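/- Let $d\ge 2$, $I=[0,1]$ and $\triangle=\{x\in I^d:\ x_1\le\dots\le x_d\}$. For $1\le i\le d$ let $q_i(dt)=\frac{1}{(d-i)!\,(i-1)!}(1-t)^{d-i}t^{i-1}\mathbf 1_I(t)\,dt$ be the $i$-th marginal of Lebesgue measure on $\triangle$, and let $$\varphi_{i,k}(t)=\sqrt{\tfrac{(2k+d)\,k!\,(k+d-1)!}{(k+d-i)!\,(k+i-1)!}}\ \sqrt{(d-i)!\,(i-1)!}\ P_k^{(d-i,i-1)}(2t-1),\qquad k\in\mathbb N,$$ where $P_k^{(\alpha,\beta)}$ are the Jacobi polynomials, given by Rodrigues' formula $P_k^{(\alpha,\beta)}(t)=\frac{(-1)^k}{2^kk!\,(1-t)^\alpha(1+t)^\beta}\frac{d^k}{dt^k}\big[(1-t)^{\alpha+k}(1+t)^{\beta+k}\big]$; the $\varphi_{i,k}$ are the orthonormal polynomials of $L^2(q_i)$. For $m=(m_1,\dots,m_d)\in(\mathbb N^*)^d$ put $|m|=\sum_i m_i$, $\varphi_m(x)=(\varphi_{i,k}(x_i))_{1\le i\le d,\,1\le k\le m_i}$, and for $\theta\in\mathbb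 R^{|m|}$ $$f_\theta=\exp(\theta\cdot\varphi_m-\psi(\theta))\mathbf 1_\triangle,\qquad \psi(\theta)=\log\int_\triangle e^{\theta\cdot\varphi_m},\qquad A_m(\theta)=\int_\triangle\varphi_m f_\theta .$$ The map $A_m$ is injective. Given a sample $X^1,\dots,X^n$, let $\hat\mu_{m,n}=\frac1n\sum_{j=1}^n\varphi_m(X^j)$. When $\hat\mu_{m,n}\in A_m(\mathbb R^{|m|})$, the maximum likelihood estimator exists and is $\hat f_{m,n}=f_{\hat\theta_{m,n}}$ with $\hat\theta_{m,n}=A_m^{-1}(\hat\mu_{m,n})$. Write $D(g\,\|\,h)=\int_\triangle g\log(g/h)$, and set $D(f^0\|\hat f_{m,n})=+\infty$ on the event that the estimator does not exist. For an integer $r\ge1$ let $W^2_r(q_i)$ be the set of $h\in L^2(q_i)$ such that $h^{(r-1)}$ is absolutely continuous on $I$ and $h^{(r)}\in L^2(q_i)$. Let $r=(r_1,\dots,r_d)$ be integers with $r_i>d$ for all $i$, let $\kappa>0$, and let $\mathcal K_r(\kappa)$ be the set of probability densities $f^0$ on $\triangle$ for which there are measurable functions $\ell_i^0\in W^2_{r_i}(q_i)$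 with $\int_I\ell_i^0q_i=0$, $\|\ell_i^0\|_\infty\le\kappa$, $\|(\ell_i^0)^{(r_i)}\|_{L^2(q_i)}\le\kappa$ ($1\le i\le d$) and $$f^0(x)=\exp\Big(\sum_{i=1}^d\ell_i^0(x_i)-a_0\Big)\ \text{ for a.e. }x\in\triangle,\qquad a_0=\log\int_\triangle\exp\Big(\sum_{i=1}^d\ell_i^0(x_i)\Big)dx .$$ Let $m(n)=(m_1(n),\dots,m_d(n))\in(\mathbb N^*)^d$, $n\ge1$, satisfy, as $n\to\infty$, $m_i(n)\to\infty$ for every $i$ and $$|m(n)|^{2d}\sum_{i=1}^d m_i(n)^{-2r_i}\to0,\qquad \frac{|m(n)|^{2d+1}}{n}\to0 .$$ For each $f^0\in\mathcal K_r(\kappa)$ let $(X^n)_{n\ge1}$ be i.i.d. with density $f^0$ under $\mathbb P=\mathbb P_{f^0}$. Then $$\lim_{K\to\infty}\ \limsup_{n\to\infty}\ \sup_{f^0\in\mathcal K_r(\kappa)}\mathbb P\Big(D\big(f^0\,\big\|\,\hat f_{m(n),n}\big)\ge K\Big(\sum_{i=1}^d m_i(n)^{-2r_i}+\frac{|m(n)|}{n}\Big)\Big)=0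 .$$ -/

import Mathlib

open MeasureTheory ProbabilityTheory Filter Topology
open scoped ENNReal Nat

namespace SimplexSeries

noncomputable section

/-- The simplex of `[0,1]^d`: nondecreasing points of the unit cube. -/
def simplex (d : ℕ) : Set (Fin d → ℝ) :=
  {x | (∀ i, x i ∈ Set.Icc (0 : ℝ) 1) ∧ Monotone x}

/-- The `i`-th one-dimensional marginal of Lebesgue measure on the simplex. The index `i : Fin d`
is zero-based, so `d - 1 - i` and `i` play the roles of `d - i` and `i - 1` for indices in
`{1, …, d}`. -/
def marginal (d : ℕ) (i : Fin d) : Measure ℝ :=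
  (volume.restrict (Set.Icc (0 : ℝ) 1)).withDensity fun t =>
    ENNReal.ofReal (((d - 1 - (i : ℕ))! * (i : ℕ)! : ℝ)⁻¹ * (1 - t) ^ (d - 1 - (i : ℕ)) *
      t ^ (i : ℕ))

/-- A probability density on the simplex (extended by zero to `ℝ^d`). -/
structure IsDensity {d : ℕ} (f : (Fin d → ℝ) → ℝ) : Prop where
  measurable : Measurable f
  nonneg : ∀ x, 0 ≤ f x
  eq_zero : ∀ x, x ∉ simplex d → f x = 0
  lintegral_eq_one : ∫⁻ x, ENNReal.ofReal (f x) = 1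

/-- The measure on `ℝ^d` with Lebesgue density `f`. -/
def densityMeasure {d : ℕ} (f : (Fin d → ℝ) → ℝ) : Measure (Fin d → ℝ) :=
  volume.withDensity fun x => ENNReal.ofReal (f x)

/-- `f` is a probability density on the simplex with a product form, with components `ℓ i`
(bounded measurable functions on `[0,1]`, centred with respect to the marginals). -/
structure HasProductForm {d : ℕ} (f : (Fin d → ℝ) → ℝ) (ℓ : Fin d → ℝ → ℝ) : Prop where
  isDensity : IsDensity f
  measurable : ∀ i, Measurable fun t : Set.Icc (0 : ℝ) 1 => ℓ i t
  bounded : ∀ i, ∃ C : ℝ, ∀ t ∈ Set.Icc (0 : ℝ) 1, |ℓ i t| ≤ C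
  centered : ∀ i, ∫ t, ℓ i t ∂(marginal d i) = 0
  ae_eq : ∀ᵐ x ∂(volume.restrict (simplex d)),
    f x = Real.exp (∑ i, ℓ i (x i) -
      Real.log (∫ y in simplex d, Real.exp (∑ i, ℓ i (y i))))

/-- The weighted Sobolev space on `[0,1]` of order `r ≥ 1`: functions in `L²(q)` that are `r - 1`
times continuously differentiable on `[0,1]` (one-sided at the endpoints), whose derivative of
order `r - 1` is absolutely continuous on `[0,1]`, and whose derivative of order `r`
(which then exists almost everywhere) is in `L²(q)`. -/
structure IsSobolev (r : ℕ) (q : Measure ℝ) (h : ℝ → ℝ) : Prop where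
  memLp : MemLp h 2 q
  contDiffOn : ContDiffOn ℝ ((r - 1 : ℕ) : WithTop ℕ∞) h (Set.Icc 0 1)
  absolutelyContinuous :
    AbsolutelyContinuousOnInterval (iteratedDerivWithin (r - 1) h (Set.Icc 0 1)) 0 1
  memLp_deriv : MemLp (iteratedDerivWithin r h (Set.Icc 0 1)) 2 q

/-- The class of product-form densities whose components lie in the Sobolev space of order `r i`,
are bounded by `κ` in sup norm on `[0,1]`, and have derivative of order `r i` bounded by `κ` in
the `L²` norm of the `i`-th marginal. -/
def productClass {d : ℕ} (r : Fin d → ℕ) (κ : ℝ) : Set ((Fin d → ℝ) → ℝ) :=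
  {f | ∃ ℓ : Fin d → ℝ → ℝ, HasProductForm f ℓ ∧ ∀ i,
    IsSobolev (r i) (marginal d i) (ℓ i) ∧
    (∀ t ∈ Set.Icc (0 : ℝ) 1, |ℓ i t| ≤ κ) ∧
    eLpNorm (iteratedDerivWithin (r i) (ℓ i) (Set.Icc 0 1)) 2 (marginal d i) ≤ ENNReal.ofReal κ}

/-- The Jacobi polynomial with natural parameters `α, β` by Rodrigues' formula. The quotient is
an exact division of polynomials, see `weight_mul_jacobi`. -/
def jacobi (α β k : ℕ) : Polynomial ℝ :=
  Polynomial.C ((-1) ^ k / (2 ^ k * (k ! : ℝ))) *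
    (Polynomial.derivative^[k]
        (((1 - Polynomial.X) ^ α * (1 + Polynomial.X) ^ β) * (1 - Polynomial.X ^ 2) ^ k) /
      ((1 - Polynomial.X) ^ α * (1 + Polynomial.X) ^ β))

theorem weight_mul_jacobi (α β k : ℕ) :
    ((1 - Polynomial.X) ^ α * (1 + Polynomial.X) ^ β) * jacobi α β k =
      Polynomial.C ((-1) ^ k / (2 ^ k * (k ! : ℝ))) * Polynomial.derivative^[k]
        (((1 - Polynomial.X) ^ α * (1 + Polynomial.X) ^ β) * (1 - Polynomial.X ^ 2) ^ k) := by
  have hcop : IsCoprime ((1 - Polynomial.X : Polynomial ℝ) ^ α) ((1 + Polynomial.X) ^ β) := by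
    apply IsCoprime.pow
    refine ⟨Polynomial.C (1 / 2), Polynomial.C (1 / 2), ?_⟩
    have h : (Polynomial.C (1 / 2) : Polynomial ℝ) + Polynomial.C (1 / 2) = 1 := by
      rw [← Polynomial.C_add]; norm_num
    linear_combination h
  have hdvd : ((1 - Polynomial.X : Polynomial ℝ) ^ α * (1 + Polynomial.X) ^ β) ∣
      Polynomial.derivative^[k]
        (((1 - Polynomial.X) ^ α * (1 + Polynomial.X) ^ β) * (1 - Polynomial.X ^ 2) ^ k) := by
    refine hcop.mul_dvd ?_ ?_
    · have h : (1 - Polynomial.X : Polynomial ℝ) ^ (α + k) ∣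
          ((1 - Polynomial.X) ^ α * (1 + Polynomial.X) ^ β) * (1 - Polynomial.X ^ 2) ^ k :=
        ⟨(1 + Polynomial.X) ^ (β + k), by
          rw [show (1 - Polynomial.X ^ 2 : Polynomial ℝ) =
            (1 - Polynomial.X) * (1 + Polynomial.X) by ring, mul_pow]
          ring⟩
      simpa using Polynomial.pow_sub_dvd_iterate_derivative_of_pow_dvd k h
    · have h : (1 + Polynomial.X : Polynomial ℝ) ^ (β + k) ∣
          ((1 - Polynomial.X) ^ α * (1 + Polynomial.X) ^ β) * (1 - Polynomial.X ^ 2) ^ k :=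
        ⟨(1 - Polynomial.X) ^ (α + k), by
          rw [show (1 - Polynomial.X ^ 2 : Polynomial ℝ) =
            (1 - Polynomial.X) * (1 + Polynomial.X) by ring, mul_pow]
          ring⟩
      simpa using Polynomial.pow_sub_dvd_iterate_derivative_of_pow_dvd k h
  obtain ⟨c, hc⟩ := hdvd
  have hne : ((1 - Polynomial.X : Polynomial ℝ) ^ α * (1 + Polynomial.X) ^ β) ≠ 0 := by
    refine mul_ne_zero (pow_ne_zero _ fun h => ?_) (pow_ne_zero _ fun h => ?_)
    · simpa using congrArg (Polynomial.eval 0) h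
    · simpa using congrArg (Polynomial.eval 0) h
  rw [jacobi, hc, mul_div_cancel_left₀ _ hne]
  ring

/-- The orthonormal polynomial of degree `k` for the `i`-th marginal: a shifted and normalised
Jacobi polynomial (`i : Fin d` zero-based). -/
def phi (d : ℕ) (i : Fin d) (k : ℕ) (t : ℝ) : ℝ :=
  √((2 * k + d : ℝ) * k ! * (k + d - 1)! / ((k + (d - 1 - (i : ℕ)))! * (k + (i : ℕ))!)) *
    √(((d - 1 - (i : ℕ))! : ℝ) * (i : ℕ)!) *
    (jacobi (d - 1 - (i : ℕ)) (i : ℕ) k).eval (2 * t - 1)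

/-- Indices of the parameter vector: `⟨i, k⟩` stands for coordinate `i` and degree `k + 1`, so that
the degrees run over `1, …, m i`. -/
abbrev ParamIndex {d : ℕ} (m : Fin d → ℕ) : Type := Σ i : Fin d, Fin (m i)

/-- The vector of basis functions at a point of `ℝ^d`. -/
def phiVec {d : ℕ} (m : Fin d → ℕ) (x : Fin d → ℝ) (p : ParamIndex m) : ℝ :=
  phi d p.1 ((p.2 : ℕ) + 1) (x p.1)

/-- The log-normalising constant of the additive exponential series model. -/
def logPartition {d : ℕ} (m : Fin d → ℕ) (θ : ParamIndex m → ℝ) : ℝ :=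
  Real.log (∫ x in simplex d, Real.exp (∑ p, θ p * phiVec m x p))

/-- The density with parameter `θ` in the additive exponential series model. -/
def modelDensity {d : ℕ} (m : Fin d → ℕ) (θ : ParamIndex m → ℝ) : (Fin d → ℝ) → ℝ :=
  (simplex d).indicator fun x => Real.exp (∑ p, θ p * phiVec m x p - logPartition m θ)

/-- The mean of the basis functions under the model density. -/
def meanMap {d : ℕ} (m : Fin d → ℕ) (θ : ParamIndex m → ℝ) (p : ParamIndex m) : ℝ :=
  ∫ x in simplex d, phiVec m x p * modelDensity m θ x

/-- The empirical mean of the basis functions over a sample of size `n`. -/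
def empiricalMean {d : ℕ} (m : Fin d → ℕ) {n : ℕ} (s : Fin n → Fin d → ℝ)
    (p : ParamIndex m) : ℝ :=
  (n : ℝ)⁻¹ * ∑ j, phiVec m (s j) p

/-- The maximum likelihood parameter: the inverse of `meanMap` at the empirical mean
(an irrelevant value if the empirical mean is not in the range of `meanMap`). -/
def mleParam {d : ℕ} (m : Fin d → ℕ) {n : ℕ} (s : Fin n → Fin d → ℝ) : ParamIndex m → ℝ :=
  Function.invFun (meanMap m) (empiricalMean m s)

open Classical in
/-- The Kullback-Leibler loss of the maximum likelihood estimator for the true density `f`,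
counted as infinite on the samples for which the estimator does not exist. -/
def mleLoss {d : ℕ} (f : (Fin d → ℝ) → ℝ) (m : Fin d → ℕ) {n : ℕ} (s : Fin n → Fin d → ℝ) :
    ℝ≥0∞ :=
  if empiricalMean m s ∈ Set.range (meanMap m) then
    InformationTheory.klDiv (densityMeasure f) (densityMeasure (modelDensity m (mleParam m s)))
  else ∞

/-- `X 0, X 1, …` are i.i.d. with density `f` under `P`. -/
structure IsIIDSample {d : ℕ} {Ω : Type*} [MeasurableSpace Ω] (P : Measure Ω)
    (X : ℕ → Ω → Fin d → ℝ) (f : (Fin d → ℝ) → ℝ) : Prop where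
  measurable : ∀ j, Measurable (X j)
  indep : iIndepFun X P
  law : ∀ j, P.map (X j) = densityMeasure f

end

end SimplexSeries

open SimplexSeries

namespace SimplexSeries

noncomputable section

/-! The estimator solves the likelihood equations of an exponential family, so it suffices to know
the Kullback-Leibler divergence near one good parameter. That parameter is `projParam`, built from
the L² projections of the ℓ_i. With the true law as base measure and -∑ ℓ_i as offset, the negative
log likelihood at θ is, up to a constant, D(f⁰‖f_θ) - θ·(μ̂ - E φ_m) (`negLogLikelihood_eq`).
Suppose D ≥ cR on the sphere of squared radius R about `projParam`, D ≤ b at its centre, |μ̂ - E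
φ_m|² ≤ δ and b + δ/(2c) < cR/2. Then convexity forces a solution to exist and every solution to lie
in the ball, with D ≤ b + (R + δ)/2 (`exists_solution_of_klTilted`). Taking R of the order of b + δ
gives the rate.

The divergence is an expectation of e^u - 1 - u for a normalised log density ratio u, and this is
comparable to u² as long as u stays bounded (`klTilted_le`, `le_klTilted`). Three analytic facts
feed this comparison.

Approximation: each derivative of ℓ_i, traded by parts against Rodrigues' formula, raises both
weight exponents and divides a squared Jacobi coefficient by about k². Bessel's inequality then
bounds the squared L² error by a multiple of m_i^(-2 r_i). As r_i > d, the coefficients also decay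
fast enough for a uniform bound on the sup norm error (`integral_sub_jacobiProj_sq_le_of_sobolev`,
`abs_sub_jacobiProj_le_of_sobolev`).

Boundedness on the ball: a Nikolskii inequality gives ‖p‖_∞² ≤ C m^(2d) ‖p‖₂² for polynomials of
degree m ≥ 1 (`sq_eval_le_integral_weightMeasure`). Parameters at squared distance R therefore
change the exponent by at most 1 when |m|^(2d) R is small, which is where the growth conditions on
m(n) enter.

Curvature: although the coordinates on the simplex are dependent, the L²(△) norm of an additive
function dominates each centred component (`integral_weightMeasure_sq_le`). The reason is that two
values s, t of one coordinate share a large fibre of completions, on which the difference of the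
function sees only that component.

Finally the expected squared deviation of the empirical moments is at most a multiple of |m|/n, so
Chebyshev's inequality with δ proportional to K|m|/n bounds the failure probability by a multiple of
1/K, uniformly over the class (`exists_measure_mleLoss_le`). -/

/-! ### Rodrigues polynomials for the weights (1 - t)^a t^b on [0, 1]. -/

/-- The polynomial `(1 - X) ^ a * X ^ b`. -/
def weightPoly (a b : ℕ) : Polynomial ℝ := (1 - Polynomial.X) ^ a * Polynomial.X ^ b

/-- The polynomial `R` such that the `k`-th derivative of `(1 - X) ^ (a + k) * X ^ (b + k)` is
`(1 - X) ^ a * X ^ b * R`. -/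
def rodrigues : ℕ → ℕ → ℕ → Polynomial ℝ
  | _, _, 0 => 1
  | a, b, k + 1 =>
    Polynomial.X * (1 - Polynomial.X) * Polynomial.derivative (rodrigues (a + 1) (b + 1) k) +
      (Polynomial.C (b + 1 : ℝ) * (1 - Polynomial.X) - Polynomial.C (a + 1 : ℝ) * Polynomial.X) *
        rodrigues (a + 1) (b + 1) k

/-- The recursion for `rodrigues` is the product rule. Raising both exponents while lowering k is
the form that later inductions need, since one integration by parts has the same effect. -/
lemma derivative_weightPoly_mul_rodrigues (a b k : ℕ) :
    Polynomial.derivative (weightPoly (a + 1) (b + 1) * rodrigues (a + 1) (b + 1) k) =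
      weightPoly a b * rodrigues a b (k + 1) := by
  simp only [rodrigues, weightPoly, Polynomial.derivative_mul, Polynomial.derivative_pow,
    Polynomial.derivative_sub, Polynomial.derivative_X, Polynomial.derivative_one]
  simp only [Nat.add_sub_cancel, Nat.cast_add, Nat.cast_one, Polynomial.C_add, Polynomial.C_1]
  ring

lemma iterate_derivative_weightPoly (a b k : ℕ) :
    Polynomial.derivative^[k] (weightPoly (a + k) (b + k)) =
      weightPoly a b * rodrigues a b k := by
  induction k generalizing a b with
  | zero => simp [rodrigues]
  | succ k ih =>
    rw [Function.iterate_succ_apply', ← derivative_weightPoly_mul_rodrigues, ← ih (a + 1) (b + 1)]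
    congr 3 <;> ring

lemma weightPoly_ne_zero (a b : ℕ) : weightPoly a b ≠ 0 := by
  refine mul_ne_zero (pow_ne_zero _ fun h => ?_) (pow_ne_zero _ Polynomial.X_ne_zero)
  simpa using congrArg (Polynomial.eval 0) h

lemma two_pow_eq_C (j : ℕ) : (2 : Polynomial ℝ) ^ j = Polynomial.C (2 ^ j) := by
  rw [map_pow]; rfl

lemma iterate_derivative_comp_affine (p : Polynomial ℝ) (k : ℕ) :
    Polynomial.derivative^[k] (p.comp (2 * Polynomial.X - 1)) =
      2 ^ k * (Polynomial.derivative^[k] p).comp (2 * Polynomial.X - 1) := by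
  induction k with
  | zero => simp
  | succ k ih =>
    have h2 : Polynomial.derivative ((2 : Polynomial ℝ) ^ k) = 0 := by
      rw [two_pow_eq_C, Polynomial.derivative_C]
    rw [Function.iterate_succ_apply', ih, Function.iterate_succ_apply', Polynomial.derivative_mul,
      Polynomial.derivative_comp, h2]
    simp
    ring

/-- Under t ↦ 2t - 1 the factors 1 - X and 1 + X become 2(1 - X) and 2X, so both Rodrigues formulas
agree up to powers of two. The chain rule supplies one 2^k and the normalisation of `jacobi`
another, and the nonzero weight is cancelled. -/
lemma jacobi_comp_affine (a b k : ℕ) :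
    (jacobi a b k).comp (2 * Polynomial.X - 1) =
      Polynomial.C ((-1) ^ k / (k ! : ℝ)) * rodrigues a b k := by
  have h := congrArg (fun p => Polynomial.comp p (2 * Polynomial.X - 1)) (weight_mul_jacobi a b k)
  simp only [Polynomial.mul_comp, Polynomial.C_comp] at h
  have h1 : (2 : Polynomial ℝ) ^ k * (Polynomial.derivative^[k]
      (((1 - Polynomial.X) ^ a * (1 + Polynomial.X) ^ b) * (1 - Polynomial.X ^ 2) ^ k)).comp
        (2 * Polynomial.X - 1) = 2 ^ (a + b + 2 * k) * (weightPoly a b * rodrigues a b k) := by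
    rw [← iterate_derivative_comp_affine, ← iterate_derivative_weightPoly]
    have : ((((1 - Polynomial.X) ^ a * (1 + Polynomial.X) ^ b) *
        (1 - Polynomial.X ^ 2) ^ k : Polynomial ℝ)).comp (2 * Polynomial.X - 1) =
        Polynomial.C (2 ^ (a + b + 2 * k)) * weightPoly (a + k) (b + k) := by
      simp only [Polynomial.mul_comp, Polynomial.pow_comp, Polynomial.sub_comp,
        Polynomial.add_comp, Polynomial.one_comp, Polynomial.X_comp, weightPoly]
      have e1 : (1 - (2 * Polynomial.X - 1) : Polynomial ℝ) = 2 * (1 - Polynomial.X) := by ring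
      have e2 : (1 + (2 * Polynomial.X - 1) : Polynomial ℝ) = 2 * Polynomial.X := by ring
      have e3 : (1 - (2 * Polynomial.X - 1) ^ 2 : Polynomial ℝ) =
        2 ^ 2 * ((1 - Polynomial.X) * Polynomial.X) := by ring
      rw [e1, e2, e3, ← two_pow_eq_C]
      simp only [mul_pow, ← pow_mul]
      ring
    rw [this, Polynomial.iterate_derivative_C_mul, two_pow_eq_C]
  have h2 : ((1 - Polynomial.X : Polynomial ℝ) ^ a).comp (2 * Polynomial.X - 1) *
      ((1 + Polynomial.X : Polynomial ℝ) ^ b).comp (2 * Polynomial.X - 1) =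
      2 ^ (a + b) * weightPoly a b := by
    simp only [Polynomial.pow_comp, Polynomial.sub_comp,
        Polynomial.add_comp, Polynomial.one_comp, Polynomial.X_comp, weightPoly]
    have e1 : (1 - (2 * Polynomial.X - 1) : Polynomial ℝ) = 2 * (1 - Polynomial.X) := by ring
    have e2 : (1 + (2 * Polynomial.X - 1) : Polynomial ℝ) = 2 * Polynomial.X := by ring
    rw [e1, e2, mul_pow, mul_pow]
    ring
  rw [h2] at h
  have hC : (2 : Polynomial ℝ) ^ (2 * k) * Polynomial.C ((-1) ^ k / (2 ^ k * (k ! : ℝ))) =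
      2 ^ k * Polynomial.C ((-1) ^ k / (k ! : ℝ)) := by
    rw [two_pow_eq_C, two_pow_eq_C, ← Polynomial.C_mul, ← Polynomial.C_mul]
    congr 1
    have : (k ! : ℝ) ≠ 0 := by positivity
    field_simp
    ring
  have h2k : (2 : Polynomial ℝ) ^ k ≠ 0 := pow_ne_zero _ two_ne_zero
  have h2ab : (2 : Polynomial ℝ) ^ (a + b) ≠ 0 := pow_ne_zero _ two_ne_zero
  apply mul_left_cancel₀ (mul_ne_zero (mul_ne_zero h2ab (weightPoly_ne_zero a b)) h2k)
  calc 2 ^ (a + b) * weightPoly a b * 2 ^ k * (jacobi a b k).comp (2 * Polynomial.X - 1)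
      = 2 ^ k * (2 ^ (a + b) * weightPoly a b * (jacobi a b k).comp (2 * Polynomial.X - 1)) := by
        ring
    _ = Polynomial.C ((-1) ^ k / (2 ^ k * (k ! : ℝ))) * (2 ^ (a + b + 2 * k) *
          (weightPoly a b * rodrigues a b k)) := by rw [h, ← h1]; ring
    _ = 2 ^ (a + b) * weightPoly a b * rodrigues a b k *
          (2 ^ (2 * k) * Polynomial.C ((-1) ^ k / (2 ^ k * (k ! : ℝ)))) := by ring
    _ = _ := by rw [hC]; ring

lemma natDegree_rodrigues_le (a b k : ℕ) : (rodrigues a b k).natDegree ≤ k := by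
  induction k generalizing a b with
  | zero => simp [rodrigues]
  | succ k ih =>
    have h := ih (a + 1) (b + 1)
    simp only [rodrigues]
    -- The count 2 + (k - 1) ≤ k + 1 fails for truncated subtraction at k = 0, where the derivative
    -- term vanishes anyway.
    rcases Nat.eq_zero_or_pos k with rfl | hk
    · simp only [rodrigues, Polynomial.derivative_one, mul_zero, zero_add, mul_one]
      compute_degree
    have h' : (Polynomial.derivative (rodrigues (a + 1) (b + 1) k)).natDegree ≤ k - 1 :=
      (Polynomial.natDegree_derivative_le _).trans (by omega)
    refine Polynomial.natDegree_add_le_of_degree_le ?_ ?_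
    · refine (Polynomial.natDegree_mul_le_of_le (m := 2) (n := k - 1) ?_ h').trans (by omega)
      compute_degree
    · refine (Polynomial.natDegree_mul_le_of_le (m := 1) (n := k) ?_ h).trans (by omega)
      compute_degree

/-- In the top degree the recursion multiplies by -(k + a + b + 2): -k from the derivative term and
-(a + b + 2) from the linear factor. -/
lemma coeff_rodrigues (a b k : ℕ) :
    (rodrigues a b k).coeff k = (-1) ^ k * (a + b + 2 * k)! / ((a + b + k)! : ℝ) := by
  induction k generalizing a b with
  | zero =>
    have : ((a + b)! : ℝ) ≠ 0 := by positivity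
    simp [rodrigues, this]
  | succ k ih =>
    have h := ih (a + 1) (b + 1)
    have hz : (rodrigues (a + 1) (b + 1) k).coeff (k + 1) = 0 :=
      Polynomial.coeff_eq_zero_of_natDegree_lt
        (Nat.lt_succ_of_le (natDegree_rodrigues_le (a + 1) (b + 1) k))
    have hexp : rodrigues a b (k + 1) = (b + 1 : ℝ) • rodrigues (a + 1) (b + 1) k +
        Polynomial.derivative (rodrigues (a + 1) (b + 1) k) * Polynomial.X -
        Polynomial.derivative (rodrigues (a + 1) (b + 1) k) * Polynomial.X * Polynomial.X -
        (a + b + 2 : ℝ) • (rodrigues (a + 1) (b + 1) k * Polynomial.X) := by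
      simp only [rodrigues, Polynomial.smul_eq_C_mul, Polynomial.C_add, Polynomial.C_1,
        Polynomial.C_ofNat]
      ring
    have hz' : (Polynomial.derivative (rodrigues (a + 1) (b + 1) k)).coeff k = 0 := by
      rw [Polynomial.coeff_derivative, hz, zero_mul]
    have hd : (Polynomial.derivative (rodrigues (a + 1) (b + 1) k) * Polynomial.X).coeff k =
        k * (rodrigues (a + 1) (b + 1) k).coeff k := by
      cases k with
      | zero => simp
      | succ k =>
        rw [Polynomial.coeff_mul_X, Polynomial.coeff_derivative]; push_cast; ring
    rw [hexp]
    simp only [Polynomial.coeff_add, Polynomial.coeff_sub, Polynomial.coeff_smul, smul_eq_mul,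
      Polynomial.coeff_mul_X, hz, hz', hd]
    rw [h]
    have e1 : a + 1 + (b + 1) + 2 * k = a + b + 2 * (k + 1) := by ring
    have e2 : a + 1 + (b + 1) + k = (a + b + (k + 1)) + 1 := by ring
    rw [e1, e2, Nat.factorial_succ]
    have : ((a + b + (k + 1))! : ℝ) ≠ 0 := by positivity
    have h3 : ((a : ℝ) + b + (k + 1) + 1) ≠ 0 := by positivity
    push_cast
    field_simp
    ring

/-- At an endpoint the factor X(1 - X) kills the derivative term of the recursion. These exact
endpoint values are the input of the Nikolskii inequality. -/
lemma eval_one_rodrigues (a b k : ℕ) :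
    (rodrigues a b k).eval 1 = (-1) ^ k * (a + k)! / (a ! : ℝ) := by
  induction k generalizing a b with
  | zero =>
    have : (a ! : ℝ) ≠ 0 := by positivity
    simp [rodrigues, this]
  | succ k ih =>
    simp only [rodrigues]
    simp [ih]
    rw [show a + 1 + k = a + (k + 1) by ring, Nat.factorial_succ a]
    have : (a ! : ℝ) ≠ 0 := by positivity
    push_cast
    field_simp
    ring

lemma eval_zero_rodrigues (a b k : ℕ) :
    (rodrigues a b k).eval 0 = (b + k)! / (b ! : ℝ) := by
  induction k generalizing a b with
  | zero =>
    have : (b ! : ℝ) ≠ 0 := by positivity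
    simp [rodrigues, this]
  | succ k ih =>
    simp only [rodrigues]
    simp [ih]
    rw [show b + 1 + k = b + (k + 1) by ring, Nat.factorial_succ b]
    have : (b ! : ℝ) ≠ 0 := by positivity
    push_cast
    field_simp

lemma eval_weightPoly (a b : ℕ) (t : ℝ) : (weightPoly a b).eval t = (1 - t) ^ a * t ^ b := by
  simp [weightPoly]

/-! ### Integration by parts, orthogonality and norms. -/

lemma absolutelyContinuousOnInterval_eval (p : Polynomial ℝ) :
    AbsolutelyContinuousOnInterval (fun t => p.eval t) 0 1 := by
  have h : ContDiffOn ℝ 1 (fun t => p.eval t) (Set.uIcc 0 1) := by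
    simpa [Polynomial.aeval_def, Polynomial.eval₂_eq_eval_map] using
      (p.contDiff_aeval (R := ℝ) (𝕜 := ℝ) 1).contDiffOn (s := Set.uIcc (0 : ℝ) 1)
  exact h.absolutelyContinuousOnInterval

/-- One integration by parts against a Rodrigues polynomial. -/
lemma integral_weight_rodrigues_succ_mul (a b k : ℕ) {h : ℝ → ℝ}
    (hh : AbsolutelyContinuousOnInterval h 0 1) :
    ∫ t in (0 : ℝ)..1, (1 - t) ^ a * t ^ b * ((rodrigues a b (k + 1)).eval t * h t) =
      -∫ t in (0 : ℝ)..1, (1 - t) ^ (a + 1) * t ^ (b + 1) *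
        ((rodrigues (a + 1) (b + 1) k).eval t * deriv h t) := by
  have hd (t : ℝ) : deriv (fun t => (weightPoly (a + 1) (b + 1) *
      rodrigues (a + 1) (b + 1) k).eval t) t = (weightPoly a b * rodrigues a b (k + 1)).eval t := by
    rw [← derivative_weightPoly_mul_rodrigues, Polynomial.deriv]
  have := AbsolutelyContinuousOnInterval.integral_mul_deriv_eq_deriv_mul
    (absolutelyContinuousOnInterval_eval (weightPoly (a + 1) (b + 1) * rodrigues (a + 1) (b + 1) k))
    hh
  simp only [hd] at this
  simp only [Polynomial.eval_mul, eval_weightPoly] at this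
  -- No boundary terms remain: the raised exponents a + 1 and b + 1 are positive, so the weight
  -- vanishes at both endpoints.
  simp only [ne_eq, Nat.add_eq_zero_iff, one_ne_zero, and_false, not_false_eq_true, zero_pow,
    sub_self, zero_mul, mul_zero, zero_sub] at this
  simp only [← mul_assoc] at this ⊢
  rw [this, neg_neg]

/-- Beta integral. The derivative of (1 - t)^(a+1) t^(b+1) integrates to zero, which trades a power
of 1 - t for a power of t. -/
lemma integral_weight (a b : ℕ) :
    ∫ t in (0 : ℝ)..1, (1 - t) ^ a * t ^ b = a ! * b ! / ((a + b + 1)! : ℝ) := by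
  induction a generalizing b with
  | zero =>
    simp only [pow_zero, one_mul, integral_pow]
    rw [show 0 + b + 1 = b + 1 by ring, Nat.factorial_succ]
    have : (b ! : ℝ) ≠ 0 := by positivity
    simp
    field_simp
  | succ a ih =>
    have h0 : ∫ t in (0 : ℝ)..1, ((b + 1 : ℝ) * ((1 - t) ^ (a + 1) * t ^ b) -
        (a + 1) * ((1 - t) ^ a * t ^ (b + 1))) = 0 := by
      have := intervalIntegral.integral_eq_sub_of_hasDerivAt (a := 0) (b := 1)
        (f := fun t : ℝ => (1 - t) ^ (a + 1) * t ^ (b + 1))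
        (f' := fun t : ℝ => ((b + 1 : ℝ) * ((1 - t) ^ (a + 1) * t ^ b) -
          (a + 1) * ((1 - t) ^ a * t ^ (b + 1)))) ?_ ?_
      · rw [this]; simp
      · intro t _
        have h1 : HasDerivAt (fun t : ℝ => (1 - t) ^ (a + 1)) _ t :=
          ((hasDerivAt_id t).const_sub 1).pow (a + 1)
        have h2 : HasDerivAt (fun t : ℝ => t ^ (b + 1)) _ t := hasDerivAt_pow (b + 1) t
        refine (h1.mul h2).congr_deriv ?_
        simp
        ring
      · exact Continuous.intervalIntegrable (by fun_prop) _ _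
    rw [intervalIntegral.integral_sub (Continuous.intervalIntegrable (by fun_prop) _ _)
      (Continuous.intervalIntegrable (by fun_prop) _ _), intervalIntegral.integral_const_mul,
      intervalIntegral.integral_const_mul, ih (b + 1)] at h0
    have hb : (b + 1 : ℝ) ≠ 0 := by positivity
    have h1 : ∫ t in (0 : ℝ)..1, (1 - t) ^ (a + 1) * t ^ b =
        (a + 1) * (a ! * (b + 1)! / (a + (b + 1) + 1)!) / (b + 1 : ℝ) := by
      rw [eq_div_iff hb]
      linarith
    rw [h1, show a + 1 + b + 1 = a + (b + 1) + 1 by ring, Nat.factorial_succ b,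
      Nat.factorial_succ a]
    have : ((a + (b + 1) + 1)! : ℝ) ≠ 0 := by positivity
    push_cast
    field_simp

/-- All k derivatives move onto p. Degree below k then gives orthogonality, and p equal to the
Rodrigues polynomial itself leaves its leading coefficient times a Beta integral. -/
lemma integral_weight_rodrigues_mul_eval (a b k : ℕ) (p : Polynomial ℝ) :
    ∫ t in (0 : ℝ)..1, (1 - t) ^ a * t ^ b * ((rodrigues a b k).eval t * p.eval t) =
      (-1) ^ k * ∫ t in (0 : ℝ)..1, (1 - t) ^ (a + k) * t ^ (b + k) *
        (Polynomial.derivative^[k] p).eval t := by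
  induction k generalizing a b p with
  | zero => simp [rodrigues]
  | succ k ih =>
    rw [integral_weight_rodrigues_succ_mul a b k (absolutelyContinuousOnInterval_eval p)]
    simp only [Polynomial.deriv]
    rw [ih (a + 1) (b + 1) (Polynomial.derivative p), ← Function.iterate_succ_apply,
      show a + 1 + k = a + (k + 1) by ring, show b + 1 + k = b + (k + 1) by ring]
    ring

/-- The squared norm of `rodrigues a b k` for the weight `(1 - t) ^ a * t ^ b`. -/
def rodriguesNormSq (a b k : ℕ) : ℝ :=
  k ! * (a + k)! * (b + k)! / ((a + b + k)! * (a + b + 2 * k + 1))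

lemma rodriguesNormSq_pos (a b k : ℕ) : 0 < rodriguesNormSq a b k := by
  unfold rodriguesNormSq; positivity

lemma integral_weight_rodrigues_mul_of_natDegree_lt {a b k : ℕ} {p : Polynomial ℝ}
    (hp : p.natDegree < k) :
    ∫ t in (0 : ℝ)..1, (1 - t) ^ a * t ^ b * ((rodrigues a b k).eval t * p.eval t) = 0 := by
  rw [integral_weight_rodrigues_mul_eval, Polynomial.iterate_derivative_eq_zero hp]
  simp

lemma integral_weight_rodrigues_sq (a b k : ℕ) :
    ∫ t in (0 : ℝ)..1, (1 - t) ^ a * t ^ b *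
      ((rodrigues a b k).eval t * (rodrigues a b k).eval t) = rodriguesNormSq a b k := by
  rw [integral_weight_rodrigues_mul_eval]
  have h1 : Polynomial.derivative^[k] (rodrigues a b k) =
      Polynomial.C (k ! * (rodrigues a b k).coeff k) := by
    ext j
    rw [Polynomial.coeff_iterate_derivative]
    cases j with
    | zero => simp [Nat.descFactorial_self]
    | succ j =>
      rw [Polynomial.coeff_eq_zero_of_natDegree_lt
        (lt_of_le_of_lt (natDegree_rodrigues_le a b k) (by omega))]
      simp
  rw [h1]
  simp only [Polynomial.eval_C, intervalIntegral.integral_mul_const, integral_weight,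
    coeff_rodrigues, rodriguesNormSq]
  rw [show a + k + (b + k) + 1 = (a + b + 2 * k) + 1 by ring, Nat.factorial_succ]
  have h2 : ((a + b + 2 * k)! : ℝ) ≠ 0 := by positivity
  have h3 : ((a + b + k)! : ℝ) ≠ 0 := by positivity
  have h4 : ((a : ℝ) + b + 2 * k + 1) ≠ 0 := by positivity
  have h5 : ((-1 : ℝ) ^ k) * (-1) ^ k = 1 := by rw [← mul_pow]; simp
  push_cast
  field_simp
  linear_combination h5

lemma integral_weight_rodrigues_mul_of_ne {a b k l : ℕ} (h : k ≠ l) :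
    ∫ t in (0 : ℝ)..1, (1 - t) ^ a * t ^ b *
      ((rodrigues a b k).eval t * (rodrigues a b l).eval t) = 0 := by
  rcases lt_or_gt_of_ne h with h | h
  · simp only [mul_comm ((rodrigues a b k).eval _)]
    exact integral_weight_rodrigues_mul_of_natDegree_lt
      ((natDegree_rodrigues_le a b k).trans_lt h)
  · exact integral_weight_rodrigues_mul_of_natDegree_lt
      ((natDegree_rodrigues_le a b l).trans_lt h)

/-- The ratio of the norms for two weights linked by differentiation is the gain per derivative in
the decay of coefficients. -/
lemma rodriguesNormSq_succ (a b k : ℕ) :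
    rodriguesNormSq a b (k + 1) =
      (k + 1) * (a + b + k + 2) * rodriguesNormSq (a + 1) (b + 1) k := by
  unfold rodriguesNormSq
  rw [show a + (k + 1) = a + 1 + k by ring, show b + (k + 1) = b + 1 + k by ring,
    show a + 1 + (b + 1) + k = (a + b + (k + 1)) + 1 by ring, Nat.factorial_succ (a + b + (k + 1)),
    Nat.factorial_succ k]
  have h3 : ((a + b + (k + 1))! : ℝ) ≠ 0 := by positivity
  push_cast
  have h4 : ((a : ℝ) + b + 2 * (k + 1) + 1) ≠ 0 := by positivity
  have h5 : ((a : ℝ) + b + (k + 1) + 1) ≠ 0 := by positivity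
  have h6 : ((a : ℝ) + 1 + (b + 1) + 2 * k + 1) ≠ 0 := by positivity
  field_simp
  ring

/-! ### Finite orthonormal systems of square integrable functions -/

section Orthonormal

variable {α ι : Type*} [MeasurableSpace α] [DecidableEq ι]

/-- The coefficients are arbitrary on purpose: the true ones give Bessel's inequality and the
projection error, other choices give the best approximation property. -/
lemma integral_sub_sum_sq {μ : Measure α} {e : ι → α → ℝ} (he : ∀ k, MemLp (e k) 2 μ)
    (horth : ∀ k l, ∫ x, e k x * e l x ∂μ = if k = l then 1 else 0) {g : α → ℝ}
    (hg : MemLp g 2 μ) (s : Finset ι) (θ : ι → ℝ) :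
    ∫ x, (g x - ∑ k ∈ s, θ k * e k x) ^ 2 ∂μ =
      ∫ x, g x ^ 2 ∂μ - 2 * ∑ k ∈ s, θ k * ∫ x, g x * e k x ∂μ + ∑ k ∈ s, θ k ^ 2 := by
  have hexp : ∀ x, (g x - ∑ k ∈ s, θ k * e k x) ^ 2 =
      g x ^ 2 - 2 * (∑ k ∈ s, θ k * (g x * e k x)) +
        ∑ k ∈ s, ∑ l ∈ s, θ k * θ l * (e k x * e l x) := by
    intro x
    have : ∑ k ∈ s, ∑ l ∈ s, θ k * θ l * (e k x * e l x) = (∑ k ∈ s, θ k * e k x) ^ 2 := by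
      rw [sq, Finset.sum_mul_sum]
      exact Finset.sum_congr rfl fun k _ => Finset.sum_congr rfl fun l _ => by ring
    rw [this, sub_sq, Finset.mul_sum, Finset.mul_sum]
    congr 2
    exact Finset.sum_congr rfl fun k _ => by ring
  have i1 : Integrable (fun x => g x ^ 2) μ := hg.integrable_sq
  have i2 : ∀ k, Integrable (fun x => θ k * (g x * e k x)) μ := fun k =>
    (hg.integrable_mul (he k)).const_mul _
  have i3 : ∀ k l, Integrable (fun x => θ k * θ l * (e k x * e l x)) μ := fun k l =>
    ((he k).integrable_mul (he l)).const_mul _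
  have i2' : Integrable (fun x => 2 * ∑ k ∈ s, θ k * (g x * e k x)) μ :=
    (integrable_finsetSum _ fun k _ => i2 k).const_mul _
  have i3' : Integrable (fun x => ∑ k ∈ s, ∑ l ∈ s, θ k * θ l * (e k x * e l x)) μ :=
    integrable_finsetSum _ fun k _ => integrable_finsetSum _ fun l _ => i3 k l
  simp_rw [hexp]
  have i12 : Integrable (fun x => g x ^ 2 - 2 * ∑ k ∈ s, θ k * (g x * e k x)) μ := i1.sub i2'
  rw [integral_add i12 i3', integral_sub i1 i2', integral_const_mul,
    integral_finsetSum _ (fun k _ => i2 k),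
    integral_finsetSum _ (fun k _ => integrable_finsetSum _ fun l _ => i3 k l)]
  congr 1
  · simp_rw [integral_const_mul]
  · refine Finset.sum_congr rfl fun k hk => ?_
    rw [integral_finsetSum _ (fun l _ => i3 k l)]
    simp_rw [integral_const_mul, horth]
    simp [hk, sq]

lemma sum_sq_coeff_le {μ : Measure α} {e : ι → α → ℝ} (he : ∀ k, MemLp (e k) 2 μ)
    (horth : ∀ k l, ∫ x, e k x * e l x ∂μ = if k = l then 1 else 0) {g : α → ℝ}
    (hg : MemLp g 2 μ) (s : Finset ι) :
    ∑ k ∈ s, (∫ x, g x * e k x ∂μ) ^ 2 ≤ ∫ x, g x ^ 2 ∂μ := by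
  have h := integral_sub_sum_sq he horth hg s (fun k => ∫ x, g x * e k x ∂μ)
  have h0 : 0 ≤ ∫ x, (g x - ∑ k ∈ s, (∫ x, g x * e k x ∂μ) * e k x) ^ 2 ∂μ :=
    integral_nonneg fun x => sq_nonneg _
  simp_rw [← sq] at h
  linarith

end Orthonormal

/-! ### The Jacobi weights on the unit interval -/

/-- The measure with density `(1 - t) ^ a * t ^ b` on `[0, 1]`. -/
def weightMeasure (a b : ℕ) : Measure ℝ :=
  (volume.restrict (Set.Icc (0 : ℝ) 1)).withDensity fun t => ENNReal.ofReal ((1 - t) ^ a * t ^ b)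

lemma measurable_weight (a b : ℕ) :
    Measurable fun t : ℝ => ENNReal.ofReal ((1 - t) ^ a * t ^ b) := by fun_prop

lemma weight_nonneg {a b : ℕ} {t : ℝ} (ht : t ∈ Set.Icc (0 : ℝ) 1) : 0 ≤ (1 - t) ^ a * t ^ b :=
  mul_nonneg (pow_nonneg (sub_nonneg.2 ht.2) _) (pow_nonneg ht.1 _)

lemma weight_le_one {a b : ℕ} {t : ℝ} (ht : t ∈ Set.Icc (0 : ℝ) 1) : (1 - t) ^ a * t ^ b ≤ 1 :=
  mul_le_one₀ (pow_le_one₀ (sub_nonneg.2 ht.2) (by linarith [ht.1])) (pow_nonneg ht.1 _)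
    (pow_le_one₀ ht.1 ht.2)

lemma weightMeasure_le (a b : ℕ) : weightMeasure a b ≤ volume.restrict (Set.Icc (0 : ℝ) 1) := by
  conv_rhs => rw [← withDensity_one (μ := volume.restrict (Set.Icc (0 : ℝ) 1))]
  refine withDensity_mono ?_
  filter_upwards [ae_restrict_mem measurableSet_Icc] with t ht
  exact ENNReal.ofReal_le_one.2 (weight_le_one ht)

instance (a b : ℕ) : IsFiniteMeasure (weightMeasure a b) :=
  isFiniteMeasure_of_le _ (weightMeasure_le a b)

lemma ae_mem_Icc_weightMeasure (a b : ℕ) : ∀ᵐ t ∂(weightMeasure a b), t ∈ Set.Icc (0 : ℝ) 1 :=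
  (weightMeasure_le a b).absolutelyContinuous.ae_le (ae_restrict_mem measurableSet_Icc)

lemma integral_weightMeasure (a b : ℕ) (g : ℝ → ℝ) :
    ∫ t, g t ∂(weightMeasure a b) = ∫ t in (0 : ℝ)..1, (1 - t) ^ a * t ^ b * g t := by
  rw [weightMeasure, integral_withDensity_eq_integral_toReal_smul (measurable_weight a b)
    (ae_of_all _ fun _ => ENNReal.ofReal_lt_top), intervalIntegral.integral_of_le zero_le_one,
    ← integral_Icc_eq_integral_Ioc]
  refine setIntegral_congr_fun measurableSet_Icc fun t ht => ?_
  simp only [smul_eq_mul, ENNReal.toReal_ofReal (weight_nonneg ht)]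

lemma marginal_eq (d : ℕ) (i : Fin d) :
    marginal d i = ENNReal.ofReal (((d - 1 - (i : ℕ))! * (i : ℕ)! : ℝ)⁻¹) •
      weightMeasure (d - 1 - (i : ℕ)) i := by
  rw [marginal, weightMeasure, ← withDensity_smul _ (measurable_weight _ _)]
  congr 1
  ext t
  rw [Pi.smul_apply, smul_eq_mul, ← ENNReal.ofReal_mul (by positivity)]
  ring_nf

lemma integral_marginal (d : ℕ) (i : Fin d) (g : ℝ → ℝ) :
    ∫ t, g t ∂(marginal d i) =
      ((d - 1 - (i : ℕ))! * (i : ℕ)! : ℝ)⁻¹ * ∫ t, g t ∂(weightMeasure (d - 1 - (i : ℕ)) i) := by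
  rw [marginal_eq, integral_smul_measure, ENNReal.toReal_ofReal (by positivity), smul_eq_mul]

lemma weightMeasure_succ_le (a b : ℕ) : weightMeasure (a + 1) (b + 1) ≤ weightMeasure a b := by
  refine withDensity_mono ?_
  filter_upwards [ae_restrict_mem measurableSet_Icc] with t ht
  refine ENNReal.ofReal_le_ofReal ?_
  have h1 := weight_nonneg (a := a) (b := b) ht
  have h2 : (1 - t) * t ≤ 1 := by nlinarith [ht.1, ht.2]
  calc (1 - t) ^ (a + 1) * t ^ (b + 1) = ((1 - t) ^ a * t ^ b) * ((1 - t) * t) := by ring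
    _ ≤ ((1 - t) ^ a * t ^ b) * 1 := by gcongr
    _ = _ := mul_one _

lemma weightMeasure_add_le (a b r : ℕ) : weightMeasure (a + r) (b + r) ≤ weightMeasure a b := by
  induction r with
  | zero => exact le_rfl
  | succ r ih => exact (weightMeasure_succ_le _ _).trans ih

lemma memLp_of_continuousOn_Icc {a b : ℕ} {g : ℝ → ℝ} (hg : ContinuousOn g (Set.Icc 0 1))
    (p : ℝ≥0∞) : MemLp g p (weightMeasure a b) := by
  obtain ⟨C, hC⟩ := isCompact_Icc.exists_bound_of_continuousOn hg
  have h : MemLp g p (volume.restrict (Set.Icc (0 : ℝ) 1)) :=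
    MemLp.of_bound (hg.aestronglyMeasurable measurableSet_Icc) C
      ((ae_restrict_mem measurableSet_Icc).mono fun t ht => hC t ht)
  exact h.mono_measure (weightMeasure_le a b)

/-! ### Orthonormal Jacobi polynomials on the unit interval -/

/-- The normalised Rodrigues polynomials, as functions. -/
def jacobiFun (a b k : ℕ) (t : ℝ) : ℝ := (rodrigues a b k).eval t / √(rodriguesNormSq a b k)

lemma continuous_jacobiFun (a b k : ℕ) : Continuous (jacobiFun a b k) :=
  (rodrigues a b k).continuous.div_const _

lemma memLp_jacobiFun (a b k : ℕ) (p : ℝ≥0∞) : MemLp (jacobiFun a b k) p (weightMeasure a b) :=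
  memLp_of_continuousOn_Icc (continuous_jacobiFun a b k).continuousOn p

lemma integral_jacobiFun_mul (a b k l : ℕ) :
    ∫ t, jacobiFun a b k t * jacobiFun a b l t ∂(weightMeasure a b) = if k = l then 1 else 0 := by
  have h : ∀ t, (1 - t) ^ a * t ^ b * (jacobiFun a b k t * jacobiFun a b l t) =
      (1 - t) ^ a * t ^ b * ((rodrigues a b k).eval t * (rodrigues a b l).eval t) *
        (√(rodriguesNormSq a b k) * √(rodriguesNormSq a b l))⁻¹ := by
    intro t; simp only [jacobiFun, div_eq_mul_inv, mul_inv]; ring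
  simp_rw [integral_weightMeasure, h, intervalIntegral.integral_mul_const]
  split_ifs with hkl
  · subst hkl
    rw [integral_weight_rodrigues_sq, Real.mul_self_sqrt (rodriguesNormSq_pos _ _ _).le,
      mul_inv_cancel₀ (rodriguesNormSq_pos _ _ _).ne']
  · rw [integral_weight_rodrigues_mul_of_ne hkl, zero_mul]

/-- The coefficients of a function in the basis `jacobiFun`. -/
def jacobiCoeff (a b k : ℕ) (h : ℝ → ℝ) : ℝ := ∫ t, h t * jacobiFun a b k t ∂(weightMeasure a b)

/-- One integration by parts, normalised by `rodriguesNormSq_succ`; squaring removes the sign.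
Absolute continuity is enough, which matters for the last derivative of a Sobolev function. -/
lemma jacobiCoeff_succ (a b k : ℕ) {h : ℝ → ℝ} (hh : AbsolutelyContinuousOnInterval h 0 1) :
    jacobiCoeff a b (k + 1) h ^ 2 =
      jacobiCoeff (a + 1) (b + 1) k (deriv h) ^ 2 / ((k + 1) * (a + b + k + 2)) := by
  have h1 : ∀ t, (1 - t) ^ a * t ^ b * (h t * jacobiFun a b (k + 1) t) =
      (1 - t) ^ a * t ^ b * ((rodrigues a b (k + 1)).eval t * h t) *
        (√(rodriguesNormSq a b (k + 1)))⁻¹ := by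
    intro t; simp only [jacobiFun, div_eq_mul_inv]; ring
  have h2 : ∀ t, (1 - t) ^ (a + 1) * t ^ (b + 1) * (deriv h t * jacobiFun (a + 1) (b + 1) k t) =
      (1 - t) ^ (a + 1) * t ^ (b + 1) * ((rodrigues (a + 1) (b + 1) k).eval t * deriv h t) *
        (√(rodriguesNormSq (a + 1) (b + 1) k))⁻¹ := by
    intro t; simp only [jacobiFun, div_eq_mul_inv]; ring
  simp_rw [jacobiCoeff, integral_weightMeasure, h1, h2, intervalIntegral.integral_mul_const,
    integral_weight_rodrigues_succ_mul a b k hh, mul_pow, inv_pow,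
    Real.sq_sqrt (rodriguesNormSq_pos _ _ _).le, rodriguesNormSq_succ]
  have h3 := (rodriguesNormSq_pos (a + 1) (b + 1) k).ne'
  have h4 : (a : ℝ) + b + k + 2 ≠ 0 := by positivity
  field_simp

lemma jacobiCoeff_congr {a b k : ℕ} {g h : ℝ → ℝ} (hgh : Set.EqOn g h (Set.Ioo 0 1)) :
    jacobiCoeff a b k g = jacobiCoeff a b k h := by
  refine integral_congr_ae ?_
  have : ∀ᵐ t ∂(volume.restrict (Set.Icc (0 : ℝ) 1)), t ∈ Set.Ioo (0 : ℝ) 1 := by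
    rw [← Measure.restrict_congr_set Ioo_ae_eq_Icc]
    exact ae_restrict_mem measurableSet_Ioo
  filter_upwards [(weightMeasure_le a b).absolutelyContinuous.ae_le this] with t ht
  rw [hgh ht]

/-- Decay of the coefficients of a function with `r` derivatives, where `h j` is the derivative of
order `j`. -/
lemma jacobiCoeff_sq_le {r : ℕ} {h : ℕ → ℝ → ℝ}
    (hac : ∀ j < r, AbsolutelyContinuousOnInterval (h j) 0 1)
    (hderiv : ∀ j < r, Set.EqOn (deriv (h j)) (h (j + 1)) (Set.Ioo 0 1)) (a b k : ℕ) :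
    jacobiCoeff a b (k + r) (h 0) ^ 2 * (k + 1) ^ (2 * r) ≤
      jacobiCoeff (a + r) (b + r) k (h r) ^ 2 := by
  induction r generalizing a b h with
  | zero => simp
  | succ r ih =>
    have h1 := ih (h := fun j => h (j + 1)) (fun j hj => hac (j + 1) (by omega))
      (fun j hj => hderiv (j + 1) (by omega)) (a + 1) (b + 1)
    simp only [zero_add] at h1
    rw [show a + 1 + r = a + (r + 1) by ring, show b + 1 + r = b + (r + 1) by ring] at h1
    refine le_trans ?_ h1
    rw [show k + (r + 1) = k + r + 1 by ring, jacobiCoeff_succ a b _ (hac 0 (by omega)),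
      jacobiCoeff_congr (hderiv 0 (by omega)), zero_add]
    have h2 : ((k : ℝ) + 1) ^ 2 ≤ ((k + r : ℕ) + 1) * (a + b + (k + r : ℕ) + 2) := by
      push_cast
      rw [sq]
      have : (0 : ℝ) ≤ a := by positivity
      have : (0 : ℝ) ≤ b := by positivity
      have : (0 : ℝ) ≤ r := by positivity
      gcongr <;> linarith
    have h3 : (0 : ℝ) < ((k + r : ℕ) + 1) * (a + b + (k + r : ℕ) + 2) := by positivity
    rw [div_mul_eq_mul_div, div_le_iff₀ h3, show 2 * (r + 1) = 2 * r + 2 by ring, pow_add,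
      ← mul_assoc]
    gcongr

/-! ### A Nikolskii inequality for the Jacobi weights -/

lemma exists_eq_sum_jacobiFun (a b : ℕ) {N : ℕ} {p : Polynomial ℝ} (hp : p.natDegree ≤ N) :
    ∃ θ : ℕ → ℝ, ∀ t, p.eval t = ∑ k ∈ Finset.range (N + 1), θ k * jacobiFun a b k t := by
  have hlead : ∀ k, (rodrigues a b k).coeff k ≠ 0 := by
    intro k
    rw [coeff_rodrigues]
    positivity
  have hsqrt : ∀ k, √(rodriguesNormSq a b k) ≠ 0 := fun k =>
    (Real.sqrt_pos.2 (rodriguesNormSq_pos a b k)).ne'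
  induction N generalizing p with
  | zero =>
    refine ⟨fun _ => p.coeff 0 * √(rodriguesNormSq a b 0), fun t => ?_⟩
    rw [Polynomial.eq_C_of_natDegree_le_zero hp]
    simp [jacobiFun, rodrigues, hsqrt 0]
  | succ N ih =>
    set c : ℝ := p.coeff (N + 1) / (rodrigues a b (N + 1)).coeff (N + 1) with hc
    have hq : (p - Polynomial.C c * rodrigues a b (N + 1)).natDegree ≤ N := by
      refine Polynomial.natDegree_le_iff_coeff_eq_zero.2 fun j hj => ?_
      rw [Polynomial.coeff_sub, Polynomial.coeff_C_mul]
      rcases Nat.lt_or_ge (N + 1) j with h | h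
      · rw [Polynomial.coeff_eq_zero_of_natDegree_lt (hp.trans_lt h),
          Polynomial.coeff_eq_zero_of_natDegree_lt ((natDegree_rodrigues_le a b _).trans_lt h)]
        simp
      · obtain rfl : j = N + 1 := by omega
        rw [hc, div_mul_cancel₀ _ (hlead _), sub_self]
    obtain ⟨θ, hθ⟩ := ih hq
    refine ⟨fun k => if k = N + 1 then c * √(rodriguesNormSq a b (N + 1)) else θ k, fun t => ?_⟩
    have h1 := hθ t
    rw [Polynomial.eval_sub, Polynomial.eval_mul, Polynomial.eval_C, sub_eq_iff_eq_add] at h1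
    rw [Finset.sum_range_succ, h1]
    congr 1
    · refine Finset.sum_congr rfl fun k hk => ?_
      have : k ≠ N + 1 := by have := Finset.mem_range.1 hk; omega
      simp only [this, if_false]
    · simp only [if_true, jacobiFun]
      have := hsqrt (N + 1)
      field_simp

lemma factorial_add_div_le (n j : ℕ) : ((n + j)! : ℝ) ≤ n ! * (n + j : ℝ) ^ j := by
  induction j with
  | zero => simp
  | succ j ih =>
    rw [show n + (j + 1) = (n + j) + 1 by ring, Nat.factorial_succ]
    push_cast
    calc ((n : ℝ) + j + 1) * (n + j)! ≤ (n + j + 1) * (n ! * (n + j : ℝ) ^ j) := by gcongr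
      _ ≤ (n + j + 1) * (n ! * (n + (j + 1) : ℝ) ^ j) := by gcongr; simp
      _ = _ := by ring

/-- The quotients (a+k)!/k! and (a+b+k)!/(b+k)! are products of a factors, each at most a + b + 1 +
k; the remaining a + b + 2k + 1 is at most twice that. -/
lemma factorial_sq_div_rodriguesNormSq_le (a b k : ℕ) :
    ((a + k)! : ℝ) ^ 2 / rodriguesNormSq a b k ≤ 2 * (a + b + 1 + k : ℝ) ^ (2 * a + 1) := by
  have h1 : ((a + k)! : ℝ) ≤ k ! * (a + b + 1 + k : ℝ) ^ a := by
    rw [add_comm a k]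
    refine (factorial_add_div_le k a).trans ?_
    have : (0 : ℝ) ≤ b := by positivity
    have h : (k + a : ℝ) ≤ a + b + 1 + k := by linarith
    gcongr
  have h2 : ((a + b + k)! : ℝ) ≤ (b + k)! * (a + b + 1 + k : ℝ) ^ a := by
    rw [show a + b + k = (b + k) + a by ring]
    refine (factorial_add_div_le (b + k) a).trans ?_
    have h : ((b + k : ℕ) + a : ℝ) ≤ a + b + 1 + k := by push_cast; linarith
    gcongr
  have h3 : (a + b + 2 * k + 1 : ℝ) ≤ 2 * (a + b + 1 + k) := by
    have : (0 : ℝ) ≤ a := by positivity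
    have : (0 : ℝ) ≤ b := by positivity
    linarith
  have hk : (0 : ℝ) < k ! := by positivity
  have hb : (0 : ℝ) < (b + k)! := by positivity
  have ha : (0 : ℝ) < (a + k)! := by positivity
  have e : ((a + k)! : ℝ) ^ 2 / rodriguesNormSq a b k =
      (a + k)! * ((a + b + k)! * (a + b + 2 * k + 1)) / (k ! * (b + k)!) := by
    unfold rodriguesNormSq
    field_simp
  rw [e, div_le_iff₀ (by positivity)]
  calc ((a + k)! : ℝ) * ((a + b + k)! * (a + b + 2 * k + 1))
      ≤ (k ! * (a + b + 1 + k : ℝ) ^ a) * (((b + k)! * (a + b + 1 + k : ℝ) ^ a) *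
        (2 * (a + b + 1 + k))) := by gcongr
    _ = _ := by ring

lemma rodriguesNormSq_comm (a b k : ℕ) : rodriguesNormSq a b k = rodriguesNormSq b a k := by
  unfold rodriguesNormSq
  rw [add_comm a b]
  ring

/-- The natural exponent at this endpoint is 2a + 1, and 2b + 1 at the other. It is enlarged to 2(a
+ b) + 1 so that both endpoints share one bound. -/
lemma jacobiFun_one_sq_le (a b k : ℕ) :
    jacobiFun a b k 1 ^ 2 ≤ 2 * (a + b + 1 + k : ℝ) ^ (2 * (a + b) + 1) := by
  have hs := Real.sq_sqrt (rodriguesNormSq_pos a b k).le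
  have h5 : ((-1 : ℝ) ^ k) ^ 2 = 1 := by rw [← pow_mul, mul_comm, pow_mul]; simp
  have ha : (1 : ℝ) ≤ a ! := by exact_mod_cast Nat.factorial_pos a
  have hN := rodriguesNormSq_pos a b k
  have h1 : (1 : ℝ) ≤ a + b + 1 + k := by
    have : (0 : ℝ) ≤ (a : ℝ) + b + k := by positivity
    linarith
  rw [jacobiFun, eval_one_rodrigues, div_pow, hs, div_pow, mul_pow, h5, one_mul, div_right_comm]
  calc ((a + k)! : ℝ) ^ 2 / rodriguesNormSq a b k / (a ! : ℝ) ^ 2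
      ≤ ((a + k)! : ℝ) ^ 2 / rodriguesNormSq a b k :=
        div_le_self (by positivity) (one_le_pow₀ ha)
    _ ≤ 2 * (a + b + 1 + k : ℝ) ^ (2 * a + 1) := factorial_sq_div_rodriguesNormSq_le a b k
    _ ≤ _ := by gcongr; omega

lemma jacobiFun_zero_sq_le (a b k : ℕ) :
    jacobiFun a b k 0 ^ 2 ≤ 2 * (a + b + 1 + k : ℝ) ^ (2 * (a + b) + 1) := by
  have hs := Real.sq_sqrt (rodriguesNormSq_pos a b k).le
  have hb : (1 : ℝ) ≤ b ! := by exact_mod_cast Nat.factorial_pos b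
  have hN := rodriguesNormSq_pos a b k
  have h1 : (1 : ℝ) ≤ a + b + 1 + k := by
    have : (0 : ℝ) ≤ (a : ℝ) + b + k := by positivity
    linarith
  rw [jacobiFun, eval_zero_rodrigues, div_pow, hs, div_pow, div_right_comm]
  calc ((b + k)! : ℝ) ^ 2 / rodriguesNormSq a b k / (b ! : ℝ) ^ 2
      ≤ ((b + k)! : ℝ) ^ 2 / rodriguesNormSq a b k :=
        div_le_self (by positivity) (one_le_pow₀ hb)
    _ ≤ 2 * (b + a + 1 + k : ℝ) ^ (2 * b + 1) := by
        rw [rodriguesNormSq_comm]; exact factorial_sq_div_rodriguesNormSq_le b a k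
    _ = 2 * (a + b + 1 + k : ℝ) ^ (2 * b + 1) := by rw [add_comm (b : ℝ)]
    _ ≤ _ := by gcongr; omega

lemma integral_sum_jacobiFun_sq (a b : ℕ) (s : Finset ℕ) (θ : ℕ → ℝ) :
    ∫ t, (∑ k ∈ s, θ k * jacobiFun a b k t) ^ 2 ∂(weightMeasure a b) = ∑ k ∈ s, θ k ^ 2 := by
  have := integral_sub_sum_sq (μ := weightMeasure a b) (fun k => memLp_jacobiFun a b k 2)
    (integral_jacobiFun_mul a b) (g := fun _ => 0) MemLp.zero s θ
  simpa using this

/-- Cauchy-Schwarz on the orthonormal expansion of p. The sum over m + 1 degrees costs one more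
power of a + b + 1 + m. -/
lemma sq_eval_le_of_jacobiFun_sq_le {a b m : ℕ} {p : Polynomial ℝ} (hp : p.natDegree ≤ m) {x : ℝ}
    (hx : ∀ k, jacobiFun a b k x ^ 2 ≤ 2 * (a + b + 1 + k : ℝ) ^ (2 * (a + b) + 1)) :
    p.eval x ^ 2 ≤ 2 * (a + b + 1 + m : ℝ) ^ (2 * (a + b + 1)) *
      ∫ t, p.eval t ^ 2 ∂(weightMeasure a b) := by
  obtain ⟨θ, hθ⟩ := exists_eq_sum_jacobiFun a b hp
  simp_rw [hθ, integral_sum_jacobiFun_sq]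
  have h1 : ∑ k ∈ Finset.range (m + 1), jacobiFun a b k x ^ 2 ≤
      2 * (a + b + 1 + m : ℝ) ^ (2 * (a + b + 1)) := by
    calc ∑ k ∈ Finset.range (m + 1), jacobiFun a b k x ^ 2
        ≤ ∑ k ∈ Finset.range (m + 1), 2 * (a + b + 1 + m : ℝ) ^ (2 * (a + b) + 1) := by
          refine Finset.sum_le_sum fun k hk => (hx k).trans ?_
          have : (k : ℝ) ≤ m := by exact_mod_cast Nat.lt_succ_iff.1 (Finset.mem_range.1 hk)
          gcongr
      _ = (m + 1) * (2 * (a + b + 1 + m : ℝ) ^ (2 * (a + b) + 1)) := by simp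
      _ ≤ (a + b + 1 + m : ℝ) * (2 * (a + b + 1 + m : ℝ) ^ (2 * (a + b) + 1)) := by
          have : (0 : ℝ) ≤ (a : ℝ) + b := by positivity
          have h : (m + 1 : ℝ) ≤ a + b + 1 + m := by linarith
          gcongr
      _ = _ := by ring
  calc (∑ k ∈ Finset.range (m + 1), θ k * jacobiFun a b k x) ^ 2
      ≤ (∑ k ∈ Finset.range (m + 1), θ k ^ 2) *
        ∑ k ∈ Finset.range (m + 1), jacobiFun a b k x ^ 2 :=
        Finset.sum_mul_sq_le_sq_mul_sq _ _ _
    _ ≤ (∑ k ∈ Finset.range (m + 1), θ k ^ 2) *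
        (2 * (a + b + 1 + m : ℝ) ^ (2 * (a + b + 1))) := by gcongr
    _ = _ := mul_comm _ _

/-- Change of variables from a subinterval touching an endpoint of `[0, 1]`. -/
lemma integral_comp_affine_weight_le (a b : ℕ) (p : Polynomial ℝ) {x c : ℝ} (hc : 1 / 2 ≤ c)
    (hx : 0 ≤ x) (hxc : x + c ≤ 1) (hend : x = 0 ∨ x + c = 1) :
    ∫ t, (p.comp (Polynomial.C x + Polynomial.C c * Polynomial.X)).eval t ^ 2
      ∂(weightMeasure a b) ≤ 2 ^ (a + b + 1) * ∫ t, p.eval t ^ 2 ∂(weightMeasure a b) := by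
  have hc0 : 0 < c := by linarith
  have hc1 : 1 ≤ 2 * c := by linarith
  simp only [integral_weightMeasure, Polynomial.eval_comp, Polynomial.eval_add,
    Polynomial.eval_mul, Polynomial.eval_C, Polynomial.eval_X]
  have hcont : ∀ u v : ℝ, IntervalIntegrable
      (fun t : ℝ => (1 - t) ^ a * t ^ b * p.eval t ^ 2) volume u v := fun u v =>
    Continuous.intervalIntegrable (by fun_prop) _ _
  have hsub : ∫ t in (0 : ℝ)..1, (1 - (x + c * t)) ^ a * (x + c * t) ^ b *
      p.eval (x + c * t) ^ 2 = c⁻¹ * ∫ t in x..(x + c), (1 - t) ^ a * t ^ b * p.eval t ^ 2 := by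
    have := intervalIntegral.integral_comp_add_mul (a := 0) (b := 1)
      (fun t : ℝ => (1 - t) ^ a * t ^ b * p.eval t ^ 2) hc0.ne' x
    simpa using this
  have hmono : ∫ t in x..(x + c), (1 - t) ^ a * t ^ b * p.eval t ^ 2 ≤
      ∫ t in (0 : ℝ)..1, (1 - t) ^ a * t ^ b * p.eval t ^ 2 := by
    refine intervalIntegral.integral_mono_interval hx (by linarith) hxc ?_ (hcont 0 1)
    filter_upwards [ae_restrict_mem measurableSet_Ioc] with t ht
    exact mul_nonneg (weight_nonneg ⟨ht.1.le, ht.2⟩) (sq_nonneg _)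
  have hI : 0 ≤ ∫ t in (0 : ℝ)..1, (1 - t) ^ a * t ^ b * p.eval t ^ 2 := by
    refine intervalIntegral.integral_nonneg zero_le_one fun t ht => ?_
    exact mul_nonneg (weight_nonneg ht) (sq_nonneg _)
  -- The affine map fixes an endpoint of [0, 1] and has slope at least 1/2, so each factor t and 1 -
  -- t is at most twice its value at the image point.
  have hpt : ∀ t ∈ Set.Icc (0 : ℝ) 1, (1 - t) ^ a * t ^ b * p.eval (x + c * t) ^ 2 ≤
      2 ^ (a + b) * ((1 - (x + c * t)) ^ a * (x + c * t) ^ b * p.eval (x + c * t) ^ 2) := by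
    intro t ht
    have h1 : 1 - t ≤ 2 * (1 - (x + c * t)) := by
      rcases hend with rfl | h
      · nlinarith [ht.1, ht.2]
      · nlinarith [ht.1, ht.2]
    have h2 : t ≤ 2 * (x + c * t) := by nlinarith [ht.1, ht.2]
    have h3 : 0 ≤ 1 - t := by linarith [ht.2]
    calc (1 - t) ^ a * t ^ b * p.eval (x + c * t) ^ 2
        ≤ (2 * (1 - (x + c * t))) ^ a * (2 * (x + c * t)) ^ b * p.eval (x + c * t) ^ 2 := by
          have := ht.1
          have h4 : 0 ≤ 1 - (x + c * t) := by linarith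
          gcongr
      _ = _ := by rw [mul_pow, mul_pow]; ring
  calc ∫ t in (0 : ℝ)..1, (1 - t) ^ a * t ^ b * p.eval (x + c * t) ^ 2
      ≤ ∫ t in (0 : ℝ)..1, 2 ^ (a + b) *
        ((1 - (x + c * t)) ^ a * (x + c * t) ^ b * p.eval (x + c * t) ^ 2) :=
        intervalIntegral.integral_mono_on zero_le_one
          (Continuous.intervalIntegrable (by fun_prop) _ _)
          (Continuous.intervalIntegrable (by fun_prop) _ _) hpt
    _ = 2 ^ (a + b) * (c⁻¹ * ∫ t in x..(x + c), (1 - t) ^ a * t ^ b * p.eval t ^ 2) := by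
        rw [intervalIntegral.integral_const_mul, hsub]
    _ ≤ 2 ^ (a + b) * (2 * ∫ t in (0 : ℝ)..1, (1 - t) ^ a * t ^ b * p.eval t ^ 2) := by
        have : c⁻¹ ≤ 2 := by rw [inv_le_comm₀ hc0 two_pos]; linarith
        refine mul_le_mul_of_nonneg_left ?_ (by positivity)
        exact (mul_le_mul_of_nonneg_left hmono (by positivity)).trans
          (mul_le_mul_of_nonneg_right this hI)
    _ = _ := by ring

lemma natDegree_comp_affine_le {p : Polynomial ℝ} {m : ℕ} (hp : p.natDegree ≤ m) (x c : ℝ) :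
    (p.comp (Polynomial.C x + Polynomial.C c * Polynomial.X)).natDegree ≤ m := by
  have h1 : (Polynomial.C x + Polynomial.C c * Polynomial.X).natDegree ≤ 1 := by compute_degree
  calc _ ≤ p.natDegree * (Polynomial.C x + Polynomial.C c * Polynomial.X).natDegree :=
        Polynomial.natDegree_comp_le
    _ ≤ m * 1 := Nat.mul_le_mul hp h1
    _ = m := mul_one m

/-- Nikolskii inequality between the sup norm and the weighted `L²` norm of polynomials. -/
theorem sq_eval_le_integral_weightMeasure (a b : ℕ) {m : ℕ} {p : Polynomial ℝ}
    (hp : p.natDegree ≤ m) {x : ℝ} (hx : x ∈ Set.Icc (0 : ℝ) 1) :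
    p.eval x ^ 2 ≤ 2 ^ (a + b + 2) * (a + b + 1 + m : ℝ) ^ (2 * (a + b + 1)) *
      ∫ t, p.eval t ^ 2 ∂(weightMeasure a b) := by
  -- An interior point becomes an endpoint after rescaling: the longer of [0, x] and [x, 1] is
  -- mapped onto [0, 1], and the endpoint bound applies to the rescaled polynomial.
  have key : ∀ y c z : ℝ, 1 / 2 ≤ c → 0 ≤ y → y + c ≤ 1 → (y = 0 ∨ y + c = 1) → y + c * z = x →
      (∀ k, jacobiFun a b k z ^ 2 ≤ 2 * (a + b + 1 + k : ℝ) ^ (2 * (a + b) + 1)) →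
      p.eval x ^ 2 ≤ 2 ^ (a + b + 2) * (a + b + 1 + m : ℝ) ^ (2 * (a + b + 1)) *
        ∫ t, p.eval t ^ 2 ∂(weightMeasure a b) := by
    intro y c z hc hy hyc hend hz hjac
    have h1 := sq_eval_le_of_jacobiFun_sq_le (natDegree_comp_affine_le hp y c) hjac
    have h2 := integral_comp_affine_weight_le a b p hc hy hyc hend
    have h3 : (p.comp (Polynomial.C y + Polynomial.C c * Polynomial.X)).eval z = p.eval x := by
      simp [Polynomial.eval_comp, hz]
    rw [h3] at h1
    calc p.eval x ^ 2 ≤ _ := h1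
      _ ≤ 2 * (a + b + 1 + m : ℝ) ^ (2 * (a + b + 1)) *
          (2 ^ (a + b + 1) * ∫ t, p.eval t ^ 2 ∂(weightMeasure a b)) := by gcongr
      _ = _ := by ring
  rcases le_total (1 / 2) x with h | h
  · exact key 0 x 1 h le_rfl (by linarith [hx.2]) (Or.inl rfl) (by ring) (jacobiFun_one_sq_le a b)
  · exact key x (1 - x) 0 (by linarith) hx.1 (by linarith) (Or.inr (by ring)) (by ring)
      (jacobiFun_zero_sq_le a b)

lemma sq_sum_jacobiFun_le (a b m : ℕ) (θ : ℕ → ℝ) {x : ℝ} (hx : x ∈ Set.Icc (0 : ℝ) 1) :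
    (∑ k ∈ Finset.range (m + 1), θ k * jacobiFun a b k x) ^ 2 ≤
      2 ^ (a + b + 2) * (a + b + 1 + m : ℝ) ^ (2 * (a + b + 1)) *
        ∑ k ∈ Finset.range (m + 1), θ k ^ 2 := by
  set p : Polynomial ℝ := ∑ k ∈ Finset.range (m + 1),
    Polynomial.C (θ k / √(rodriguesNormSq a b k)) * rodrigues a b k with hp
  have heval : ∀ t, p.eval t = ∑ k ∈ Finset.range (m + 1), θ k * jacobiFun a b k t := by
    intro t
    simp only [hp, Polynomial.eval_finsetSum, Polynomial.eval_mul, Polynomial.eval_C, jacobiFun]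
    exact Finset.sum_congr rfl fun k _ => by ring
  have hdeg : p.natDegree ≤ m := by
    refine Polynomial.natDegree_sum_le_of_forall_le _ _ fun k hk => ?_
    refine (Polynomial.natDegree_C_mul_le _ _).trans ((natDegree_rodrigues_le a b k).trans ?_)
    exact Nat.lt_succ_iff.1 (Finset.mem_range.1 hk)
  have h := sq_eval_le_integral_weightMeasure a b hdeg hx
  simpa only [heval, integral_sum_jacobiFun_sq] using h

/-! ### Polynomial approximation of Sobolev functions -/

/-- The orthogonal projection on the polynomials of degree at most `m`. -/
def jacobiProj (a b m : ℕ) (h : ℝ → ℝ) (t : ℝ) : ℝ :=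
  ∑ k ∈ Finset.range (m + 1), jacobiCoeff a b k h * jacobiFun a b k t

lemma continuous_jacobiProj (a b m : ℕ) (h : ℝ → ℝ) : Continuous (jacobiProj a b m h) :=
  continuous_finsetSum _ fun k _ => (continuous_jacobiFun a b k).const_mul _

lemma integral_sub_jacobiProj_sq {a b : ℕ} {h : ℝ → ℝ} (hh : MemLp h 2 (weightMeasure a b))
    (m : ℕ) :
    ∫ t, (h t - jacobiProj a b m h t) ^ 2 ∂(weightMeasure a b) =
      ∫ t, h t ^ 2 ∂(weightMeasure a b) - ∑ k ∈ Finset.range (m + 1), jacobiCoeff a b k h ^ 2 := by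
  have := integral_sub_sum_sq (μ := weightMeasure a b) (fun k => memLp_jacobiFun a b k 2)
    (integral_jacobiFun_mul a b) hh (Finset.range (m + 1)) (fun k => jacobiCoeff a b k h)
  simp only [jacobiProj, this]
  have hc : ∀ k, ∫ t, h t * jacobiFun a b k t ∂(weightMeasure a b) = jacobiCoeff a b k h :=
    fun _ => rfl
  simp only [hc, ← sq]
  ring

lemma integral_sub_jacobiProj_sq_le {a b : ℕ} {h : ℝ → ℝ} (hh : MemLp h 2 (weightMeasure a b))
    (m : ℕ) (θ : ℕ → ℝ) :
    ∫ t, (h t - jacobiProj a b m h t) ^ 2 ∂(weightMeasure a b) ≤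
      ∫ t, (h t - ∑ k ∈ Finset.range (m + 1), θ k * jacobiFun a b k t) ^ 2
        ∂(weightMeasure a b) := by
  rw [integral_sub_jacobiProj_sq hh, integral_sub_sum_sq (fun k => memLp_jacobiFun a b k 2)
    (integral_jacobiFun_mul a b) hh]
  have h1 : 0 ≤ ∑ k ∈ Finset.range (m + 1), (jacobiCoeff a b k h - θ k) ^ 2 :=
    Finset.sum_nonneg fun k _ => sq_nonneg _
  have h2 : ∑ k ∈ Finset.range (m + 1), (jacobiCoeff a b k h - θ k) ^ 2 =
      ∑ k ∈ Finset.range (m + 1), jacobiCoeff a b k h ^ 2 -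
        2 * ∑ k ∈ Finset.range (m + 1), θ k * jacobiCoeff a b k h +
        ∑ k ∈ Finset.range (m + 1), θ k ^ 2 := by
    rw [Finset.mul_sum, ← Finset.sum_sub_distrib, ← Finset.sum_add_distrib]
    exact Finset.sum_congr rfl fun k _ => by ring
  simp only [jacobiCoeff] at h1 h2 ⊢
  linarith

lemma measureReal_weightMeasure_le_one (a b : ℕ) : (weightMeasure a b).real Set.univ ≤ 1 := by
  refine ENNReal.toReal_le_of_le_ofReal zero_le_one ?_
  refine (weightMeasure_le a b _).trans ?_
  simp

/-- Completeness of the Jacobi system: Weierstrass approximation combined with the best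
approximation property of the projection. -/
lemma exists_integral_sub_jacobiProj_sq_le {a b : ℕ} {h : ℝ → ℝ}
    (hh : ContinuousOn h (Set.Icc 0 1)) {ε : ℝ} (hε : 0 < ε) :
    ∃ N, ∀ M ≥ N, ∫ t, (h t - jacobiProj a b M h t) ^ 2 ∂(weightMeasure a b) ≤ ε := by
  obtain ⟨p, hp⟩ := exists_polynomial_near_of_continuousOn 0 1 h hh (√ε) (Real.sqrt_pos.2 hε)
  refine ⟨p.natDegree, fun M hM => ?_⟩
  obtain ⟨θ, hθ⟩ := exists_eq_sum_jacobiFun a b (p := p) hM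
  refine (integral_sub_jacobiProj_sq_le (memLp_of_continuousOn_Icc hh 2) M θ).trans ?_
  simp_rw [← hθ]
  have hle : ∀ᵐ t ∂(weightMeasure a b), (h t - p.eval t) ^ 2 ≤ ε := by
    filter_upwards [ae_mem_Icc_weightMeasure a b] with t ht
    have := hp t ht
    rw [← Real.sq_sqrt hε.le, ← sq_abs, abs_sub_comm]
    gcongr
  calc ∫ t, (h t - p.eval t) ^ 2 ∂(weightMeasure a b) ≤ ∫ _, ε ∂(weightMeasure a b) :=
        integral_mono_of_nonneg (ae_of_all _ fun t => sq_nonneg _) (integrable_const _) hle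
    _ ≤ ε := by
        rw [integral_const, smul_eq_mul]
        exact mul_le_of_le_one_left hε.le (measureReal_weightMeasure_le_one a b)

lemma eqOn_Icc_of_integral_weightMeasure_sq_eq_zero {a b : ℕ} {g : ℝ → ℝ}
    (hg : ContinuousOn g (Set.Icc 0 1)) (h0 : ∫ t, g t ^ 2 ∂(weightMeasure a b) = 0) :
    Set.EqOn g 0 (Set.Icc 0 1) := by
  have hint : Integrable (fun t => g t ^ 2) (weightMeasure a b) :=
    (memLp_of_continuousOn_Icc hg 2).integrable_sq
  have h1 := (integral_eq_zero_iff_of_nonneg (fun t => sq_nonneg (g t)) hint).1 h0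
  rw [Filter.EventuallyEq, weightMeasure, ae_withDensity_iff (measurable_weight a b)] at h1
  refine Measure.eqOn_Icc_of_ae_eq volume zero_ne_one ?_ hg continuousOn_const
  have h2 : ∀ᵐ t ∂(volume.restrict (Set.Icc (0 : ℝ) 1)), t ∈ Set.Ioo (0 : ℝ) 1 := by
    rw [← Measure.restrict_congr_set Ioo_ae_eq_Icc]
    exact ae_restrict_mem measurableSet_Ioo
  filter_upwards [h1, h2] with t ht ht'
  have hpos : 0 < (1 - t) ^ a * t ^ b :=
    mul_pos (pow_pos (sub_pos.2 ht'.2) _) (pow_pos ht'.1 _)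
  have := ht (by simpa using hpos)
  simpa using this

lemma abs_jacobiFun_le (a b : ℕ) {k : ℕ} (hk : 1 ≤ k) {t : ℝ} (ht : t ∈ Set.Icc (0 : ℝ) 1) :
    |jacobiFun a b k t| ≤ 2 ^ (a + b + 2) * (a + b + 2 : ℝ) ^ (a + b + 1) * (k : ℝ) ^ (a + b + 1) := by
  have h := sq_sum_jacobiFun_le a b k (fun j => if j = k then 1 else 0) ht
  have hk' : (1 : ℝ) ≤ k := by exact_mod_cast hk
  simp at h
  refine abs_le_of_sq_le_sq ?_ (by positivity)
  have h1 : (a + b + 1 + k : ℝ) ≤ (a + b + 2) * k := by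
    have : (0 : ℝ) ≤ (a : ℝ) + b := by positivity
    nlinarith
  calc jacobiFun a b k t ^ 2 ≤ _ := h
    _ ≤ 2 ^ (2 * (a + b + 2)) * ((a + b + 2) * k : ℝ) ^ (2 * (a + b + 1)) := by
        gcongr
        · norm_num
        · omega
    _ = _ := by rw [mul_pow]; ring

lemma sum_Ico_sub_le {f : ℕ → ℝ} {S : ℝ} (hS : ∀ s : Finset ℕ, ∑ k ∈ s, f k ≤ S) {r m : ℕ}
    (hr : r ≤ m) (M : ℕ) : ∑ k ∈ Finset.Ioo m M, f (k - r) ≤ S := by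
  have hinj : Set.InjOn (fun k => k - r) (Finset.Ioo m M : Finset ℕ) := by
    intro x hx y hy hxy
    simp only [Finset.coe_Ioo, Set.mem_Ioo] at hx hy hxy
    omega
  rw [← Finset.sum_image (f := f) hinj]
  exact hS _

/-- The constant in the sup norm approximation bound. -/
def approxConst (a b r : ℕ) (S : ℝ) : ℝ :=
  r ^ r * (2 ^ (a + b + 2) * (a + b + 2 : ℝ) ^ (a + b + 1)) * (S + 2)

/-! ### Projection error for a function with a chain of r derivatives. -/

section Chain

variable {a b r : ℕ} {h : ℕ → ℝ → ℝ} {S : ℝ}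

lemma jacobiCoeff_sq_le_of_le (hr : 1 ≤ r)
    (hac : ∀ j < r, AbsolutelyContinuousOnInterval (h j) 0 1)
    (hderiv : ∀ j < r, Set.EqOn (deriv (h j)) (h (j + 1)) (Set.Ioo 0 1)) {k : ℕ} (hk : r ≤ k) :
    jacobiCoeff a b k (h 0) ^ 2 ≤
      ((r : ℝ) / k) ^ (2 * r) * jacobiCoeff (a + r) (b + r) (k - r) (h r) ^ 2 := by
  have h1 := jacobiCoeff_sq_le hac hderiv a b (k - r)
  rw [Nat.sub_add_cancel hk] at h1
  have hk0 : (0 : ℝ) < k := by exact_mod_cast (hr.trans hk)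
  -- Equivalent to (r - 1)(k - r) ≥ 0.
  have h2 : (k : ℝ) / r ≤ ((k - r : ℕ) : ℝ) + 1 := by
    have hr1 : (1 : ℝ) ≤ r := by exact_mod_cast hr
    have hrk : (r : ℝ) ≤ k := by exact_mod_cast hk
    rw [div_le_iff₀ (by linarith), Nat.cast_sub hk]
    nlinarith
  have h3 : jacobiCoeff a b k (h 0) ^ 2 * ((k : ℝ) / r) ^ (2 * r) ≤
      jacobiCoeff (a + r) (b + r) (k - r) (h r) ^ 2 := le_trans (by gcongr) h1
  have hr0 : (0 : ℝ) < r := by exact_mod_cast hr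
  have h4 : (0 : ℝ) < ((k : ℝ) / r) ^ (2 * r) := by positivity
  rw [← inv_div (k : ℝ) r, inv_pow, mul_comm, ← div_eq_mul_inv, le_div_iff₀ h4]
  exact h3

/-- Bessel's inequality for the raised weight, which is dominated by the original one. Hence a norm
of the last derivative in the original weight suffices. -/
lemma sum_jacobiCoeff_sq_le (hr : MemLp (h r) 2 (weightMeasure a b))
    (hS : ∫ t, h r t ^ 2 ∂(weightMeasure a b) ≤ S) (s : Finset ℕ) :
    ∑ k ∈ s, jacobiCoeff (a + r) (b + r) k (h r) ^ 2 ≤ S := by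
  have h1 : MemLp (h r) 2 (weightMeasure (a + r) (b + r)) :=
    hr.mono_measure (weightMeasure_add_le a b r)
  refine (sum_sq_coeff_le (fun k => memLp_jacobiFun (a + r) (b + r) k 2)
    (integral_jacobiFun_mul _ _) h1 s).trans (le_trans ?_ hS)
  exact integral_mono_measure (weightMeasure_add_le a b r) (ae_of_all _ fun t => sq_nonneg _)
    hr.integrable_sq

/-- `L²` approximation of a Sobolev function by its orthogonal projection. -/
theorem integral_sub_jacobiProj_sq_le_of_sobolev (hr : 1 ≤ r)
    (hac : ∀ j < r, AbsolutelyContinuousOnInterval (h j) 0 1)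
    (hderiv : ∀ j < r, Set.EqOn (deriv (h j)) (h (j + 1)) (Set.Ioo 0 1))
    (hLp : MemLp (h r) 2 (weightMeasure a b))
    (hS : ∫ t, h r t ^ 2 ∂(weightMeasure a b) ≤ S) {m : ℕ} (hm : r ≤ m) :
    ∫ t, (h 0 t - jacobiProj a b m (h 0) t) ^ 2 ∂(weightMeasure a b) ≤
      ((r : ℝ) / m) ^ (2 * r) * S := by
  have hcont : ContinuousOn (h 0) (Set.Icc 0 1) := by
    simpa using (hac 0 hr).continuousOn
  have hm0 : (0 : ℝ) < m := by exact_mod_cast (hr.trans hm)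
  -- A projection of large degree M has error at most ε, so the error at degree m is a finite block
  -- of squared coefficients plus ε, and no infinite series is needed.
  refine le_of_forall_pos_le_add fun ε hε => ?_
  obtain ⟨N, hN⟩ := exists_integral_sub_jacobiProj_sq_le (a := a) (b := b) hcont hε
  have h1 := hN (max N m) (le_max_left _ _)
  have hMm : m + 1 ≤ max N m + 1 := by have := le_max_right N m; omega
  generalize max N m = M at h1 hMm
  have hL2 := memLp_of_continuousOn_Icc (a := a) (b := b) hcont 2
  rw [integral_sub_jacobiProj_sq hL2] at h1 ⊢
  have h2 := Finset.sum_Ico_eq_sub (fun k => jacobiCoeff a b k (h 0) ^ 2) hMm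
  have h3 : ∑ k ∈ Finset.Ico (m + 1) (M + 1), jacobiCoeff a b k (h 0) ^ 2 ≤
      ((r : ℝ) / m) ^ (2 * r) * S := by
    calc ∑ k ∈ Finset.Ico (m + 1) (M + 1), jacobiCoeff a b k (h 0) ^ 2
        ≤ ∑ k ∈ Finset.Ioo m (M + 1), ((r : ℝ) / m) ^ (2 * r) *
          jacobiCoeff (a + r) (b + r) (k - r) (h r) ^ 2 := by
          have : Finset.Ico (m + 1) (M + 1) = Finset.Ioo m (M + 1) := by
            ext; simp
          rw [this]
          refine Finset.sum_le_sum fun k hk => ?_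
          have hmk : m ≤ k := (Finset.mem_Ioo.1 hk).1.le
          refine (jacobiCoeff_sq_le_of_le hr hac hderiv (hm.trans hmk)).trans ?_
          have : (m : ℝ) ≤ k := by exact_mod_cast hmk
          gcongr
      _ ≤ _ := by
          rw [← Finset.mul_sum]
          gcongr
          exact sum_Ico_sub_le (f := fun k => jacobiCoeff (a + r) (b + r) k (h r) ^ 2)
            (sum_jacobiCoeff_sq_le hLp hS) hm _
  linarith

/-- Sup norm bound for the approximation error of a Sobolev function. -/
theorem abs_sub_jacobiProj_le_of_sobolev (hr : a + b + 2 ≤ r)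
    (hac : ∀ j < r, AbsolutelyContinuousOnInterval (h j) 0 1)
    (hderiv : ∀ j < r, Set.EqOn (deriv (h j)) (h (j + 1)) (Set.Ioo 0 1))
    (hLp : MemLp (h r) 2 (weightMeasure a b))
    (hS : ∫ t, h r t ^ 2 ∂(weightMeasure a b) ≤ S) {m : ℕ} (hm : r ≤ m) {t : ℝ}
    (ht : t ∈ Set.Icc (0 : ℝ) 1) :
    |h 0 t - jacobiProj a b m (h 0) t| ≤ approxConst a b r S := by
  have hr1 : 1 ≤ r := by omega
  have hcont : ContinuousOn (h 0) (Set.Icc 0 1) := by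
    simpa using (hac 0 hr1).continuousOn
  set G : ℝ := r ^ r * (2 ^ (a + b + 2) * (a + b + 2 : ℝ) ^ (a + b + 1)) with hG
  have hG0 : 0 ≤ G := by positivity
  -- The coefficient is at most (r/k)^r s and the basis function grows like k^(a+b+1). Since r ≥ a +
  -- b + 2 a factor 1/k is left, and s/k ≤ s² + 1/k² is summable by Bessel.
  have hterm : ∀ k, m < k → ∀ x ∈ Set.Icc (0 : ℝ) 1,
      |jacobiCoeff a b k (h 0) * jacobiFun a b k x| ≤
        G * (jacobiCoeff (a + r) (b + r) (k - r) (h r) ^ 2 + ((k : ℝ) ^ 2)⁻¹) := by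
    intro k hk x hx
    have hk1 : 1 ≤ k := by omega
    have hk1' : (1 : ℝ) ≤ k := by exact_mod_cast hk1
    have h1 : |jacobiCoeff a b k (h 0)| ≤
        ((r : ℝ) / k) ^ r * |jacobiCoeff (a + r) (b + r) (k - r) (h r)| := by
      refine abs_le_of_sq_le_sq ?_ (by positivity)
      rw [mul_pow, sq_abs, ← pow_mul, mul_comm r 2]
      exact jacobiCoeff_sq_le_of_le hr1 hac hderiv (by omega)
    set s := |jacobiCoeff (a + r) (b + r) (k - r) (h r)| with hs
    have hs0 : 0 ≤ s := abs_nonneg _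
    have h2 : ((r : ℝ) / k) ^ r * (k : ℝ) ^ (a + b + 1) ≤ r ^ r * (k : ℝ)⁻¹ := by
      have h3 : (k : ℝ) ^ (a + b + 1) * k ≤ (k : ℝ) ^ r := by
        rw [← pow_succ]
        exact pow_le_pow_right₀ hk1' hr
      rw [div_pow, div_mul_eq_mul_div, div_le_iff₀ (by positivity), mul_assoc]
      refine mul_le_mul_of_nonneg_left ?_ (by positivity)
      rw [inv_mul_eq_div, le_div_iff₀ (by linarith)]
      exact h3
    rw [abs_mul]
    calc |jacobiCoeff a b k (h 0)| * |jacobiFun a b k x|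
        ≤ (((r : ℝ) / k) ^ r * s) *
          (2 ^ (a + b + 2) * (a + b + 2 : ℝ) ^ (a + b + 1) * (k : ℝ) ^ (a + b + 1)) := by
          gcongr
          exact abs_jacobiFun_le a b hk1 hx
      _ = (((r : ℝ) / k) ^ r * (k : ℝ) ^ (a + b + 1)) *
          (2 ^ (a + b + 2) * (a + b + 2 : ℝ) ^ (a + b + 1)) * s := by ring
      _ ≤ (r ^ r * (k : ℝ)⁻¹) * (2 ^ (a + b + 2) * (a + b + 2 : ℝ) ^ (a + b + 1)) * s := by
          gcongr
      _ = G * (s * (k : ℝ)⁻¹) := by rw [hG]; ring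
      _ ≤ G * (s ^ 2 + ((k : ℝ) ^ 2)⁻¹) := by
          refine mul_le_mul_of_nonneg_left ?_ hG0
          rw [← inv_pow]
          nlinarith [sq_nonneg (s - (k : ℝ)⁻¹), sq_nonneg s, sq_nonneg ((k : ℝ)⁻¹)]
      _ = _ := by rw [hs, sq_abs]
  have hdiff : ∀ M ≥ m, ∀ x ∈ Set.Icc (0 : ℝ) 1,
      |jacobiProj a b M (h 0) x - jacobiProj a b m (h 0) x| ≤ approxConst a b r S := by
    intro M hM x hx
    have h2 := Finset.sum_Ico_eq_sub (fun k => jacobiCoeff a b k (h 0) * jacobiFun a b k x)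
      (Nat.succ_le_succ hM)
    have h3 : Finset.Ico m.succ M.succ = Finset.Ioo m (M + 1) := by ext; simp
    rw [h3] at h2
    simp only [jacobiProj]
    rw [← h2]
    calc _ ≤ ∑ k ∈ Finset.Ioo m (M + 1), |jacobiCoeff a b k (h 0) * jacobiFun a b k x| :=
          Finset.abs_sum_le_sum_abs _ _
      _ ≤ ∑ k ∈ Finset.Ioo m (M + 1),
          G * (jacobiCoeff (a + r) (b + r) (k - r) (h r) ^ 2 + ((k : ℝ) ^ 2)⁻¹) :=
          Finset.sum_le_sum fun k hk => hterm k (Finset.mem_Ioo.1 hk).1 x hx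
      _ ≤ G * (S + 2) := by
          rw [← Finset.mul_sum, Finset.sum_add_distrib]
          refine mul_le_mul_of_nonneg_left (add_le_add ?_ ?_) hG0
          · exact sum_Ico_sub_le (f := fun k => jacobiCoeff (a + r) (b + r) k (h r) ^ 2)
              (sum_jacobiCoeff_sq_le hLp hS) hm _
          · refine (sum_Ioo_inv_sq_le m (M + 1)).trans ?_
            rw [div_le_iff₀ (by positivity)]
            have : (0 : ℝ) ≤ m := by positivity
            linarith
  set A := approxConst a b r S with hA
  have hproj : Continuous (jacobiProj a b m (h 0)) := continuous_jacobiProj _ _ _ _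
  -- Only L² convergence of the projections is known. The excess of the error over A is dominated
  -- pointwise by the error at every degree M ≥ m, so its L² norm is zero, and continuity makes it
  -- vanish everywhere on [0, 1].
  set g : ℝ → ℝ := fun x => max (|h 0 x - jacobiProj a b m (h 0) x| - A) 0 with hg
  have hgc : ContinuousOn g (Set.Icc 0 1) :=
    (((hcont.sub hproj.continuousOn).abs).sub continuousOn_const).sup continuousOn_const
  have hg0 : ∫ x, g x ^ 2 ∂(weightMeasure a b) = 0 := by
    refine le_antisymm ?_ (integral_nonneg fun x => sq_nonneg _)
    refine le_of_forall_pos_le_add fun ε hε => ?_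
    obtain ⟨N, hN⟩ := exists_integral_sub_jacobiProj_sq_le (a := a) (b := b) hcont hε
    rw [zero_add]
    refine le_trans ?_ (hN (max N m) (le_max_left _ _))
    refine integral_mono_ae (memLp_of_continuousOn_Icc hgc 2).integrable_sq
      (memLp_of_continuousOn_Icc
        (hcont.sub (continuous_jacobiProj _ _ _ _).continuousOn) 2).integrable_sq ?_
    filter_upwards [ae_mem_Icc_weightMeasure a b] with x hx
    have h1 := hdiff (max N m) (le_max_right _ _) x hx
    show g x ^ 2 ≤ (h 0 x - jacobiProj a b (max N m) (h 0) x) ^ 2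
    rw [← sq_abs (h 0 x - _)]
    have h2 := abs_sub_abs_le_abs_sub (h 0 x - jacobiProj a b m (h 0) x)
      (jacobiProj a b (max N m) (h 0) x - jacobiProj a b m (h 0) x)
    rw [sub_sub_sub_cancel_right] at h2
    refine pow_le_pow_left₀ (le_max_right _ _) (max_le ?_ (abs_nonneg _)) 2
    linarith
  have h3 := eqOn_Icc_of_integral_weightMeasure_sq_eq_zero hgc hg0 ht
  have h4 : |h 0 t - jacobiProj a b m (h 0) t| - A ≤ g t := le_max_left _ _
  rw [h3] at h4
  simpa using h4

end Chain

/-! ### Derivatives of Sobolev functions -/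

lemma IsSobolev.absolutelyContinuousOnInterval {r : ℕ} {q : Measure ℝ} {h : ℝ → ℝ}
    (hs : IsSobolev r q h) {j : ℕ} (hj : j < r) :
    AbsolutelyContinuousOnInterval (iteratedDerivWithin j h (Set.Icc 0 1)) 0 1 := by
  rcases Nat.lt_or_ge j (r - 1) with h1 | h1
  · have h2 : ContDiffOn ℝ ((j + 1 : ℕ) : WithTop ℕ∞) h (Set.Icc 0 1) :=
      hs.contDiffOn.of_le (by exact_mod_cast h1)
    have h3 := (contDiffOn_nat_succ_iff_contDiffOn_one_iteratedDerivWithin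
      (uniqueDiffOn_Icc (zero_lt_one' ℝ))).1 (by exact_mod_cast h2)
    refine ContDiffOn.absolutelyContinuousOnInterval ?_
    simpa using h3.2
  · obtain rfl : j = r - 1 := by omega
    exact hs.absolutelyContinuous

lemma eqOn_deriv_iteratedDerivWithin (h : ℝ → ℝ) (j : ℕ) :
    Set.EqOn (deriv (iteratedDerivWithin j h (Set.Icc 0 1)))
      (iteratedDerivWithin (j + 1) h (Set.Icc 0 1)) (Set.Ioo 0 1) := by
  intro t ht
  rw [iteratedDerivWithin_succ, derivWithin_of_mem_nhds (Icc_mem_nhds ht.1 ht.2)]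

/-! ### Comparison of Lebesgue measure on the simplex with its marginals -/

lemma isClosed_simplex (d : ℕ) : IsClosed (simplex d) := by
  have : simplex d = (⋂ i, {x : Fin d → ℝ | x i ∈ Set.Icc (0 : ℝ) 1}) ∩
      ⋂ i, ⋂ j, ⋂ (_ : i ≤ j), {x : Fin d → ℝ | x i ≤ x j} := by
    ext x
    simp [simplex, Monotone]
  rw [this]
  refine IsClosed.inter (isClosed_iInter fun i => ?_) (isClosed_iInter fun i =>
    isClosed_iInter fun j => isClosed_iInter fun _ => ?_)
  · exact isClosed_Icc.preimage (continuous_apply i)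
  · exact isClosed_le (continuous_apply i) (continuous_apply j)

lemma measurableSet_simplex (d : ℕ) : MeasurableSet (simplex d) := (isClosed_simplex d).measurableSet

lemma isCompact_simplex (d : ℕ) : IsCompact (simplex d) := by
  refine (isCompact_univ_pi fun _ : Fin d => isCompact_Icc (a := (0 : ℝ)) (b := 1)).of_isClosed_subset
    (isClosed_simplex d) fun x hx => ?_
  exact fun i _ => hx.1 i

lemma insertNth_mem_simplex_iff {n : ℕ} {i : Fin (n + 1)} {s : ℝ} {y : Fin n → ℝ} :
    i.insertNth (α := fun _ => ℝ) s y ∈ simplex (n + 1) ↔ s ∈ Set.Icc (0 : ℝ) 1 ∧ y ∈ simplex n ∧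
      ∀ j : Fin n, if (j : ℕ) < i then y j ≤ s else s ≤ y j := by
  simp only [simplex, Set.mem_ofPred_eq, Monotone, Fin.forall_iff_succAbove i, Fin.insertNth_apply_same,
    Fin.insertNth_apply_succAbove, le_refl, Fin.succAbove_le_succAbove_iff]
  constructor
  · rintro ⟨⟨hs, hy⟩, ⟨-, h1⟩, h2⟩
    refine ⟨hs, ⟨hy, fun j k => (h2 j).2 k⟩, fun j => ?_⟩
    split_ifs with hj
    · exact (h2 j).1 (Fin.succAbove_lt_iff_castSucc_lt i j |>.2 (by simpa [Fin.lt_def] using hj)).le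
    · exact h1 j (Fin.lt_succAbove_iff_le_castSucc i j |>.2
        (by simpa [Fin.le_def] using hj)).le
  · rintro ⟨hs, ⟨hy, hm⟩, h⟩
    refine ⟨⟨hs, hy⟩, ⟨fun _ => trivial, fun j hj => ?_⟩, fun j => ⟨fun hj => ?_, fun k => @hm j k⟩⟩
    · have h1 := (Fin.lt_succAbove_iff_le_castSucc i j).1 (lt_of_le_of_ne hj (Fin.succAbove_ne i j).symm)
      have h2 := h j
      rwa [if_neg (by simpa [Fin.le_def] using h1)] at h2
    · have h1 := (Fin.succAbove_lt_iff_castSucc_lt i j).1 (lt_of_le_of_ne hj (Fin.succAbove_ne i j))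
      have h2 := h j
      rwa [if_pos (by simpa [Fin.lt_def] using h1)] at h2

lemma prod_ite_val_lt {M : Type*} [CommMonoid M] {n k : ℕ} (hk : k ≤ n) (A B : M) :
    ∏ j : Fin n, (if (j : ℕ) < k then A else B) = A ^ k * B ^ (n - k) := by
  rw [Fin.prod_univ_eq_prod_range (fun j => if j < k then A else B) n]
  obtain ⟨l, rfl⟩ := Nat.exists_eq_add_of_le hk
  rw [Finset.prod_range_add, Nat.add_sub_cancel_left]
  congr 1
  · rw [Finset.prod_congr rfl fun j hj => if_pos (Finset.mem_range.1 hj)]; simp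
  · simp

lemma lintegral_eq_lintegral_insertNth {n : ℕ} (i : Fin (n + 1)) {f : (Fin (n + 1) → ℝ) → ℝ≥0∞}
    (hf : Measurable f) :
    ∫⁻ x, f x = ∫⁻ s : ℝ, ∫⁻ y : Fin n → ℝ, f (i.insertNth (α := fun _ => ℝ) s y) := by
  have h := (volume_preserving_piFinSuccAbove (fun _ : Fin (n + 1) => ℝ) i).symm
  rw [← h.lintegral_comp hf, Measure.volume_eq_prod, lintegral_prod]
  · rfl
  · exact (hf.comp h.measurable).aemeasurable

lemma measurable_insertNth {n : ℕ} (i : Fin (n + 1)) :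
    Measurable fun p : ℝ × (Fin n → ℝ) => i.insertNth (α := fun _ => ℝ) p.1 p.2 :=
  (MeasurableEquiv.piFinSuccAbove (fun _ : Fin (n + 1) => ℝ) i).symm.measurable

/-- The marginals of Lebesgue measure on the simplex are dominated by the Jacobi weights. -/
lemma map_eval_restrict_simplex_le {d : ℕ} (i : Fin d) :
    (volume.restrict (simplex d)).map (fun x => x i) ≤ weightMeasure (d - 1 - (i : ℕ)) i := by
  obtain ⟨n, rfl⟩ : ∃ n, d = n + 1 := ⟨d - 1, by have := i.2; omega⟩
  have hi : (i : ℕ) ≤ n := Nat.lt_succ_iff.1 i.2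
  refine Measure.le_iff.2 fun A hA => ?_
  have hS : MeasurableSet ((fun x : Fin (n + 1) → ℝ => x i) ⁻¹' A ∩ simplex (n + 1)) :=
    (measurable_pi_apply i hA).inter (measurableSet_simplex _)
  rw [Measure.map_apply (measurable_pi_apply i) hA,
    Measure.restrict_apply (measurable_pi_apply i hA), ← lintegral_indicator_one hS,
    lintegral_eq_lintegral_insertNth i (measurable_one.indicator hS), weightMeasure,
    withDensity_apply _ hA, Measure.restrict_restrict hA, ← lintegral_indicator
      (hA.inter measurableSet_Icc)]
  refine lintegral_mono fun s => ?_
  by_cases hs : s ∈ A ∩ Set.Icc (0 : ℝ) 1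
  · rw [Set.indicator_of_mem hs]
    -- The fibre over s lies in the box [0, s]^i × [s, 1]^(n-i). Forgetting the order of the other
    -- coordinates costs only the factorials, which is why the bound is by the unnormalised weight.
    have hsub : ∀ y : Fin n → ℝ, ((fun x : Fin (n + 1) → ℝ => x i) ⁻¹' A ∩ simplex (n + 1)).indicator
        (1 : (Fin (n + 1) → ℝ) → ℝ≥0∞) (i.insertNth (α := fun _ => ℝ) s y) ≤ (Set.univ.pi fun j : Fin n =>
          if (j : ℕ) < i then Set.Icc (0 : ℝ) s else Set.Icc s 1).indicator (1 : (Fin n → ℝ) → ℝ≥0∞) y := by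
      intro y
      by_cases hy : i.insertNth (α := fun _ => ℝ) s y ∈ simplex (n + 1)
      · obtain ⟨-, hy1, hy2⟩ := insertNth_mem_simplex_iff.1 hy
        rw [Set.indicator_of_mem (s := Set.univ.pi _)]
        · exact Set.indicator_le_self' (by simp) _
        · intro j _
          have h2 := hy2 j
          show y j ∈ (if (j : ℕ) < i then Set.Icc (0 : ℝ) s else Set.Icc s 1)
          split_ifs with hj
          · rw [if_pos hj] at h2
            exact ⟨(hy1.1 j).1, h2⟩
          · rw [if_neg hj] at h2
            exact ⟨h2, (hy1.1 j).2⟩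
      · rw [Set.indicator_of_notMem fun h => hy h.2]
        exact zero_le
    refine (lintegral_mono hsub).trans ?_
    have hmeas : MeasurableSet (Set.univ.pi fun j : Fin n =>
          if (j : ℕ) < i then Set.Icc (0 : ℝ) s else Set.Icc s 1) :=
      MeasurableSet.univ_pi fun j => by split_ifs <;> exact measurableSet_Icc
    rw [lintegral_indicator_one hmeas, volume_pi_pi]
    have : ∀ j : Fin n, volume (if (j : ℕ) < i then Set.Icc (0 : ℝ) s else Set.Icc s 1) =
        if (j : ℕ) < i then ENNReal.ofReal s else ENNReal.ofReal (1 - s) := by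
      intro j; split_ifs <;> simp
    simp_rw [this]
    have h1 : (0 : ℝ) ≤ 1 - s := sub_nonneg.2 hs.2.2
    rw [prod_ite_val_lt hi, ← ENNReal.ofReal_pow hs.2.1, ← ENNReal.ofReal_pow h1,
      ← ENNReal.ofReal_mul (pow_nonneg hs.2.1 _), mul_comm]
    simp
  · rw [Set.indicator_of_notMem hs]
    refine le_of_eq ?_
    rw [lintegral_eq_zero_iff' (by
      exact (measurable_one.indicator hS).comp ((measurable_insertNth i).comp
        (measurable_const.prodMk measurable_id)) |>.aemeasurable)]
    refine ae_of_all _ fun y => ?_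
    refine Set.indicator_of_notMem ?_ _
    · rintro ⟨h1, h2⟩
      rw [Set.mem_preimage, Fin.insertNth_apply_same] at h1
      exact hs ⟨h1, (insertNth_mem_simplex_iff.1 h2).1⟩

/-! ### Lower bound for additive functions on the simplex. -/

/-- The set of points completing both `s` and `t` at coordinate `i` to points of the simplex is not
too small. -/
lemma weight_mul_weight_le_volume {n : ℕ} (i : Fin (n + 1)) {s t : ℝ} (hs : s ∈ Set.Icc (0 : ℝ) 1)
    (ht : t ∈ Set.Icc (0 : ℝ) 1) :
    ENNReal.ofReal (((n : ℝ) ^ n)⁻¹ * (((1 - s) ^ (n - (i : ℕ)) * s ^ (i : ℕ)) *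
      ((1 - t) ^ (n - (i : ℕ)) * t ^ (i : ℕ)))) ≤
      volume {y : Fin n → ℝ | i.insertNth (α := fun _ => ℝ) s y ∈ simplex (n + 1) ∧
        i.insertNth (α := fun _ => ℝ) t y ∈ simplex (n + 1)} := by
  have hi : (i : ℕ) ≤ n := Nat.lt_succ_iff.1 i.2
  set p := min s t with hp
  set q := max s t with hq
  have hp0 : 0 ≤ p := le_min hs.1 ht.1
  have hq1 : q ≤ 1 := max_le hs.2 ht.2
  have hpq : p ≤ q := min_le_max
  -- A box of points that are automatically ordered: coordinate j ranges over the j-th of n equal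
  -- pieces of [0, p] when j < i, and of [q, 1] otherwise.
  set lo : ℕ → ℝ := fun j => if j < i then p * (j / n) else q + (1 - q) * (j / n) with hlo
  set hi' : ℕ → ℝ := fun j => if j < i then p * ((j + 1) / n) else q + (1 - q) * ((j + 1) / n)
    with hhi'
  have hbox : (Set.univ.pi fun j : Fin n => Set.Icc (lo j) (hi' j)) ⊆
      {y : Fin n → ℝ | i.insertNth (α := fun _ => ℝ) s y ∈ simplex (n + 1) ∧
        i.insertNth (α := fun _ => ℝ) t y ∈ simplex (n + 1)} := by
    intro y hy
    have hy' : ∀ j : Fin n, lo j ≤ y j ∧ y j ≤ hi' j := fun j => hy j trivial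
    have hn : ∀ _ : Fin n, (0 : ℝ) < n := fun j => by exact_mod_cast j.pos
    have hfrac : ∀ j : Fin n, ((j : ℝ) + 1) / n ≤ 1 := fun j => by
      rw [div_le_one (hn j)]; exact_mod_cast j.2
    have hlow : ∀ j : Fin n, (j : ℕ) < i → y j ≤ p := by
      intro j hj
      refine (hy' j).2.trans ?_
      simp only [hhi', if_pos hj]
      exact mul_le_of_le_one_right hp0 (hfrac j)
    have hhigh : ∀ j : Fin n, ¬ (j : ℕ) < i → q ≤ y j := by
      intro j hj
      refine le_trans ?_ (hy' j).1
      simp only [hlo, if_neg hj]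
      have : 0 ≤ (1 - q) * ((j : ℕ) / n) :=
        mul_nonneg (by linarith) (by positivity)
      linarith
    have h0 : ∀ j, 0 ≤ y j := by
      intro j
      by_cases hj : (j : ℕ) < i
      · refine le_trans ?_ (hy' j).1
        simp only [hlo, if_pos hj]
        positivity
      · exact (hp0.trans hpq).trans (hhigh j hj)
    have h1 : ∀ j, y j ≤ 1 := by
      intro j
      by_cases hj : (j : ℕ) < i
      · exact (hlow j hj).trans (hpq.trans hq1)
      · refine (hy' j).2.trans ?_
        simp only [hhi', if_neg hj]
        have := mul_le_of_le_one_right (sub_nonneg.2 hq1) (hfrac j)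
        linarith
    have hmono : Monotone y := by
      intro j k hjk
      rcases hjk.eq_or_lt with rfl | hlt
      · exact le_rfl
      have hlt' : (j : ℕ) + 1 ≤ k := hlt
      have hdiv : ((j : ℝ) + 1) / n ≤ (k : ℝ) / n := by
        have : ((j : ℝ) + 1) ≤ k := by exact_mod_cast hlt'
        have := hn j
        gcongr
      by_cases hj : (j : ℕ) < i <;> by_cases hk : (k : ℕ) < i
      · refine (hy' j).2.trans (le_trans ?_ (hy' k).1)
        simp only [hhi', hlo, if_pos hj, if_pos hk]
        gcongr
      · exact (hlow j hj).trans (hpq.trans (hhigh k hk))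
      · omega
      · refine (hy' j).2.trans (le_trans ?_ (hy' k).1)
        simp only [hhi', hlo, if_neg hj, if_neg hk]
        have := mul_le_mul_of_nonneg_left hdiv (sub_nonneg.2 hq1)
        linarith
    have hsimp : y ∈ simplex n := ⟨fun j => ⟨h0 j, h1 j⟩, hmono⟩
    refine ⟨insertNth_mem_simplex_iff.2 ⟨hs, hsimp, fun j => ?_⟩,
      insertNth_mem_simplex_iff.2 ⟨ht, hsimp, fun j => ?_⟩⟩
    · split_ifs with hj
      · exact (hlow j hj).trans (min_le_left _ _)
      · exact (le_max_left _ _).trans (hhigh j hj)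
    · split_ifs with hj
      · exact (hlow j hj).trans (min_le_right _ _)
      · exact (le_max_right _ _).trans (hhigh j hj)
  refine le_trans ?_ (measure_mono hbox)
  rw [volume_pi_pi]
  have hvol : ∀ j : Fin n, volume (Set.Icc (lo j) (hi' j)) =
      if (j : ℕ) < i then ENNReal.ofReal (p / n) else ENNReal.ofReal ((1 - q) / n) := by
    intro j
    rw [Real.volume_Icc]
    by_cases hj : (j : ℕ) < i
    · simp only [hlo, hhi', if_pos hj]; congr 1; ring
    · simp only [hlo, hhi', if_neg hj]; congr 1; ring
  simp_rw [hvol]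
  have hq0 : 0 ≤ 1 - q := sub_nonneg.2 hq1
  rw [prod_ite_val_lt hi, ← ENNReal.ofReal_pow (by positivity), ← ENNReal.ofReal_pow (by positivity),
    ← ENNReal.ofReal_mul (by positivity)]
  refine ENNReal.ofReal_le_ofReal ?_
  have h1 : (p / n) ^ (i : ℕ) * ((1 - q) / n) ^ (n - (i : ℕ)) =
      ((n : ℝ) ^ n)⁻¹ * ((1 - q) ^ (n - (i : ℕ)) * p ^ (i : ℕ)) := by
    have : (n : ℝ) ^ n = n ^ (i : ℕ) * n ^ (n - (i : ℕ)) := by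
      rw [← pow_add, Nat.add_sub_cancel' hi]
    rw [div_pow, div_pow, this, mul_inv]
    ring
  rw [h1]
  refine mul_le_mul_of_nonneg_left ?_ (by positivity)
  -- Replacing min(s, t) by st, and 1 - max(s, t) by (1 - s)(1 - t), turns the bound into a product
  -- of weights in s and t.
  have hsp : s * t ≤ p := by
    refine le_min ?_ ?_
    · exact mul_le_of_le_one_right hs.1 ht.2
    · exact mul_le_of_le_one_left ht.1 hs.2
  have hsq : (1 - s) * (1 - t) ≤ 1 - q := by
    rw [hq, le_sub_comm]
    refine max_le ?_ ?_ <;> nlinarith [hs.1, hs.2, ht.1, ht.2]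
  have hs1 : 0 ≤ 1 - s := sub_nonneg.2 hs.2
  have ht1 : 0 ≤ 1 - t := sub_nonneg.2 ht.2
  calc (1 - s) ^ (n - (i : ℕ)) * s ^ (i : ℕ) * ((1 - t) ^ (n - (i : ℕ)) * t ^ (i : ℕ))
      = ((1 - s) * (1 - t)) ^ (n - (i : ℕ)) * (s * t) ^ (i : ℕ) := by
        rw [mul_pow, mul_pow]; ring
    _ ≤ (1 - q) ^ (n - (i : ℕ)) * p ^ (i : ℕ) := by
        have := mul_nonneg hs.1 ht.1
        gcongr

/-- On the fibre shared by s and t the increment of H is g s - g t, whatever the other coordinates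
contribute. Its square is at most twice the sum of the squares of H at the two points, and the
product weight is dominated by the volume of that fibre. Integration over [0, 1]² gives the factor
4. -/
lemma lintegral_sub_sq_le {n : ℕ} (i : Fin (n + 1)) {g : ℝ → ℝ} (hg : Measurable g)
    {H : (Fin (n + 1) → ℝ) → ℝ} (hH : Measurable H)
    (hgH : ∀ s t y, H (i.insertNth (α := fun _ => ℝ) s y) - H (i.insertNth (α := fun _ => ℝ) t y) =
      g s - g t) :
    ENNReal.ofReal (((n : ℝ) ^ n)⁻¹) *
      ∫⁻ s, ∫⁻ t, ENNReal.ofReal ((g s - g t) ^ 2) ∂(weightMeasure (n - (i : ℕ)) i)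
        ∂(weightMeasure (n - (i : ℕ)) i) ≤
      4 * ∫⁻ x in simplex (n + 1), ENNReal.ofReal (H x ^ 2) := by
  set S := simplex (n + 1)
  have hS : MeasurableSet S := measurableSet_simplex _
  set ins : ℝ → (Fin n → ℝ) → (Fin (n + 1) → ℝ) := fun s y => i.insertNth (α := fun _ => ℝ) s y
    with hins
  have hinsm : Measurable fun p : ℝ × (Fin n → ℝ) => ins p.1 p.2 := measurable_insertNth i
  set F : (Fin (n + 1) → ℝ) → ℝ≥0∞ := S.indicator fun x => ENNReal.ofReal (H x ^ 2) with hF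
  have hFm : Measurable F := ((hH.pow_const 2).ennreal_ofReal).indicator hS
  have hFint : ∫⁻ x in S, ENNReal.ofReal (H x ^ 2) = ∫⁻ s, ∫⁻ y, F (ins s y) := by
    rw [← lintegral_indicator hS, lintegral_eq_lintegral_insertNth i hFm]
  set I : ℝ → ℝ≥0∞ := (Set.Icc (0 : ℝ) 1).indicator 1 with hI
  have hIm : Measurable I := measurable_one.indicator measurableSet_Icc
  have hI1 : ∫⁻ t, I t = 1 := by rw [hI, lintegral_indicator_one measurableSet_Icc]; simp
  set V : ℝ → ℝ → ℝ≥0∞ := fun s t => volume {y : Fin n → ℝ | ins s y ∈ S ∧ ins t y ∈ S}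
  have hset : ∀ s t, MeasurableSet {y : Fin n → ℝ | ins s y ∈ S ∧ ins t y ∈ S} := fun s t =>
    ((hinsm.comp (measurable_const.prodMk measurable_id)) hS).inter
      ((hinsm.comp (measurable_const.prodMk measurable_id)) hS)
  have hw : ∀ f : ℝ → ℝ≥0∞, Measurable f → ∫⁻ t, f t ∂(weightMeasure (n - (i : ℕ)) i) =
      ∫⁻ t, I t * (ENNReal.ofReal ((1 - t) ^ (n - (i : ℕ)) * t ^ (i : ℕ)) * f t) := by
    intro f hf
    rw [weightMeasure, lintegral_withDensity_eq_lintegral_mul _ (measurable_weight _ _) hf,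
      ← lintegral_indicator measurableSet_Icc]
    refine lintegral_congr fun t => ?_
    by_cases ht : t ∈ Set.Icc (0 : ℝ) 1 <;> simp [hI, ht]
  have hgm : Measurable fun p : ℝ × ℝ => ENNReal.ofReal ((g p.1 - g p.2) ^ 2) := by fun_prop
  have hstep : ENNReal.ofReal (((n : ℝ) ^ n)⁻¹) *
      ∫⁻ s, ∫⁻ t, ENNReal.ofReal ((g s - g t) ^ 2) ∂(weightMeasure (n - (i : ℕ)) i)
        ∂(weightMeasure (n - (i : ℕ)) i) ≤
      ∫⁻ s, ∫⁻ t, ∫⁻ y, (I t * (2 * F (ins s y)) + I s * (2 * F (ins t y))) := by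
    have hm1 : Measurable fun s => ∫⁻ t, ENNReal.ofReal ((g s - g t) ^ 2)
        ∂(weightMeasure (n - (i : ℕ)) i) := hgm.lintegral_prod_right'
    have hm2 : Measurable fun s => I s * (ENNReal.ofReal ((1 - s) ^ (n - (i : ℕ)) * s ^ (i : ℕ)) *
        ∫⁻ t, ENNReal.ofReal ((g s - g t) ^ 2) ∂(weightMeasure (n - (i : ℕ)) i)) :=
      hIm.mul ((measurable_weight _ _).mul hm1)
    rw [hw _ hm1, ← lintegral_const_mul _ hm2]
    refine lintegral_mono fun s => ?_
    have hgs : Measurable fun t => ENNReal.ofReal ((g s - g t) ^ 2) := by fun_prop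
    rw [hw _ hgs, ← lintegral_const_mul _ (by fun_prop), ← lintegral_const_mul _ (by fun_prop),
      ← lintegral_const_mul _ (by fun_prop)]
    refine lintegral_mono fun t => ?_
    by_cases hs : s ∈ Set.Icc (0 : ℝ) 1
    swap
    · simp [hI, hs]
    by_cases ht : t ∈ Set.Icc (0 : ℝ) 1
    swap
    · simp [hI, ht]
    have hIs : I s = 1 := by simp [hI, hs]
    have hIt : I t = 1 := by simp [hI, ht]
    simp only [hIs, hIt, one_mul]
    have hV := weight_mul_weight_le_volume i hs ht
    have hws : 0 ≤ (1 - s) ^ (n - (i : ℕ)) * s ^ (i : ℕ) := weight_nonneg hs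
    rw [ENNReal.ofReal_mul (by positivity), ENNReal.ofReal_mul hws] at hV
    calc _ = (ENNReal.ofReal (((n : ℝ) ^ n)⁻¹) *
          (ENNReal.ofReal ((1 - s) ^ (n - (i : ℕ)) * s ^ (i : ℕ)) *
            ENNReal.ofReal ((1 - t) ^ (n - (i : ℕ)) * t ^ (i : ℕ)))) *
            ENNReal.ofReal ((g s - g t) ^ 2) := by ring
      _ ≤ V s t * ENNReal.ofReal ((g s - g t) ^ 2) := by gcongr
      _ = ∫⁻ y in {y : Fin n → ℝ | ins s y ∈ S ∧ ins t y ∈ S},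
          ENNReal.ofReal ((g s - g t) ^ 2) := by
          rw [setLIntegral_const, mul_comm]
      _ ≤ ∫⁻ y, (2 * F (ins s y) + 2 * F (ins t y)) := by
          rw [← lintegral_indicator (hset s t)]
          refine lintegral_mono fun y => ?_
          by_cases hy : ins s y ∈ S ∧ ins t y ∈ S
          · rw [Set.indicator_of_mem (s := {y | ins s y ∈ S ∧ ins t y ∈ S}) hy]
            simp only [hF, Set.indicator_of_mem hy.1, Set.indicator_of_mem hy.2]
            rw [← hgH s t y, ← mul_add, ← ENNReal.ofReal_add (sq_nonneg _) (sq_nonneg _),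
              ← ENNReal.ofReal_ofNat 2, ← ENNReal.ofReal_mul zero_le_two]
            refine ENNReal.ofReal_le_ofReal ?_
            show (H (ins s y) - H (ins t y)) ^ 2 ≤ _
            nlinarith [sq_nonneg (H (ins s y) + H (ins t y))]
          · rw [Set.indicator_of_notMem (s := {y | ins s y ∈ S ∧ ins t y ∈ S}) hy]
            exact zero_le
  refine hstep.trans (le_of_eq ?_)
  rw [hFint]
  have hFy : ∀ s, Measurable fun y => F (ins s y) := fun s =>
    hFm.comp (hinsm.comp (measurable_const.prodMk measurable_id))
  have hG : Measurable fun s => ∫⁻ y, F (ins s y) := (hFm.comp hinsm).lintegral_prod_right'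
  have e1 : ∀ s t, ∫⁻ y, (I t * (2 * F (ins s y)) + I s * (2 * F (ins t y))) =
      I t * (2 * ∫⁻ y, F (ins s y)) + I s * (2 * ∫⁻ y, F (ins t y)) := by
    intro s t
    rw [lintegral_add_left (((hFy s).const_mul _).const_mul _),
      lintegral_const_mul _ ((hFy s).const_mul _), lintegral_const_mul _ (hFy s),
      lintegral_const_mul _ ((hFy t).const_mul _), lintegral_const_mul _ (hFy t)]
  have e2 : ∀ s, ∫⁻ t, (I t * (2 * ∫⁻ y, F (ins s y)) + I s * (2 * ∫⁻ y, F (ins t y))) =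
      2 * (∫⁻ y, F (ins s y)) + I s * (2 * ∫⁻ t, ∫⁻ y, F (ins t y)) := by
    intro s
    rw [lintegral_add_left (hIm.mul_const _), lintegral_mul_const _ hIm, hI1, one_mul,
      lintegral_const_mul _ (hG.const_mul _), lintegral_const_mul _ hG]
  simp_rw [e1, e2]
  rw [lintegral_add_left (hG.const_mul _), lintegral_const_mul _ hG, lintegral_mul_const _ hIm, hI1,
    one_mul, ← two_mul, ← mul_assoc]
  norm_num

/-- Total mass of a Jacobi weight. -/
lemma measureReal_weightMeasure_univ (a b : ℕ) :
    (weightMeasure a b).real Set.univ = a ! * b ! / ((a + b + 1)! : ℝ) := by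
  have := integral_weightMeasure a b (fun _ => 1)
  simpa [integral_weight] using this

/-- The constant in the lower bound for the norm of additive functions on the simplex. -/
def additiveConst (d : ℕ) : ℝ := (((d - 1 : ℕ) : ℝ) ^ (d - 1) * 4 * d !)⁻¹

lemma additiveConst_pos (d : ℕ) : 0 < additiveConst d := by
  unfold additiveConst
  rcases Nat.eq_zero_or_pos (d - 1) with h | h
  · rw [h]; positivity
  · positivity

/-- The `L²` norm on the simplex of a function that is additive in the coordinate `i` controls the
norm of the (centred) component. -/
theorem integral_weightMeasure_sq_le {d : ℕ} (i : Fin d) {g : ℝ → ℝ} (hg : Continuous g)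
    (hg0 : ∫ t, g t ∂(weightMeasure (d - 1 - (i : ℕ)) i) = 0)
    {H : (Fin d → ℝ) → ℝ} (hH : Continuous H)
    (hgH : ∀ x t, H (Function.update x i t) - H x = g t - g (x i)) :
    additiveConst d * ∫ t, g t ^ 2 ∂(weightMeasure (d - 1 - (i : ℕ)) i) ≤
      ∫ x in simplex d, H x ^ 2 := by
  obtain ⟨n, rfl⟩ : ∃ n, d = n + 1 := ⟨d - 1, by have := i.2; omega⟩
  have hi : (i : ℕ) ≤ n := Nat.lt_succ_iff.1 i.2
  simp only [Nat.add_sub_cancel] at hg0 ⊢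
  set μ := weightMeasure (n - (i : ℕ)) i with hμ
  have hLp := memLp_of_continuousOn_Icc (a := n - (i : ℕ)) (b := i) hg.continuousOn 2
  have hLpi := hLp.integrable one_le_two
  have hins : ∀ s t y, H (i.insertNth (α := fun _ => ℝ) s y) -
      H (i.insertNth (α := fun _ => ℝ) t y) = g s - g t := by
    intro s t y
    have := hgH (i.insertNth (α := fun _ => ℝ) t y) s
    rwa [Fin.update_insertNth, Fin.insertNth_apply_same] at this
  have key := lintegral_sub_sq_le i hg.measurable hH.measurable hins
  set W := μ.real Set.univ with hW
  have hWval : W = (n - (i : ℕ))! * (i : ℕ)! / ((n + 1)! : ℝ) := by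
    rw [hW, hμ, measureReal_weightMeasure_univ, Nat.sub_add_cancel hi]
  have hW1 : ((n + 1)! : ℝ)⁻¹ ≤ W := by
    rw [hWval, inv_eq_one_div]
    gcongr
    have h1 : (1 : ℝ) ≤ (n - (i : ℕ))! := by exact_mod_cast Nat.factorial_pos _
    have h2 : (1 : ℝ) ≤ (i : ℕ)! := by exact_mod_cast Nat.factorial_pos _
    nlinarith
  have hW0 : 0 ≤ W := measureReal_nonneg
  have hinner : ∀ s, ENNReal.ofReal (W * g s ^ 2) ≤
      ∫⁻ t, ENNReal.ofReal ((g s - g t) ^ 2) ∂μ := by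
    intro s
    have hi1 : Integrable (fun t => (g s - g t) ^ 2) μ :=
      (memLp_of_continuousOn_Icc (continuous_const.sub hg).continuousOn 2).integrable_sq
    rw [← ofReal_integral_eq_lintegral_ofReal hi1 (ae_of_all _ fun t => sq_nonneg _)]
    refine ENNReal.ofReal_le_ofReal ?_
    -- Centring removes the cross term; the second square is then discarded.
    have : ∫ t, (g s - g t) ^ 2 ∂μ = W * g s ^ 2 + ∫ t, g t ^ 2 ∂μ := by
      have e : ∀ t, (g s - g t) ^ 2 = g s ^ 2 - 2 * g s * g t + g t ^ 2 := fun t => by ring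
      simp_rw [e]
      have i1 : Integrable (fun t => g s ^ 2 - 2 * g s * g t) μ :=
        (integrable_const _).sub (hLpi.const_mul _)
      rw [integral_add i1 hLp.integrable_sq,
        integral_sub (integrable_const _) (hLpi.const_mul _), integral_const_mul, hg0,
        integral_const, smul_eq_mul]
      ring
    rw [this]
    have := integral_nonneg (μ := μ) (f := fun t => g t ^ 2) fun t => sq_nonneg _
    linarith
  have houter : ENNReal.ofReal (W * ∫ t, g t ^ 2 ∂μ) ≤
      ∫⁻ s, ∫⁻ t, ENNReal.ofReal ((g s - g t) ^ 2) ∂μ ∂μ := by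
    refine le_trans (le_of_eq ?_) (lintegral_mono hinner)
    rw [← ofReal_integral_eq_lintegral_ofReal (hLp.integrable_sq.const_mul _)
      (ae_of_all _ fun t => by positivity), integral_const_mul]
  have hHint : IntegrableOn (fun x => H x ^ 2) (simplex (n + 1)) :=
    (hH.pow 2).continuousOn.integrableOn_compact (isCompact_simplex _)
  have hfin : ENNReal.ofReal (((n : ℝ) ^ n)⁻¹ * (W * ∫ t, g t ^ 2 ∂μ)) ≤
      ENNReal.ofReal (4 * ∫ x in simplex (n + 1), H x ^ 2) := by
    rw [ENNReal.ofReal_mul (by positivity), ENNReal.ofReal_mul (by norm_num : (0 : ℝ) ≤ 4),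
      ofReal_integral_eq_lintegral_ofReal hHint (ae_of_all _ fun t => sq_nonneg _),
      ENNReal.ofReal_ofNat]
    refine le_trans ?_ key
    gcongr
  have hH0 : 0 ≤ ∫ x in simplex (n + 1), H x ^ 2 := integral_nonneg fun x => sq_nonneg _
  rw [ENNReal.ofReal_le_ofReal_iff (by positivity)] at hfin
  have hg2 : 0 ≤ ∫ t, g t ^ 2 ∂μ := integral_nonneg fun t => sq_nonneg _
  have h1 : ((n : ℝ) ^ n)⁻¹ * (((n + 1)! : ℝ)⁻¹ * ∫ t, g t ^ 2 ∂μ) ≤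
      4 * ∫ x in simplex (n + 1), H x ^ 2 := le_trans (by gcongr) hfin
  unfold additiveConst
  simp only [Nat.add_sub_cancel]
  rw [mul_inv, mul_inv]
  linarith

/-! ### Exponential families with essentially bounded statistics -/

lemma exp_sub_one_sub_le {v M : ℝ} (hv : |v| ≤ M) : Real.exp v - 1 - v ≤ Real.exp M * v ^ 2 := by
  have hM : 0 ≤ M := (abs_nonneg v).trans hv
  have h0 := Real.add_one_le_exp (-v)
  have h1 : Real.exp v * Real.exp (-v) = 1 := by rw [← Real.exp_add]; simp
  have h2 := Real.exp_pos v
  have h3 : Real.exp v ≤ Real.exp M := Real.exp_le_exp.2 ((le_abs_self v).trans hv)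
  have h4 : 1 ≤ Real.exp M := Real.one_le_exp hM
  have h5 : Real.exp v - 1 ≤ v * Real.exp v := by nlinarith
  rcases le_total 0 v with h | h
  · have h6 : v * (Real.exp v - 1) ≤ v * (v * Real.exp v) := mul_le_mul_of_nonneg_left h5 h
    have h7 : v ^ 2 * Real.exp v ≤ v ^ 2 * Real.exp M :=
      mul_le_mul_of_nonneg_left h3 (sq_nonneg v)
    nlinarith
  · have h6 : v ≤ Real.exp v - 1 := by linarith [Real.add_one_le_exp v]
    have h7 : v * (Real.exp v - 1) ≤ v * v := mul_le_mul_of_nonpos_left h6 h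
    nlinarith [mul_le_mul_of_nonneg_right h4 (sq_nonneg v)]

/-- For v ≥ 0 the exponential series suffices, on [-2, 0] the bound e^v ≥ (1 + v/2)², and below -2
the linear growth of -1 - v, which accounts for the factor 1 + M. -/
lemma sq_div_le_exp_sub_one_sub {v M : ℝ} (hv : |v| ≤ M) :
    v ^ 2 / (4 * (1 + M)) ≤ Real.exp v - 1 - v := by
  have hM : 0 ≤ M := (abs_nonneg v).trans hv
  rw [div_le_iff₀ (by positivity)]
  rcases le_total 0 v with h | h
  · have h1 := Real.quadratic_le_exp_of_nonneg h
    nlinarith [sq_nonneg v]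
  · rcases le_total (-2) v with h2 | h2
    · have h3 := Real.add_one_le_exp (v / 2)
      have h4 : Real.exp v = Real.exp (v / 2) ^ 2 := by rw [← Real.exp_nat_mul]; congr 1; ring
      have h5 : (v / 2 + 1) ^ 2 ≤ Real.exp v := by
        rw [h4]; exact pow_le_pow_left₀ (by linarith) h3 2
      nlinarith [sq_nonneg v]
    · have h3 := Real.exp_pos v
      rw [abs_of_nonpos h] at hv
      nlinarith

section EssBounded

variable {E : Type*} [MeasurableSpace E] {P : Measure E}

/-- Almost everywhere measurable and essentially bounded functions. -/
def EssBounded (P : Measure E) (v : E → ℝ) : Prop :=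
  AEMeasurable v P ∧ ∃ M : ℝ, ∀ᵐ x ∂P, |v x| ≤ M

namespace EssBounded

variable {v w : E → ℝ}

lemma zero : EssBounded P 0 := ⟨aemeasurable_const, 0, by simp⟩

lemma add (hv : EssBounded P v) (hw : EssBounded P w) : EssBounded P (v + w) := by
  obtain ⟨M, hM⟩ := hv.2
  obtain ⟨N, hN⟩ := hw.2
  refine ⟨hv.1.add hw.1, M + N, ?_⟩
  filter_upwards [hM, hN] with x h1 h2
  exact (abs_add_le _ _).trans (add_le_add h1 h2)

lemma const_smul (hv : EssBounded P v) (c : ℝ) : EssBounded P (c • v) := by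
  obtain ⟨M, hM⟩ := hv.2
  refine ⟨hv.1.const_smul c, |c| * M, ?_⟩
  filter_upwards [hM] with x h1
  rw [Pi.smul_apply, smul_eq_mul, abs_mul]
  gcongr

lemma sum {ι : Type*} (s : Finset ι) {f : ι → E → ℝ} (hf : ∀ i ∈ s, EssBounded P (f i)) :
    EssBounded P (∑ i ∈ s, f i) :=
  Finset.sum_induction f (EssBounded P) (fun _ _ => add) zero hf

lemma sub (hv : EssBounded P v) (hw : EssBounded P w) : EssBounded P (v - w) := by
  have := hv.add (hw.const_smul (-1))
  rwa [neg_one_smul, ← sub_eq_add_neg] at this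

lemma mono {Q : Measure E} (hv : EssBounded P v) (hQ : Q ≪ P) : EssBounded Q v := by
  obtain ⟨M, hM⟩ := hv.2
  exact ⟨hv.1.mono_ac hQ, M, hQ.ae_le hM⟩

lemma integrable [IsFiniteMeasure P] (hv : EssBounded P v) : Integrable v P := by
  obtain ⟨M, hM⟩ := hv.2
  exact Integrable.of_bound hv.1.aestronglyMeasurable M hM

lemma integrable_sq [IsFiniteMeasure P] (hv : EssBounded P v) :
    Integrable (fun x => v x ^ 2) P := by
  obtain ⟨M, hM⟩ := hv.2
  refine Integrable.of_bound (hv.1.pow_const 2).aestronglyMeasurable (M ^ 2) ?_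
  filter_upwards [hM] with x hx
  rw [Real.norm_eq_abs, abs_pow]
  gcongr

lemma integrable_exp [IsFiniteMeasure P] (hv : EssBounded P v) :
    Integrable (fun x => Real.exp (v x)) P := by
  obtain ⟨M, hM⟩ := hv.2
  refine Integrable.of_bound (Real.measurable_exp.comp_aemeasurable hv.1).aestronglyMeasurable
    (Real.exp M) ?_
  filter_upwards [hM] with x hx
  rw [Real.norm_eq_abs, Real.abs_exp]
  exact Real.exp_le_exp.2 ((le_abs_self _).trans hx)

end EssBounded

/-- The exponent of an exponential family with offset `w`. -/
def familyExponent {ι : Type*} [Fintype ι] (T : ι → E → ℝ) (w : E → ℝ) (θ : ι → ℝ) : E → ℝ :=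
  ∑ p, θ p • T p + w

lemma essBounded_familyExponent {ι : Type*} [Fintype ι] {T : ι → E → ℝ} {w : E → ℝ}
    (hT : ∀ p, EssBounded P (T p)) (hw : EssBounded P w) (θ : ι → ℝ) :
    EssBounded P (familyExponent T w θ) :=
  (EssBounded.sum _ fun p _ => (hT p).const_smul _).add hw

/-! ### Log moments, tilted measures and divergence. -/

/-- The logarithm of the exponential moment of `v`. -/
def logExpMoment (P : Measure E) (v : E → ℝ) : ℝ := Real.log (∫ x, Real.exp (v x) ∂P)

variable [IsProbabilityMeasure P] {v w : E → ℝ}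

lemma exp_logExpMoment (hv : EssBounded P v) :
    Real.exp (logExpMoment P v) = ∫ x, Real.exp (v x) ∂P :=
  Real.exp_log (integral_exp_pos hv.integrable_exp)

lemma isProbabilityMeasure_tilted_of_essBounded (hv : EssBounded P v) :
    IsProbabilityMeasure (P.tilted v) :=
  isProbabilityMeasure_tilted hv.integrable_exp

/-- Gradient inequality for the log partition function. -/
lemma logExpMoment_add_integral_le (hv : EssBounded P v) (hw : EssBounded P w) :
    logExpMoment P v + ∫ x, (w x - v x) ∂(P.tilted v) ≤ logExpMoment P w := by
  have := isProbabilityMeasure_tilted_of_essBounded hv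
  have hd : EssBounded (P.tilted v) (w - v) :=
    (hw.sub hv).mono (tilted_absolutelyContinuous P v)
  set c := ∫ x, (w x - v x) ∂(P.tilted v) with hc
  -- Jensen's inequality, from 1 + y ≤ e^y applied to the centred difference.
  have h1 : 1 ≤ ∫ x, Real.exp ((w - v) x - c) ∂(P.tilted v) := by
    have h2 : ∫ x, ((w - v) x - c + 1) ∂(P.tilted v) = 1 := by
      have h4 : Integrable (fun x => (w - v) x - c) (P.tilted v) :=
        hd.integrable.sub (integrable_const _)
      rw [integral_add h4 (integrable_const _),
        integral_sub hd.integrable (integrable_const _)]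
      simp [hc]
    rw [← h2]
    refine integral_mono ((hd.integrable.sub (integrable_const _)).add (integrable_const _)) ?_
      fun x => Real.add_one_le_exp _
    simp_rw [Real.exp_sub _ c]
    exact hd.integrable_exp.div_const _
  have h3 : ∫ x, Real.exp ((w - v) x - c) ∂(P.tilted v) =
      (∫ x, Real.exp (w x) ∂P) / (∫ x, Real.exp (v x) ∂P) / Real.exp c := by
    simp_rw [Real.exp_sub _ c]
    rw [integral_div, integral_exp_tilted]
    simp
  rw [h3, le_div_iff₀ (Real.exp_pos c), one_mul, ← exp_logExpMoment hv, ← exp_logExpMoment hw,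
    ← Real.exp_sub, Real.exp_le_exp] at h1
  linarith

lemma abs_logExpMoment_le {M : ℝ} (hv : EssBounded P v) (hM : ∀ᵐ x ∂P, |v x| ≤ M) :
    |logExpMoment P v| ≤ M := by
  rw [abs_le, ← Real.exp_le_exp, ← Real.exp_le_exp (y := M), exp_logExpMoment hv]
  constructor
  · have : ∫ _, Real.exp (-M) ∂P ≤ ∫ x, Real.exp (v x) ∂P := by
      refine integral_mono_ae (integrable_const _) hv.integrable_exp ?_
      filter_upwards [hM] with x hx
      exact Real.exp_le_exp.2 (abs_le.1 hx).1
    simpa using this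
  · have : ∫ x, Real.exp (v x) ∂P ≤ ∫ _, Real.exp M ∂P := by
      refine integral_mono_ae hv.integrable_exp (integrable_const _) ?_
      filter_upwards [hM] with x hx
      exact Real.exp_le_exp.2 (abs_le.1 hx).2
    simpa using this

/-- The Kullback-Leibler divergence of a probability measure with respect to its tilt by `v`. -/
def klTilted (P : Measure E) (v : E → ℝ) : ℝ := logExpMoment P v - ∫ x, v x ∂P

lemma klDiv_tilted (hv : EssBounded P v) :
    InformationTheory.klDiv P (P.tilted v) = ENNReal.ofReal (klTilted P v) := by
  have := isProbabilityMeasure_tilted_of_essBounded hv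
  have h0 : Integrable (llr P P) P :=
    (integrable_congr (llr_self P)).2 (integrable_zero _ _ _)
  have hac : P ≪ P.tilted v := absolutelyContinuous_tilted hv.integrable_exp
  rw [InformationTheory.klDiv_of_ac_of_integrable hac
    (integrable_llr_tilted_right Measure.AbsolutelyContinuous.rfl hv.integrable h0
      hv.integrable_exp),
    integral_llr_tilted_right Measure.AbsolutelyContinuous.rfl hv.integrable hv.integrable_exp h0,
    integral_congr_ae (llr_self P)]
  simp only [klTilted, logExpMoment, Pi.zero_apply, integral_zero, probReal_univ]
  congr 1
  ring

/-- By log z ≤ z - 1 the divergence is at most the mean of e^v - 1 - v, with no normalisation of v.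
-/
lemma klTilted_le {M : ℝ} (hv : EssBounded P v) (hM : ∀ᵐ x ∂P, |v x| ≤ M) :
    klTilted P v ≤ Real.exp M * ∫ x, v x ^ 2 ∂P := by
  have h1 : logExpMoment P v ≤ ∫ x, Real.exp (v x) ∂P - 1 :=
    Real.log_le_sub_one_of_pos (integral_exp_pos hv.integrable_exp)
  have h2 : ∫ x, (Real.exp (v x) - 1 - v x) ∂P ≤ ∫ x, Real.exp M * v x ^ 2 ∂P := by
    refine integral_mono_ae ((hv.integrable_exp.sub (integrable_const _)).sub hv.integrable)
      (hv.integrable_sq.const_mul _) ?_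
    filter_upwards [hM] with x hx
    exact exp_sub_one_sub_le hx
  have h3 : ∫ x, (Real.exp (v x) - 1 - v x) ∂P = ∫ x, Real.exp (v x) ∂P - 1 - ∫ x, v x ∂P := by
    have h4 : Integrable (fun x => Real.exp (v x) - 1) P :=
      hv.integrable_exp.sub (integrable_const _)
    rw [integral_sub h4 hv.integrable,
      integral_sub hv.integrable_exp (integrable_const _)]
    simp
  rw [h3, integral_const_mul] at h2
  rw [klTilted]
  linarith

/-- For u = v - c with c the log moment, e^u has mean one and the divergence is exactly the mean of
e^u - 1 - u. The bound 2M for u comes from |c| ≤ M. -/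
lemma le_klTilted {M : ℝ} (hv : EssBounded P v) (hM : ∀ᵐ x ∂P, |v x| ≤ M) :
    (∫ x, (v x - logExpMoment P v) ^ 2 ∂P) / (4 * (1 + 2 * M)) ≤ klTilted P v := by
  set c := logExpMoment P v with hc
  have hcM := abs_logExpMoment_le hv hM
  have hconst : EssBounded P fun _ => c := ⟨aemeasurable_const, |c|, by simp⟩
  have hu : EssBounded P (fun x => v x - c) := hv.sub hconst
  have huM : ∀ᵐ x ∂P, |v x - c| ≤ 2 * M := by
    filter_upwards [hM] with x hx
    calc |v x - c| ≤ |v x| + |c| := abs_sub _ _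
      _ ≤ 2 * M := by linarith
  have h1 : ∫ x, (v x - c) ^ 2 / (4 * (1 + 2 * M)) ∂P ≤
      ∫ x, (Real.exp (v x - c) - 1 - (v x - c)) ∂P := by
    refine integral_mono_ae (hu.integrable_sq.div_const _)
      ((hu.integrable_exp.sub (integrable_const _)).sub hu.integrable) ?_
    filter_upwards [huM] with x hx
    exact sq_div_le_exp_sub_one_sub hx
  have h2 : ∫ x, Real.exp (v x - c) ∂P = 1 := by
    simp_rw [Real.exp_sub _ c]
    rw [integral_div, hc, exp_logExpMoment hv]
    exact div_self (integral_exp_pos hv.integrable_exp).ne'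
  have h3 : ∫ x, (Real.exp (v x - c) - 1 - (v x - c)) ∂P = klTilted P v := by
    have h4 : Integrable (fun x => Real.exp (v x - c) - 1) P :=
      hu.integrable_exp.sub (integrable_const _)
    rw [integral_sub h4 hu.integrable,
      integral_sub hu.integrable_exp (integrable_const _), h2,
      integral_sub hv.integrable (integrable_const _)]
    simp [klTilted, hc]
  rwa [integral_div, h3] at h1

/-! ### Maximum likelihood in exponential families -/

section Likelihood

variable {ι : Type*} [Fintype ι]

/-- The negative log likelihood at the statistic `μ`. -/
def negLogLikelihood (P : Measure E) (T : ι → E → ℝ) (w : E → ℝ) (μ θ : ι → ℝ) : ℝ :=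
  logExpMoment P (familyExponent T w θ) - ∑ p, θ p * μ p

variable {T : ι → E → ℝ} {μ θ θ₀ : ι → ℝ}

lemma negLogLikelihood_add_le (hT : ∀ p, EssBounded P (T p)) (hw : EssBounded P w)
    (μ θ θ' : ι → ℝ) :
    negLogLikelihood P T w μ θ +
      ∑ p, (θ' p - θ p) * (∫ x, T p x ∂(P.tilted (familyExponent T w θ)) - μ p) ≤
      negLogLikelihood P T w μ θ' := by
  have hv := essBounded_familyExponent hT hw
  have := isProbabilityMeasure_tilted_of_essBounded (hv θ)
  have h := logExpMoment_add_integral_le (hv θ) (hv θ')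
  have h1 : ∀ x, familyExponent T w θ' x - familyExponent T w θ x =
      ∑ p, (θ' p - θ p) * T p x := by
    intro x
    simp [familyExponent, Finset.sum_apply, sub_mul, Finset.sum_sub_distrib]
  have hTi : ∀ p, Integrable (T p) (P.tilted (familyExponent T w θ)) := fun p =>
    ((hT p).mono (tilted_absolutelyContinuous P _)).integrable
  simp_rw [h1] at h
  rw [integral_finsetSum _ fun p _ => (hTi p).const_mul _] at h
  simp_rw [integral_const_mul] at h
  have h2 : ∑ p, (θ' p - θ p) * (∫ x, T p x ∂(P.tilted (familyExponent T w θ)) - μ p) =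
      ∑ p, (θ' p - θ p) * ∫ x, T p x ∂(P.tilted (familyExponent T w θ)) -
        (∑ p, θ' p * μ p - ∑ p, θ p * μ p) := by
    rw [← Finset.sum_sub_distrib, ← Finset.sum_sub_distrib]
    exact Finset.sum_congr rfl fun p _ => by ring
  rw [negLogLikelihood, negLogLikelihood, h2]
  linarith

/-- Average the two gradient inequalities taken at the intermediate point; their linear terms
cancel. -/
lemma convexOn_negLogLikelihood (hT : ∀ p, EssBounded P (T p)) (hw : EssBounded P w)
    (μ : ι → ℝ) : ConvexOn ℝ Set.univ (negLogLikelihood P T w μ) := by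
  refine ⟨convex_univ, fun θ _ θ' _ a b ha hb hab => ?_⟩
  set s := a • θ + b • θ' with hs
  set G := fun p => ∫ x, T p x ∂(P.tilted (familyExponent T w s)) - μ p with hG
  have h1 := negLogLikelihood_add_le hT hw μ s θ
  have h2 := negLogLikelihood_add_le hT hw μ s θ'
  have h3 : a * ∑ p, (θ p - s p) * G p + b * ∑ p, (θ' p - s p) * G p = 0 := by
    rw [Finset.mul_sum, Finset.mul_sum, ← Finset.sum_add_distrib]
    refine Finset.sum_eq_zero fun p _ => ?_
    simp only [hs, Pi.add_apply, Pi.smul_apply, smul_eq_mul]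
    obtain rfl : a = 1 - b := by linarith
    ring
  have h4 := mul_le_mul_of_nonneg_left h1 ha
  have h5 := mul_le_mul_of_nonneg_left h2 hb
  have h6 : negLogLikelihood P T w μ s =
      a * negLogLikelihood P T w μ s + b * negLogLikelihood P T w μ s := by
    rw [← add_mul, hab, one_mul]
  simp only [smul_eq_mul]
  simp only [hG] at h3
  linarith

lemma continuous_negLogLikelihood (hT : ∀ p, EssBounded P (T p)) (hw : EssBounded P w)
    (μ : ι → ℝ) : Continuous (negLogLikelihood P T w μ) :=
  (convexOn_negLogLikelihood hT hw μ).locallyLipschitz.continuous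

/-- The likelihood equations at a local minimum of the negative log likelihood. -/
lemma integral_eq_of_isLocalMin [DecidableEq ι] (hT : ∀ p, EssBounded P (T p))
    (hw : EssBounded P w) (hmin : IsLocalMin (negLogLikelihood P T w μ) θ) (p : ι) :
    ∫ x, T p x ∂(P.tilted (familyExponent T w θ)) = μ p := by
  have hv := essBounded_familyExponent hT hw
  set Q := P.tilted (familyExponent T w θ) with hQ
  have hQp : IsProbabilityMeasure Q := isProbabilityMeasure_tilted_of_essBounded (hv θ)
  have hTQ : EssBounded Q (T p) := (hT p).mono (tilted_absolutelyContinuous P _)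
  have huniv : integrableExpSet (T p) Q = Set.univ :=
    Set.eq_univ_of_forall fun t => (hTQ.const_smul t).integrable_exp
  have h0 : (0 : ℝ) ∈ interior (integrableExpSet (T p) Q) := by rw [huniv]; simp
  have hexp : ∀ t : ℝ, familyExponent T w (θ + t • Pi.single p 1) =
      familyExponent T w θ + t • T p := by
    intro t
    have : ∑ q, (t • (Pi.single p (1 : ℝ) : ι → ℝ)) q • T q = t • T p := by
      rw [Finset.sum_eq_single p] <;> simp +contextual
    simp only [familyExponent, Pi.add_apply, add_smul, Finset.sum_add_distrib, this]
    abel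
  -- Along a coordinate line the function is a cumulant generating function under the tilted law
  -- minus a linear term, so its derivative at 0 is the difference of means.
  have hF : ∀ t : ℝ, negLogLikelihood P T w μ (θ + t • Pi.single p 1) =
      negLogLikelihood P T w μ θ + (cgf (T p) Q t - t * μ p) := by
    intro t
    have h1 : ∑ q, (θ + t • (Pi.single p (1 : ℝ) : ι → ℝ)) q * μ q =
        ∑ q, θ q * μ q + t * μ p := by
      simp only [Pi.add_apply, add_mul, Finset.sum_add_distrib]
      congr 1
      rw [Finset.sum_eq_single p] <;> simp +contextual
    have h2 : cgf (T p) Q t = logExpMoment P (familyExponent T w (θ + t • Pi.single p 1)) -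
        logExpMoment P (familyExponent T w θ) := by
      rw [cgf, mgf, hQ]
      have h3 := integral_exp_tilted (μ := P) (familyExponent T w θ) (t • T p)
      simp only [Pi.smul_apply, smul_eq_mul] at h3
      rw [h3, Real.log_div (integral_exp_pos ((hv θ).add ((hT p).const_smul t)).integrable_exp).ne'
        (integral_exp_pos (hv θ).integrable_exp).ne', hexp]
      rfl
    rw [negLogLikelihood, negLogLikelihood, h1, h2]
    ring
  have hmin' : IsLocalMin (fun t : ℝ => cgf (T p) Q t - t * μ p) 0 := by
    have hc : ContinuousAt (fun t : ℝ => θ + t • (Pi.single p (1 : ℝ) : ι → ℝ)) 0 := by fun_prop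
    have h1 : IsLocalMin (negLogLikelihood P T w μ)
        ((fun t : ℝ => θ + t • (Pi.single p (1 : ℝ) : ι → ℝ)) 0) := by simpa using hmin
    have h2 : IsLocalMin (negLogLikelihood P T w μ ∘
        fun t : ℝ => θ + t • (Pi.single p (1 : ℝ) : ι → ℝ)) 0 :=
      IsLocalMin.comp_continuous (g := fun t : ℝ => θ + t • (Pi.single p (1 : ℝ) : ι → ℝ)) h1 hc
    filter_upwards [h2] with t ht
    simp only [Function.comp_apply, hF] at ht
    linarith
  have hdiff : HasDerivAt (cgf (T p) Q) (∫ x, T p x ∂Q) 0 := by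
    have h1 := deriv_cgf_zero h0
    rw [probReal_univ, div_one] at h1
    rw [← h1]
    exact (analyticAt_cgf h0).differentiableAt.hasDerivAt
  have h3 := hmin'.hasDerivAt_eq_zero (hdiff.sub ((hasDerivAt_id (0 : ℝ)).mul_const (μ p)))
  simp only [one_mul] at h3
  linarith

/-- If the negative log likelihood on a sphere around `θ₀` is larger than at `θ₀`, then the
likelihood equations have a solution, and all solutions are inside the sphere. -/
theorem exists_solution_of_sphere [DecidableEq ι] (hT : ∀ p, EssBounded P (T p))
    (hw : EssBounded P w) {R : ℝ} (hR : 0 < R)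
    (hsphere : ∀ θ, ∑ p, (θ p - θ₀ p) ^ 2 = R →
      negLogLikelihood P T w μ θ₀ < negLogLikelihood P T w μ θ) :
    (∃ θ, ∀ p, ∫ x, T p x ∂(P.tilted (familyExponent T w θ)) = μ p) ∧
    ∀ θ, (∀ p, ∫ x, T p x ∂(P.tilted (familyExponent T w θ)) = μ p) →
      ∑ p, (θ p - θ₀ p) ^ 2 ≤ R ∧
        negLogLikelihood P T w μ θ ≤ negLogLikelihood P T w μ θ₀ := by
  have hcont := continuous_negLogLikelihood hT hw μ
  constructor
  · set N : (ι → ℝ) → ℝ := fun θ => ∑ p, (θ p - θ₀ p) ^ 2 with hN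
    have hNc : Continuous N := by fun_prop
    have hcpt : IsCompact {θ | N θ ≤ R} := by
      refine (isCompact_univ_pi fun p => isCompact_Icc (a := θ₀ p - √R) (b := θ₀ p + √R)).of_isClosed_subset
        (isClosed_le hNc continuous_const) fun θ hθ p _ => ?_
      have h1 : (θ p - θ₀ p) ^ 2 ≤ R := le_trans
        (Finset.single_le_sum (f := fun p => (θ p - θ₀ p) ^ 2) (fun _ _ => sq_nonneg _)
          (Finset.mem_univ p)) hθ
      have h2 := Real.abs_le_sqrt h1
      rw [abs_le] at h2
      exact ⟨by linarith [h2.1], by linarith [h2.2]⟩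
    have h0 : θ₀ ∈ {θ | N θ ≤ R} := by
      show N θ₀ ≤ R
      simp [hN, hR.le]
    obtain ⟨θ, hθ, hθmin⟩ := hcpt.exists_isMinOn ⟨θ₀, h0⟩ hcont.continuousOn
    -- A minimiser over the closed ball cannot lie on the sphere, where the values exceed the one at
    -- the centre.
    have hlt : N θ < R := by
      refine lt_of_le_of_ne hθ fun h => ?_
      exact absurd (hθmin h0) (not_le.2 (hsphere θ h))
    have hnhds : {θ | N θ ≤ R} ∈ 𝓝 θ :=
      mem_of_superset ((isOpen_lt hNc continuous_const).mem_nhds hlt) fun x (h : N x < R) => (h.le : N x ≤ R)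
    exact ⟨θ, integral_eq_of_isLocalMin hT hw (hθmin.isLocalMin hnhds)⟩
  · intro θ hθ
    have hle : negLogLikelihood P T w μ θ ≤ negLogLikelihood P T w μ θ₀ := by
      have := negLogLikelihood_add_le hT hw μ θ θ₀
      simpa [hθ] using this
    refine ⟨?_, hle⟩
    by_contra! hlt
    -- The parameter at which the segment from θ₀ to θ crosses the sphere; convexity there
    -- contradicts the lower bound.
    set t := √(R / ∑ p, (θ p - θ₀ p) ^ 2) with ht
    have hpos : 0 < ∑ p, (θ p - θ₀ p) ^ 2 := hR.trans hlt
    have ht0 : 0 ≤ t := Real.sqrt_nonneg _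
    have ht1 : t ≤ 1 := by
      rw [ht, Real.sqrt_le_one, div_le_one hpos]
      exact hlt.le
    have hts : t ^ 2 * ∑ p, (θ p - θ₀ p) ^ 2 = R := by
      rw [ht, Real.sq_sqrt (by positivity), div_mul_cancel₀ _ hpos.ne']
    have h1 := hsphere ((1 - t) • θ₀ + t • θ) (by
      rw [← hts, Finset.mul_sum]
      refine Finset.sum_congr rfl fun p _ => ?_
      simp only [Pi.add_apply, Pi.smul_apply, smul_eq_mul]
      ring)
    have h2 := (convexOn_negLogLikelihood hT hw μ).2 (Set.mem_univ θ₀) (Set.mem_univ θ)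
      (sub_nonneg.2 ht1) ht0 (by ring)
    simp only [smul_eq_mul] at h2
    nlinarith

end Likelihood

end EssBounded

/-! ### The basis functions of the model -/

/-- The reciprocal of the normalising constant of a marginal. -/
def marginalConst (d : ℕ) (i : Fin d) : ℝ := (d - 1 - (i : ℕ))! * (i : ℕ)!

lemma one_le_marginalConst (d : ℕ) (i : Fin d) : 1 ≤ marginalConst d i := by
  have h1 : (1 : ℝ) ≤ (d - 1 - (i : ℕ))! := by exact_mod_cast Nat.factorial_pos _
  have h2 : (1 : ℝ) ≤ (i : ℕ)! := by exact_mod_cast Nat.factorial_pos _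
  exact one_le_mul_of_one_le_of_one_le h1 h2

lemma marginalConst_pos (d : ℕ) (i : Fin d) : 0 < marginalConst d i :=
  zero_lt_one.trans_le (one_le_marginalConst d i)

lemma marginalConst_le (d : ℕ) (i : Fin d) : marginalConst d i ≤ d ! := by
  have h1 : (d - 1 - (i : ℕ))! * (i : ℕ)! ≤ d ! := by
    refine (Nat.le_of_dvd (Nat.factorial_pos _) (Nat.factorial_mul_factorial_dvd_factorial_add _ _)).trans
      (Nat.factorial_le ?_)
    have := i.2
    omega
  unfold marginalConst
  exact_mod_cast h1

/-- With a = d - 1 - i and b = i one has a + b + 1 = d, so the normalisations match. The sign comes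
from Rodrigues' formula, and the square root from the mass of the unnormalised weight. -/
lemma phi_eq {d : ℕ} (i : Fin d) (k : ℕ) (t : ℝ) :
    phi d i k t = (-1) ^ k * √(marginalConst d i) * jacobiFun (d - 1 - (i : ℕ)) i k t := by
  have h := congrArg (fun p => Polynomial.eval t p) (jacobi_comp_affine (d - 1 - (i : ℕ)) i k)
  simp only [Polynomial.eval_comp, Polynomial.eval_mul, Polynomial.eval_C, Polynomial.eval_sub,
    Polynomial.eval_X, Polynomial.eval_one, Polynomial.eval_ofNat] at h
  have hN := rodriguesNormSq_pos (d - 1 - (i : ℕ)) i k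
  have hconst : √((2 * k + d : ℝ) * k ! * (k + d - 1)! /
      ((k + (d - 1 - (i : ℕ)))! * (k + (i : ℕ))!)) =
      k ! / √(rodriguesNormSq (d - 1 - (i : ℕ)) i k) := by
    rw [← Real.sqrt_sq (Nat.cast_nonneg (k !)), ← Real.sqrt_div (sq_nonneg _)]
    congr 1
    obtain ⟨n, hn⟩ : ∃ n, d = n + 1 := ⟨d - 1, by have := i.2; omega⟩
    have hi : (i : ℕ) ≤ n := by have := i.2; omega
    obtain ⟨a, ha⟩ : ∃ a, n = a + i := ⟨n - i, by omega⟩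
    have e1 : d - 1 - (i : ℕ) = a := by omega
    have e2 : k + d - 1 = a + i + k := by omega
    have e3 : (d : ℝ) = a + (i : ℕ) + 1 := by
      have : d = a + i + 1 := by omega
      exact_mod_cast this
    rw [e1, e2, e3, rodriguesNormSq, add_comm k a, add_comm k (i : ℕ),
      Real.sqrt_sq (by positivity)]
    have h4 : (a : ℝ) + (i : ℕ) + 2 * k + 1 ≠ 0 := by positivity
    field_simp
    ring
  rw [phi, h, hconst, jacobiFun, marginalConst]
  have hs := (Real.sqrt_pos.2 hN).ne'
  field_simp

lemma continuous_phi {d : ℕ} (i : Fin d) (k : ℕ) : Continuous (phi d i k) := by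
  have : phi d i k = fun t => (-1) ^ k * √(marginalConst d i) *
      jacobiFun (d - 1 - (i : ℕ)) i k t := funext fun t => phi_eq i k t
  rw [this]
  exact (continuous_jacobiFun _ _ _).const_mul _

lemma continuous_phiVec {d : ℕ} (m : Fin d → ℕ) (p : ParamIndex m) :
    Continuous fun x => phiVec m x p :=
  (continuous_phi _ _).comp (continuous_apply _)

lemma integral_phi_sq {d : ℕ} (i : Fin d) (k : ℕ) :
    ∫ t, phi d i k t ^ 2 ∂(weightMeasure (d - 1 - (i : ℕ)) i) = marginalConst d i := by
  have h : ∀ t, phi d i k t ^ 2 = marginalConst d i *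
      (jacobiFun (d - 1 - (i : ℕ)) i k t * jacobiFun (d - 1 - (i : ℕ)) i k t) := by
    intro t
    rw [phi_eq, mul_pow, mul_pow, Real.sq_sqrt (marginalConst_pos d i).le, ← pow_mul, mul_comm k 2,
      pow_mul]
    ring
  simp_rw [h]
  rw [integral_const_mul, integral_jacobiFun_mul, if_pos rfl, mul_one]

/-! ### Coordinates of the exponent in the Jacobi basis. -/

section Components

variable {d : ℕ} (m : Fin d → ℕ)

/-- The coordinates of a component of the exponent in the basis `jacobiFun`. -/
def compCoeff (θ : ParamIndex m → ℝ) (i : Fin d) : ℕ → ℝ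
  -- The model has no constant term, which matches the centring of the true components.
  | 0 => 0
  | k + 1 => if h : k < m i then (-1) ^ (k + 1) * √(marginalConst d i) * θ ⟨i, ⟨k, h⟩⟩ else 0

lemma sum_mul_phi_eq (θ : ParamIndex m → ℝ) (i : Fin d) (t : ℝ) :
    ∑ k : Fin (m i), θ ⟨i, k⟩ * phi d i ((k : ℕ) + 1) t =
      ∑ k ∈ Finset.range (m i + 1), compCoeff m θ i k * jacobiFun (d - 1 - (i : ℕ)) i k t := by
  rw [Finset.sum_range_succ', Finset.sum_range]
  simp only [compCoeff, zero_mul, add_zero, Fin.is_lt, dif_pos, Fin.eta]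
  exact Finset.sum_congr rfl fun k _ => by rw [phi_eq]; ring

lemma sum_compCoeff_sub_sq (θ θ' : ParamIndex m → ℝ) (i : Fin d) :
    ∑ k ∈ Finset.range (m i + 1), (compCoeff m θ i k - compCoeff m θ' i k) ^ 2 =
      marginalConst d i * ∑ k : Fin (m i), (θ ⟨i, k⟩ - θ' ⟨i, k⟩) ^ 2 := by
  rw [Finset.sum_range_succ', Finset.sum_range, Finset.mul_sum]
  simp only [compCoeff, Fin.is_lt, dif_pos, Fin.eta]
  rw [sub_self, zero_pow two_ne_zero, add_zero]
  refine Finset.sum_congr rfl fun k _ => ?_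
  rw [← mul_sub, mul_pow, mul_pow, Real.sq_sqrt (marginalConst_pos d i).le, ← pow_mul,
    mul_comm _ 2, pow_mul]
  simp

/-- The parameter of the orthogonal projection of the components `ℓ`. -/
def projParam (ℓ : Fin d → ℝ → ℝ) (p : ParamIndex m) : ℝ :=
  (-1) ^ ((p.2 : ℕ) + 1) * jacobiCoeff (d - 1 - (p.1 : ℕ)) p.1 ((p.2 : ℕ) + 1) (ℓ p.1) /
    √(marginalConst d p.1)

lemma compCoeff_projParam {ℓ : Fin d → ℝ → ℝ} {i : Fin d}
    (h0 : jacobiCoeff (d - 1 - (i : ℕ)) i 0 (ℓ i) = 0) {k : ℕ} (hk : k ∈ Finset.range (m i + 1)) :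
    compCoeff m (projParam m ℓ) i k = jacobiCoeff (d - 1 - (i : ℕ)) i k (ℓ i) := by
  cases k with
  | zero => rw [h0]; rfl
  | succ k =>
    have hk' : k < m i := by simpa using hk
    have hs := (Real.sqrt_pos.2 (marginalConst_pos d i)).ne'
    have h1 : ((-1 : ℝ) ^ (k + 1)) * (-1) ^ (k + 1) = 1 := by rw [← mul_pow]; simp
    simp only [compCoeff, dif_pos hk', projParam]
    field_simp
    linear_combination jacobiCoeff (d - 1 - (i : ℕ)) i (k + 1) (ℓ i) * h1

/-- Difference between a component of the exponent of the model and a function on the line. -/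
def compDiff (ℓ : Fin d → ℝ → ℝ) (θ : ParamIndex m → ℝ) (i : Fin d) (t : ℝ) : ℝ :=
  ∑ k : Fin (m i), θ ⟨i, k⟩ * phi d i ((k : ℕ) + 1) t - ℓ i t

variable {m} {ℓ : Fin d → ℝ → ℝ} {i : Fin d}

lemma continuous_compDiff (hℓ : Continuous (ℓ i)) (θ : ParamIndex m → ℝ) :
    Continuous (compDiff m ℓ θ i) :=
  (continuous_finsetSum _ fun _ _ => (continuous_phi _ _).const_mul _).sub hℓ

lemma integral_jacobiFun_eq_zero (a b k : ℕ) :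
    ∫ t, jacobiFun a b (k + 1) t ∂(weightMeasure a b) = 0 := by
  have h := integral_jacobiFun_mul a b (k + 1) 0
  rw [if_neg (by omega)] at h
  have h0 : ∀ t, jacobiFun a b 0 t = (√(rodriguesNormSq a b 0))⁻¹ := by
    intro t; simp [jacobiFun, rodrigues]
  simp_rw [h0] at h
  rw [integral_mul_const] at h
  have hs := Real.sqrt_pos.2 (rodriguesNormSq_pos a b 0)
  exact (mul_eq_zero.1 h).resolve_right (inv_ne_zero hs.ne')

lemma integral_compDiff (hℓ : Continuous (ℓ i))
    (h0 : ∫ t, ℓ i t ∂(weightMeasure (d - 1 - (i : ℕ)) i) = 0) (θ : ParamIndex m → ℝ) :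
    ∫ t, compDiff m ℓ θ i t ∂(weightMeasure (d - 1 - (i : ℕ)) i) = 0 := by
  have hint : ∀ g : ℝ → ℝ, Continuous g →
      Integrable g (weightMeasure (d - 1 - (i : ℕ)) i) := fun g hg =>
    (memLp_of_continuousOn_Icc hg.continuousOn 1).integrable le_rfl
  have hphi : ∀ k, ∫ t, phi d i (k + 1) t ∂(weightMeasure (d - 1 - (i : ℕ)) i) = 0 := by
    intro k
    simp_rw [phi_eq]
    rw [integral_const_mul, integral_jacobiFun_eq_zero, mul_zero]
  simp only [compDiff]
  rw [integral_sub (integrable_finsetSum _ fun _ _ => (hint _ (continuous_phi _ _)).const_mul _)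
    (hint _ hℓ), h0, integral_finsetSum _ fun _ _ => (hint _ (continuous_phi _ _)).const_mul _]
  simp [integral_const_mul, hphi]

/-- Pythagoras: the component error splits into the coefficient error and a nonnegative projection
error. The factor `marginalConst` is at least one and can be dropped. -/
lemma sum_sub_projParam_sq_le (hℓ : Continuous (ℓ i))
    (h0 : jacobiCoeff (d - 1 - (i : ℕ)) i 0 (ℓ i) = 0) (θ : ParamIndex m → ℝ) :
    ∑ k : Fin (m i), (θ ⟨i, k⟩ - projParam m ℓ ⟨i, k⟩) ^ 2 ≤
      ∫ t, compDiff m ℓ θ i t ^ 2 ∂(weightMeasure (d - 1 - (i : ℕ)) i) := by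
  set a := d - 1 - (i : ℕ) with ha
  have hL2 : MemLp (ℓ i) 2 (weightMeasure a i) := memLp_of_continuousOn_Icc hℓ.continuousOn 2
  have h1 : ∀ t, compDiff m ℓ θ i t ^ 2 = (ℓ i t -
      ∑ k ∈ Finset.range (m i + 1), compCoeff m θ i k * jacobiFun a i k t) ^ 2 := by
    intro t
    rw [compDiff, sum_mul_phi_eq, ← neg_sq, neg_sub]
  have h2 := integral_sub_sum_sq (fun k => memLp_jacobiFun a i k 2) (integral_jacobiFun_mul a i)
    hL2 (Finset.range (m i + 1)) (compCoeff m θ i)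
  have h3 := sum_sq_coeff_le (fun k => memLp_jacobiFun a i k 2) (integral_jacobiFun_mul a i)
    hL2 (Finset.range (m i + 1))
  have h4 := sum_compCoeff_sub_sq m θ (projParam m ℓ) i
  have h5 : ∑ k ∈ Finset.range (m i + 1),
      (compCoeff m θ i k - compCoeff m (projParam m ℓ) i k) ^ 2 =
      ∑ k ∈ Finset.range (m i + 1), (jacobiCoeff a i k (ℓ i)) ^ 2 -
        2 * ∑ k ∈ Finset.range (m i + 1), compCoeff m θ i k * jacobiCoeff a i k (ℓ i) +
        ∑ k ∈ Finset.range (m i + 1), compCoeff m θ i k ^ 2 := by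
    rw [Finset.mul_sum, ← Finset.sum_sub_distrib, ← Finset.sum_add_distrib]
    refine Finset.sum_congr rfl fun k hk => ?_
    rw [compCoeff_projParam m h0 hk]
    ring
  have h6 : ∑ k : Fin (m i), (θ ⟨i, k⟩ - projParam m ℓ ⟨i, k⟩) ^ 2 ≤
      marginalConst d i * ∑ k : Fin (m i), (θ ⟨i, k⟩ - projParam m ℓ ⟨i, k⟩) ^ 2 :=
    le_mul_of_one_le_left (Finset.sum_nonneg fun _ _ => sq_nonneg _) (one_le_marginalConst d i)
  simp_rw [h1]
  rw [h2]
  simp only [jacobiCoeff] at h5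
  linarith

lemma compDiff_projParam (h0 : jacobiCoeff (d - 1 - (i : ℕ)) i 0 (ℓ i) = 0) (t : ℝ) :
    compDiff m ℓ (projParam m ℓ) i t = jacobiProj (d - 1 - (i : ℕ)) i (m i) (ℓ i) t - ℓ i t := by
  rw [compDiff, sum_mul_phi_eq, jacobiProj]
  congr 1
  exact Finset.sum_congr rfl fun k hk => by rw [compCoeff_projParam m h0 hk]

/-- Constant in the sup norm bound for the components of the model. -/
def nikolskiiConst (d : ℕ) : ℝ := 2 ^ (d + 1) * (d + 1 : ℝ) ^ (2 * d) * d !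

lemma compDiff_sub_sq_le (hm : 1 ≤ m i) (θ θ' : ParamIndex m → ℝ) {t : ℝ}
    (ht : t ∈ Set.Icc (0 : ℝ) 1) :
    (compDiff m ℓ θ i t - compDiff m ℓ θ' i t) ^ 2 ≤
      nikolskiiConst d * (m i : ℝ) ^ (2 * d) * ∑ k : Fin (m i), (θ ⟨i, k⟩ - θ' ⟨i, k⟩) ^ 2 := by
  have h1 : compDiff m ℓ θ i t - compDiff m ℓ θ' i t = ∑ k ∈ Finset.range (m i + 1),
      (compCoeff m θ i k - compCoeff m θ' i k) * jacobiFun (d - 1 - (i : ℕ)) i k t := by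
    simp only [compDiff, sum_mul_phi_eq, sub_mul, Finset.sum_sub_distrib]
    ring
  have hi : d - 1 - (i : ℕ) + i = d - 1 := by have := i.2; omega
  have hd : 1 ≤ d := by have := i.2; omega
  have hd1 : ((d - 1 - (i : ℕ) : ℕ) : ℝ) + (i : ℕ) + 1 = d := by
    rw [← Nat.cast_add, hi]
    exact_mod_cast Nat.sub_add_cancel hd
  have hm1 : (1 : ℝ) ≤ m i := by exact_mod_cast hm
  have h2 := sq_sum_jacobiFun_le (d - 1 - (i : ℕ)) i (m i)
    (fun k => compCoeff m θ i k - compCoeff m θ' i k) ht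
  rw [← h1, sum_compCoeff_sub_sq, hi, hd1, show d - 1 + 2 = d + 1 by omega,
    Nat.sub_add_cancel hd] at h2
  refine h2.trans ?_
  have hsum : 0 ≤ ∑ k : Fin (m i), (θ ⟨i, k⟩ - θ' ⟨i, k⟩) ^ 2 :=
    Finset.sum_nonneg fun _ _ => sq_nonneg _
  have h3 : (d : ℝ) + m i ≤ (d + 1) * m i := by
    have : (0 : ℝ) ≤ d := by positivity
    nlinarith
  have h4 := marginalConst_le d i
  have h5 := marginalConst_pos d i
  calc 2 ^ (d + 1) * ((d : ℝ) + m i) ^ (2 * d) *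
        (marginalConst d i * ∑ k : Fin (m i), (θ ⟨i, k⟩ - θ' ⟨i, k⟩) ^ 2)
      ≤ 2 ^ (d + 1) * ((d + 1) * m i : ℝ) ^ (2 * d) *
        (d ! * ∑ k : Fin (m i), (θ ⟨i, k⟩ - θ' ⟨i, k⟩) ^ 2) := by gcongr
    _ = _ := by rw [mul_pow, nikolskiiConst]; ring

end Components

/-! ### Components in the Sobolev class -/

lemma integral_weightMeasure_eq_marginal {d : ℕ} (i : Fin d) (g : ℝ → ℝ) :
    ∫ t, g t ∂(weightMeasure (d - 1 - (i : ℕ)) i) =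
      marginalConst d i * ∫ t, g t ∂(marginal d i) := by
  have := marginalConst_pos d i
  rw [integral_marginal, ← marginalConst, ← mul_assoc, mul_inv_cancel₀ this.ne', one_mul]

lemma memLp_weightMeasure_of_marginal {d : ℕ} {i : Fin d} {g : ℝ → ℝ}
    (hg : MemLp g 2 (marginal d i)) : MemLp g 2 (weightMeasure (d - 1 - (i : ℕ)) i) := by
  have hpos := marginalConst_pos d i
  have h : weightMeasure (d - 1 - (i : ℕ)) i =
      ENNReal.ofReal (marginalConst d i) • marginal d i := by
    rw [marginal_eq, smul_smul, ← marginalConst, ← ENNReal.ofReal_mul hpos.le,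
      mul_inv_cancel₀ hpos.ne', ENNReal.ofReal_one, one_smul]
  rw [h]
  exact hg.smul_measure ENNReal.ofReal_ne_top

lemma integral_sq_le_of_eLpNorm_le {α : Type*} [MeasurableSpace α] {μ : Measure α} {g : α → ℝ}
    (hg : MemLp g 2 μ) {κ : ℝ} (hκ : 0 ≤ κ) (h : eLpNorm g 2 μ ≤ ENNReal.ofReal κ) :
    ∫ x, g x ^ 2 ∂μ ≤ κ ^ 2 := by
  have h1 := hg.eLpNorm_eq_integral_rpow_norm (by norm_num) (by norm_num)
  rw [h1, ENNReal.ofReal_le_ofReal_iff hκ] at h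
  simp only [ENNReal.toReal_ofNat, Real.rpow_ofNat, Real.norm_eq_abs, sq_abs] at h
  have h0 : 0 ≤ ∫ x, g x ^ 2 ∂μ := integral_nonneg fun x => sq_nonneg _
  have h2 := pow_le_pow_left₀ (Real.rpow_nonneg h0 _) h 2
  rwa [← Real.rpow_natCast, ← Real.rpow_mul h0, show ((2 : ℝ)⁻¹ * ((2 : ℕ) : ℝ)) = 1 by norm_num,
    Real.rpow_one] at h2

section Sobolev

variable {d : ℕ} {i : Fin d} {r : ℕ} {h : ℝ → ℝ} {κ : ℝ}

lemma integral_iteratedDerivWithin_sq_le (hs : IsSobolev r (marginal d i) h) (hκ : 0 ≤ κ)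
    (hnorm : eLpNorm (iteratedDerivWithin r h (Set.Icc 0 1)) 2 (marginal d i) ≤
      ENNReal.ofReal κ) :
    ∫ t, iteratedDerivWithin r h (Set.Icc 0 1) t ^ 2 ∂(weightMeasure (d - 1 - (i : ℕ)) i) ≤
      d ! * κ ^ 2 := by
  rw [integral_weightMeasure_eq_marginal]
  have h1 := integral_sq_le_of_eLpNorm_le hs.memLp_deriv hκ hnorm
  have h2 := marginalConst_le d i
  have h3 := marginalConst_pos d i
  gcongr

/-- `L²` bound for the bias in the Sobolev class. -/
lemma IsSobolev.integral_sub_jacobiProj_sq_le (hr : d < r) (hs : IsSobolev r (marginal d i) h)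
    (hκ : 0 ≤ κ)
    (hnorm : eLpNorm (iteratedDerivWithin r h (Set.Icc 0 1)) 2 (marginal d i) ≤
      ENNReal.ofReal κ) {m : ℕ} (hm : r ≤ m) :
    ∫ t, (h t - jacobiProj (d - 1 - (i : ℕ)) i m h t) ^ 2
      ∂(weightMeasure (d - 1 - (i : ℕ)) i) ≤ ((r : ℝ) / m) ^ (2 * r) * (d ! * κ ^ 2) := by
  have := integral_sub_jacobiProj_sq_le_of_sobolev
    (h := fun j => iteratedDerivWithin j h (Set.Icc 0 1)) (by omega)
    (fun j hj => hs.absolutelyContinuousOnInterval hj)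
    (fun j _ => eqOn_deriv_iteratedDerivWithin h j)
    (memLp_weightMeasure_of_marginal hs.memLp_deriv)
    (integral_iteratedDerivWithin_sq_le hs hκ hnorm) hm
  simpa only [iteratedDerivWithin_zero] using this

/-- Sup norm bound for the bias in the Sobolev class. -/
lemma IsSobolev.abs_sub_jacobiProj_le (hr : d < r) (hs : IsSobolev r (marginal d i) h)
    (hκ : 0 ≤ κ)
    (hnorm : eLpNorm (iteratedDerivWithin r h (Set.Icc 0 1)) 2 (marginal d i) ≤
      ENNReal.ofReal κ) {m : ℕ} (hm : r ≤ m) {t : ℝ} (ht : t ∈ Set.Icc (0 : ℝ) 1) :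
    |h t - jacobiProj (d - 1 - (i : ℕ)) i m h t| ≤
      approxConst (d - 1 - (i : ℕ)) i r (d ! * κ ^ 2) := by
  have hi := i.2
  have := abs_sub_jacobiProj_le_of_sobolev
    (h := fun j => iteratedDerivWithin j h (Set.Icc 0 1)) (by omega)
    (fun j hj => hs.absolutelyContinuousOnInterval hj)
    (fun j _ => eqOn_deriv_iteratedDerivWithin h j)
    (memLp_weightMeasure_of_marginal hs.memLp_deriv)
    (integral_iteratedDerivWithin_sq_le hs hκ hnorm) hm ht
  simpa only [iteratedDerivWithin_zero] using this

lemma IsSobolev.continuousOn {q : Measure ℝ} (hs : IsSobolev r q h) :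
    ContinuousOn h (Set.Icc 0 1) := hs.contDiffOn.continuousOn

end Sobolev

/-! ### The model as a family of tilted measures -/

section Model

variable {d : ℕ}

lemma exp_sub_log_integral {α : Type*} [MeasurableSpace α] {μ : Measure α} [NeZero μ] {g : α → ℝ}
    (hg : Integrable (fun x => Real.exp (g x)) μ) (y : ℝ) :
    Real.exp (y - Real.log (∫ x, Real.exp (g x) ∂μ)) = Real.exp y / ∫ x, Real.exp (g x) ∂μ := by
  rw [Real.exp_sub, Real.exp_log (integral_exp_pos hg)]

lemma integrable_of_continuous_simplex {g : (Fin d → ℝ) → ℝ} (hg : Continuous g) :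
    Integrable g (volume.restrict (simplex d)) :=
  hg.continuousOn.integrableOn_compact (isCompact_simplex d)

lemma integrable_exp_of_continuous_simplex {g : (Fin d → ℝ) → ℝ} (hg : Continuous g) :
    Integrable (fun x => Real.exp (g x)) (volume.restrict (simplex d)) :=
  integrable_of_continuous_simplex (Real.continuous_exp.comp hg)

lemma essBounded_of_continuous {P : Measure (Fin d → ℝ)} (hP : P ≪ volume.restrict (simplex d))
    {g : (Fin d → ℝ) → ℝ} (hg : Continuous g) : EssBounded P g := by
  obtain ⟨M, hM⟩ := (isCompact_simplex d).exists_bound_of_continuousOn hg.continuousOn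
  exact ⟨hg.aemeasurable, M, hP.ae_le
    ((ae_restrict_mem (measurableSet_simplex d)).mono fun x hx => hM x hx)⟩

instance : IsFiniteMeasure (volume.restrict (simplex d)) :=
  ⟨by simpa using (isCompact_simplex d).measure_lt_top⟩

lemma IsDensity.densityMeasure_eq {f : (Fin d → ℝ) → ℝ} (hf : IsDensity f) :
    densityMeasure f =
      (volume.restrict (simplex d)).withDensity fun x => ENNReal.ofReal (f x) := by
  rw [densityMeasure, ← withDensity_indicator (measurableSet_simplex d)]
  congr 1
  ext x
  by_cases hx : x ∈ simplex d
  · rw [Set.indicator_of_mem hx]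
  · rw [Set.indicator_of_notMem hx, hf.eq_zero x hx, ENNReal.ofReal_zero]

lemma IsDensity.neZero {f : (Fin d → ℝ) → ℝ} (hf : IsDensity f) :
    NeZero (volume.restrict (simplex d)) := by
  refine ⟨fun h => ?_⟩
  have h1 : densityMeasure f Set.univ = 1 := by
    rw [densityMeasure, withDensity_apply _ MeasurableSet.univ, setLIntegral_univ,
      hf.lintegral_eq_one]
  rw [hf.densityMeasure_eq, h] at h1
  simp at h1

lemma densityMeasure_eq_tilted [NeZero (volume.restrict (simplex d))] {f : (Fin d → ℝ) → ℝ}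
    (hf : IsDensity f) {g : (Fin d → ℝ) → ℝ} (hg : Continuous g)
    (hfg : ∀ᵐ x ∂(volume.restrict (simplex d)),
      f x = Real.exp (g x - Real.log (∫ y in simplex d, Real.exp (g y)))) :
    densityMeasure f = (volume.restrict (simplex d)).tilted g := by
  rw [hf.densityMeasure_eq, Measure.tilted]
  refine withDensity_congr_ae ?_
  filter_upwards [hfg] with x hx
  rw [hx, exp_sub_log_integral (integrable_exp_of_continuous_simplex hg)]

variable (m : Fin d → ℕ)

lemma continuous_sum_mul_phiVec (θ : ParamIndex m → ℝ) :
    Continuous fun x => ∑ p, θ p * phiVec m x p :=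
  continuous_finsetSum _ fun p _ => (continuous_phiVec m p).const_mul _

lemma densityMeasure_modelDensity [NeZero (volume.restrict (simplex d))]
    (θ : ParamIndex m → ℝ) :
    densityMeasure (modelDensity m θ) =
      (volume.restrict (simplex d)).tilted fun x => ∑ p, θ p * phiVec m x p := by
  have h : (fun x => ENNReal.ofReal (modelDensity m θ x)) = (simplex d).indicator fun x =>
      ENNReal.ofReal (Real.exp (∑ p, θ p * phiVec m x p) /
        ∫ x in simplex d, Real.exp (∑ p, θ p * phiVec m x p)) := by
    ext x
    by_cases hx : x ∈ simplex d
    · rw [modelDensity, Set.indicator_of_mem hx, Set.indicator_of_mem hx, logPartition,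
        exp_sub_log_integral
          (integrable_exp_of_continuous_simplex (continuous_sum_mul_phiVec m θ))]
    · rw [modelDensity, Set.indicator_of_notMem hx, Set.indicator_of_notMem hx,
        ENNReal.ofReal_zero]
  rw [densityMeasure, h, withDensity_indicator (measurableSet_simplex d)]
  rfl

lemma meanMap_eq [NeZero (volume.restrict (simplex d))] (θ : ParamIndex m → ℝ)
    (p : ParamIndex m) :
    meanMap m θ p = ∫ x, phiVec m x p ∂((volume.restrict (simplex d)).tilted
      fun x => ∑ p, θ p * phiVec m x p) := by
  rw [integral_tilted, meanMap]
  refine setIntegral_congr_fun (measurableSet_simplex d) fun x hx => ?_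
  simp only [modelDensity, Set.indicator_of_mem hx, logPartition, smul_eq_mul]
  rw [exp_sub_log_integral (integrable_exp_of_continuous_simplex (continuous_sum_mul_phiVec m θ)),
    mul_comm]

end Model

/-! ### Densities with regular components -/

/-- `ℓ` are continuous components on the line of the density `f`, together with the approximation
properties given by the Sobolev regularity. -/
structure RegularComponents {d : ℕ} (r : Fin d → ℕ) (κ : ℝ) (f : (Fin d → ℝ) → ℝ)
    (ℓ : Fin d → ℝ → ℝ) : Prop where
  isDensity : IsDensity f
  continuous : ∀ i, Continuous (ℓ i)
  abs_le : ∀ i, ∀ t ∈ Set.Icc (0 : ℝ) 1, |ℓ i t| ≤ κ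
  centered : ∀ i : Fin d, ∫ t, ℓ i t ∂(weightMeasure (d - 1 - (i : ℕ)) i) = 0
  ae_eq : ∀ᵐ x ∂(volume.restrict (simplex d)),
    f x = Real.exp (∑ i, ℓ i (x i) - Real.log (∫ y in simplex d, Real.exp (∑ i, ℓ i (y i))))
  integral_sq_le : ∀ (i : Fin d) (m : ℕ), r i ≤ m →
    ∫ t, (ℓ i t - jacobiProj (d - 1 - (i : ℕ)) i m (ℓ i) t) ^ 2
      ∂(weightMeasure (d - 1 - (i : ℕ)) i) ≤ ((r i : ℝ) / m) ^ (2 * r i) * (d ! * κ ^ 2)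
  abs_sub_le : ∀ (i : Fin d) (m : ℕ), r i ≤ m → ∀ t ∈ Set.Icc (0 : ℝ) 1,
    |ℓ i t - jacobiProj (d - 1 - (i : ℕ)) i m (ℓ i) t| ≤
      approxConst (d - 1 - (i : ℕ)) i (r i) (d ! * κ ^ 2)

/-- The components are prescribed on [0, 1] only. Extending them by their endpoint values makes them
continuous on the line and changes no integral over [0, 1] or the simplex. -/
lemma exists_regularComponents {d : ℕ} {r : Fin d → ℕ} (hr : ∀ i, d < r i) {κ : ℝ} (hκ : 0 ≤ κ)
    {f : (Fin d → ℝ) → ℝ} (hf : f ∈ productClass r κ) :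
    ∃ ℓ, RegularComponents r κ f ℓ := by
  obtain ⟨ℓ, hprod, hℓ⟩ := hf
  have heq : ∀ i, Set.EqOn (Set.IccExtend (zero_le_one' ℝ) fun t : Set.Icc (0 : ℝ) 1 => ℓ i t)
      (ℓ i) (Set.Icc 0 1) := fun i t ht => Set.IccExtend_of_mem _ _ ht
  have hproj : ∀ (i : Fin d) (m : ℕ), jacobiProj (d - 1 - (i : ℕ)) i m
      (Set.IccExtend (zero_le_one' ℝ) fun t : Set.Icc (0 : ℝ) 1 => ℓ i t) =
      jacobiProj (d - 1 - (i : ℕ)) i m (ℓ i) := by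
    intro i m
    ext t
    exact Finset.sum_congr rfl fun k _ => by
      rw [jacobiCoeff_congr ((heq i).mono Set.Ioo_subset_Icc_self)]
  have hsum : ∀ x ∈ simplex d, ∑ i, Set.IccExtend (zero_le_one' ℝ)
      (fun t : Set.Icc (0 : ℝ) 1 => ℓ i t) (x i) = ∑ i, ℓ i (x i) := fun x hx =>
    Finset.sum_congr rfl fun i _ => heq i (hx.1 i)
  refine ⟨fun i => Set.IccExtend (zero_le_one' ℝ) fun t : Set.Icc (0 : ℝ) 1 => ℓ i t,
    hprod.isDensity, fun i => ?_, fun i t ht => ?_, fun i => ?_, ?_, fun i m hm => ?_,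
    fun i m hm t ht => ?_⟩
  · exact (continuousOn_iff_continuous_domRestrict.1 (hℓ i).1.continuousOn).Icc_extend'
  · rw [heq i ht]
    exact (hℓ i).2.1 t ht
  · have h0 := integral_weightMeasure_eq_marginal i (ℓ i)
    rw [hprod.centered i, mul_zero] at h0
    refine Eq.trans ?_ h0
    refine integral_congr_ae ?_
    filter_upwards [ae_mem_Icc_weightMeasure _ _] with t ht
    exact heq i ht
  · have hint : ∫ y in simplex d, Real.exp (∑ i, Set.IccExtend (zero_le_one' ℝ)
        (fun t : Set.Icc (0 : ℝ) 1 => ℓ i t) (y i)) =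
        ∫ y in simplex d, Real.exp (∑ i, ℓ i (y i)) :=
      setIntegral_congr_fun (measurableSet_simplex d) fun y hy => by simp only [hsum y hy]
    filter_upwards [hprod.ae_eq, ae_restrict_mem (measurableSet_simplex d)] with x hx hxs
    rw [hx, hint, hsum x hxs]
  · rw [hproj]
    refine le_trans (le_of_eq ?_)
      ((hℓ i).1.integral_sub_jacobiProj_sq_le (hr i) hκ (hℓ i).2.2 hm)
    refine integral_congr_ae ?_
    filter_upwards [ae_mem_Icc_weightMeasure _ _] with t ht
    rw [heq i ht]
  · rw [hproj, heq i ht]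
    exact (hℓ i).1.abs_sub_jacobiProj_le (hr i) hκ (hℓ i).2.2 hm ht

namespace RegularComponents

variable {d : ℕ} {r : Fin d → ℕ} {κ : ℝ} {f : (Fin d → ℝ) → ℝ} {ℓ : Fin d → ℝ → ℝ}

lemma continuous_sum (h : RegularComponents r κ f ℓ) :
    Continuous fun x : Fin d → ℝ => ∑ i, ℓ i (x i) :=
  continuous_finsetSum _ fun i _ => (h.continuous i).comp (continuous_apply i)

lemma densityMeasure_eq (h : RegularComponents r κ f ℓ) :
    densityMeasure f = (volume.restrict (simplex d)).tilted fun x => ∑ i, ℓ i (x i) := by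
  have := h.isDensity.neZero
  exact densityMeasure_eq_tilted h.isDensity h.continuous_sum h.ae_eq

lemma isProbabilityMeasure (h : RegularComponents r κ f ℓ) :
    IsProbabilityMeasure (densityMeasure f) := by
  have := h.isDensity.neZero
  rw [h.densityMeasure_eq]
  exact isProbabilityMeasure_tilted (integrable_exp_of_continuous_simplex h.continuous_sum)

lemma absolutelyContinuous (h : RegularComponents r κ f ℓ) :
    densityMeasure f ≪ volume.restrict (simplex d) := by
  rw [h.densityMeasure_eq]
  exact tilted_absolutelyContinuous _ _

lemma jacobiCoeff_zero (h : RegularComponents r κ f ℓ) (i : Fin d) :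
    jacobiCoeff (d - 1 - (i : ℕ)) i 0 (ℓ i) = 0 := by
  have h0 : ∀ t, ℓ i t * jacobiFun (d - 1 - (i : ℕ)) i 0 t =
      ℓ i t * (√(rodriguesNormSq (d - 1 - (i : ℕ)) i 0))⁻¹ := by
    intro t; simp [jacobiFun, rodrigues]
  rw [jacobiCoeff]
  simp_rw [h0]
  rw [integral_mul_const, h.centered, zero_mul]

lemma abs_sum_le (h : RegularComponents r κ f ℓ) {x : Fin d → ℝ} (hx : x ∈ simplex d) :
    |∑ i, ℓ i (x i)| ≤ d * κ := by
  calc |∑ i, ℓ i (x i)| ≤ ∑ i, |ℓ i (x i)| := Finset.abs_sum_le_sum_abs _ _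
    _ ≤ ∑ _i : Fin d, κ := Finset.sum_le_sum fun i _ => h.abs_le i _ (hx.1 i)
    _ = d * κ := by simp

end RegularComponents

/-! ### Comparison of the true law with Lebesgue measure on the simplex. -/

/-- Lower bound for the densities of the class. -/
def densityLower (d : ℕ) (κ : ℝ) : ℝ := Real.exp (-(2 * (d * κ))) / volume.real (simplex d)

/-- Upper bound for the densities of the class. -/
def densityUpper (d : ℕ) (κ : ℝ) : ℝ := Real.exp (2 * (d * κ)) / volume.real (simplex d)

lemma IsDensity.measureReal_simplex_pos {d : ℕ} {f : (Fin d → ℝ) → ℝ} (hf : IsDensity f) :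
    0 < volume.real (simplex d) := by
  have h := hf.neZero
  refine ENNReal.toReal_pos (fun h0 => h.out ?_) (isCompact_simplex d).measure_lt_top.ne
  rwa [Measure.restrict_eq_zero]

namespace RegularComponents

variable {d : ℕ} {r : Fin d → ℕ} {κ : ℝ} {f : (Fin d → ℝ) → ℝ} {ℓ : Fin d → ℝ → ℝ}

lemma integral_exp_mem (h : RegularComponents r κ f ℓ) :
    ∫ x in simplex d, Real.exp (∑ i, ℓ i (x i)) ∈
      Set.Icc (Real.exp (-(d * κ)) * volume.real (simplex d))
        (Real.exp (d * κ) * volume.real (simplex d)) := by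
  have hint := integrable_exp_of_continuous_simplex h.continuous_sum
  have hc : ∀ c : ℝ, ∫ _ in simplex d, c = c * volume.real (simplex d) := by
    intro c; simp [mul_comm]
  rw [← hc, ← hc]
  constructor
  · exact setIntegral_mono_on (integrable_const _) hint (measurableSet_simplex d) fun x hx =>
      Real.exp_le_exp.2 (_root_.abs_le.1 (h.abs_sum_le hx)).1
  · exact setIntegral_mono_on hint (integrable_const _) (measurableSet_simplex d) fun x hx =>
      Real.exp_le_exp.2 (_root_.abs_le.1 (h.abs_sum_le hx)).2

lemma integral_densityMeasure (h : RegularComponents r κ f ℓ) (g : (Fin d → ℝ) → ℝ) :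
    ∫ x, g x ∂(densityMeasure f) = ∫ x in simplex d, Real.exp (∑ i, ℓ i (x i)) /
      (∫ x in simplex d, Real.exp (∑ i, ℓ i (x i))) * g x := by
  rw [h.densityMeasure_eq, integral_tilted]
  rfl

/-- The exponent and the logarithm of the normaliser divided by the volume both lie within dκ of 0,
hence the exponent 2dκ in the constants. -/
lemma le_integral_densityMeasure (h : RegularComponents r κ f ℓ) {g : (Fin d → ℝ) → ℝ}
    (hg : Continuous g) (hg0 : ∀ x, 0 ≤ g x) :
    densityLower d κ * ∫ x in simplex d, g x ≤ ∫ x, g x ∂(densityMeasure f) := by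
  have hV := h.isDensity.measureReal_simplex_pos
  obtain ⟨h1, h2⟩ := h.integral_exp_mem
  set Z := ∫ x in simplex d, Real.exp (∑ i, ℓ i (x i))
  have hZ : 0 < Z := lt_of_lt_of_le (by positivity) h1
  have hcont := h.continuous_sum
  rw [h.integral_densityMeasure, ← integral_const_mul]
  refine setIntegral_mono_on ((integrable_of_continuous_simplex hg).const_mul _)
    (integrable_of_continuous_simplex
      (((Real.continuous_exp.comp hcont).div_const Z).mul hg)) (measurableSet_simplex d)
    fun x hx => mul_le_mul_of_nonneg_right ?_ (hg0 x)
  rw [densityLower, div_le_div_iff₀ hV hZ]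
  have h3 : Real.exp (-(2 * (d * κ))) * Real.exp (d * κ) = Real.exp (-(d * κ)) := by
    rw [← Real.exp_add]; congr 1; ring
  calc Real.exp (-(2 * (d * κ))) * Z
      ≤ Real.exp (-(2 * (d * κ))) * (Real.exp (d * κ) * volume.real (simplex d)) := by gcongr
    _ = Real.exp (-(d * κ)) * volume.real (simplex d) := by rw [← mul_assoc, h3]
    _ ≤ Real.exp (∑ i, ℓ i (x i)) * volume.real (simplex d) := by
        have := (_root_.abs_le.1 (h.abs_sum_le hx)).1
        gcongr

lemma integral_densityMeasure_le (h : RegularComponents r κ f ℓ) {g : (Fin d → ℝ) → ℝ}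
    (hg : Continuous g) (hg0 : ∀ x, 0 ≤ g x) :
    ∫ x, g x ∂(densityMeasure f) ≤ densityUpper d κ * ∫ x in simplex d, g x := by
  have hV := h.isDensity.measureReal_simplex_pos
  obtain ⟨h1, h2⟩ := h.integral_exp_mem
  set Z := ∫ x in simplex d, Real.exp (∑ i, ℓ i (x i))
  have hZ : 0 < Z := lt_of_lt_of_le (by positivity) h1
  have hcont := h.continuous_sum
  rw [h.integral_densityMeasure, ← integral_const_mul]
  refine setIntegral_mono_on (integrable_of_continuous_simplex
      (((Real.continuous_exp.comp hcont).div_const Z).mul hg))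
    ((integrable_of_continuous_simplex hg).const_mul _) (measurableSet_simplex d)
    fun x hx => mul_le_mul_of_nonneg_right ?_ (hg0 x)
  rw [densityUpper, div_le_div_iff₀ hZ hV]
  have h3 : Real.exp (2 * (d * κ)) * Real.exp (-(d * κ)) = Real.exp (d * κ) := by
    rw [← Real.exp_add]; congr 1; ring
  calc Real.exp (∑ i, ℓ i (x i)) * volume.real (simplex d)
      ≤ Real.exp (d * κ) * volume.real (simplex d) := by
        have := (_root_.abs_le.1 (h.abs_sum_le hx)).2
        gcongr
    _ = Real.exp (2 * (d * κ)) * (Real.exp (-(d * κ)) * volume.real (simplex d)) := by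
        rw [← mul_assoc, h3]
    _ ≤ Real.exp (2 * (d * κ)) * Z := by gcongr

end RegularComponents

lemma setIntegral_simplex_apply_le {d : ℕ} (i : Fin d) {g : ℝ → ℝ} (hg : Continuous g)
    (hg0 : ∀ t, 0 ≤ g t) :
    ∫ x in simplex d, g (x i) ≤ ∫ t, g t ∂(weightMeasure (d - 1 - (i : ℕ)) i) := by
  refine (integral_map (measurable_pi_apply i).aemeasurable
    hg.aestronglyMeasurable).symm.le.trans ?_
  exact integral_mono_measure (map_eval_restrict_simplex_le i) (ae_of_all _ hg0)
    ((memLp_of_continuousOn_Icc hg.continuousOn 1).integrable le_rfl)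

/-! ### Maximum likelihood near a good parameter of an exponential family -/

section Likelihood

variable {E : Type*} [MeasurableSpace E] {P : Measure E} [IsProbabilityMeasure P]
  {ι : Type*} [Fintype ι] {T : ι → E → ℝ} {w : E → ℝ} {μ θ₀ : ι → ℝ}

/-- Separates the deterministic divergence from the deviation of the moments, which enters linearly
in θ. -/
lemma negLogLikelihood_eq (hT : ∀ p, EssBounded P (T p)) (hw : EssBounded P w) (θ : ι → ℝ) :
    negLogLikelihood P T w μ θ = klTilted P (familyExponent T w θ) + ∫ x, w x ∂P -
      ∑ p, θ p * (μ p - ∫ x, T p x ∂P) := by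
  have h1 : ∫ x, familyExponent T w θ x ∂P = ∑ p, θ p * ∫ x, T p x ∂P + ∫ x, w x ∂P := by
    simp only [familyExponent, Pi.add_apply, Finset.sum_apply, Pi.smul_apply, smul_eq_mul]
    rw [integral_add (integrable_finsetSum _ fun p _ => (hT p).integrable.const_mul _)
      hw.integrable, integral_finsetSum _ fun p _ => (hT p).integrable.const_mul _]
    simp_rw [integral_const_mul]
  simp only [negLogLikelihood, klTilted, h1, mul_sub, Finset.sum_sub_distrib]
  ring

lemma sum_mul_le_add (u v : ι → ℝ) {a : ℝ} (ha : 0 < a) :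
    ∑ p, u p * v p ≤ a / 2 * ∑ p, u p ^ 2 + 1 / (2 * a) * ∑ p, v p ^ 2 := by
  rw [Finset.mul_sum, Finset.mul_sum, ← Finset.sum_add_distrib]
  refine Finset.sum_le_sum fun p _ => ?_
  have h : 0 ≤ (a * u p - v p) ^ 2 / (2 * a) := by positivity
  have h2 : (a * u p - v p) ^ 2 / (2 * a) =
      a / 2 * u p ^ 2 + 1 / (2 * a) * v p ^ 2 - u p * v p := by
    field_simp
    ring
  linarith

/-- If the Kullback-Leibler divergence to the model grows quadratically around a parameter `θ₀`
with small divergence, the likelihood equations with moments close to the true ones are solvable,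
and all solutions have small divergence. -/
theorem exists_solution_of_klTilted [DecidableEq ι] (hT : ∀ p, EssBounded P (T p))
    (hw : EssBounded P w) {R b δ c : ℝ} (hR : 0 < R) (hc : 0 < c)
    (hb : klTilted P (familyExponent T w θ₀) ≤ b)
    (hsphere : ∀ θ, ∑ p, (θ p - θ₀ p) ^ 2 = R → c * R ≤ klTilted P (familyExponent T w θ))
    (hμ : ∑ p, (μ p - ∫ x, T p x ∂P) ^ 2 ≤ δ) (hbR : b + 1 / (2 * c) * δ < c / 2 * R) :
    (∃ θ, ∀ p, ∫ x, T p x ∂(P.tilted (familyExponent T w θ)) = μ p) ∧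
    ∀ θ, (∀ p, ∫ x, T p x ∂(P.tilted (familyExponent T w θ)) = μ p) →
      klTilted P (familyExponent T w θ) ≤ b + (R + δ) / 2 := by
  have hsub : ∀ θ : ι → ℝ, ∑ p, (θ p - θ₀ p) * (μ p - ∫ x, T p x ∂P) =
      ∑ p, θ p * (μ p - ∫ x, T p x ∂P) - ∑ p, θ₀ p * (μ p - ∫ x, T p x ∂P) := fun θ => by
    simp only [sub_mul, Finset.sum_sub_distrib]
  obtain ⟨h1, h2⟩ := exists_solution_of_sphere (μ := μ) (θ₀ := θ₀) hT hw hR fun θ hθ => by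
    have h3 := hsphere θ hθ
    -- Young's inequality with weight c, so that half of the growth cR absorbs the linear term.
    have h4 := sum_mul_le_add (fun p => θ p - θ₀ p) (fun p => μ p - ∫ x, T p x ∂P) hc
    have h5 : 1 / (2 * c) * ∑ p, (μ p - ∫ x, T p x ∂P) ^ 2 ≤ 1 / (2 * c) * δ := by gcongr
    rw [hθ, hsub θ] at h4
    rw [negLogLikelihood_eq hT hw, negLogLikelihood_eq hT hw]
    linarith
  refine ⟨h1, fun θ hθ => ?_⟩
  obtain ⟨h3, h4⟩ := h2 θ hθ
  have h5 := sum_mul_le_add (fun p => θ p - θ₀ p) (fun p => μ p - ∫ x, T p x ∂P) one_pos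
  rw [hsub θ] at h5
  rw [negLogLikelihood_eq hT hw, negLogLikelihood_eq hT hw] at h4
  linarith

end Likelihood

/-! ### The additive exponential series model around a density of the class -/

section Model

variable {d : ℕ} {r : Fin d → ℕ} {κ : ℝ} {f : (Fin d → ℝ) → ℝ} {ℓ : Fin d → ℝ → ℝ}
  {m : Fin d → ℕ}

/-- The difference between the log densities (up to a constant) of the model and of the density
with components `ℓ`. -/
def exponentDiff (m : Fin d → ℕ) (ℓ : Fin d → ℝ → ℝ) (θ : ParamIndex m → ℝ) (x : Fin d → ℝ) : ℝ :=
  ∑ i, compDiff m ℓ θ i (x i)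

/-- The offset -∑ ℓ_i cancels the true log density, so tilting the true law by this exponent gives
the model density. -/
lemma familyExponent_eq_exponentDiff (θ : ParamIndex m → ℝ) :
    familyExponent (fun p x => phiVec m x p) (fun x => -∑ i, ℓ i (x i)) θ =
      exponentDiff m ℓ θ := by
  ext x
  simp only [familyExponent, Pi.add_apply, Finset.sum_apply, Pi.smul_apply, smul_eq_mul,
    exponentDiff, compDiff, Finset.sum_sub_distrib, Fintype.sum_sigma, phiVec]
  ring

lemma exponentDiff_update_sub (θ : ParamIndex m → ℝ) (i : Fin d) (x : Fin d → ℝ) (t : ℝ) :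
    exponentDiff m ℓ θ (Function.update x i t) - exponentDiff m ℓ θ x =
      compDiff m ℓ θ i t - compDiff m ℓ θ i (x i) := by
  rw [exponentDiff, exponentDiff, ← Finset.sum_sub_distrib,
    Finset.sum_eq_single i (fun j _ hj => by rw [Function.update_of_ne hj, sub_self])
      (fun h => absurd (Finset.mem_univ i) h), Function.update_self]

lemma exponentDiff_sub_sq_le (hm : ∀ i, 1 ≤ m i) (θ θ' : ParamIndex m → ℝ) {x : Fin d → ℝ}
    (hx : x ∈ simplex d) :
    (exponentDiff m ℓ θ x - exponentDiff m ℓ θ' x) ^ 2 ≤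
      d * nikolskiiConst d * (∑ i, (m i : ℝ)) ^ (2 * d) * ∑ p, (θ p - θ' p) ^ 2 := by
  have hN : 0 ≤ nikolskiiConst d := by unfold nikolskiiConst; positivity
  calc (exponentDiff m ℓ θ x - exponentDiff m ℓ θ' x) ^ 2
      = (∑ i, (compDiff m ℓ θ i (x i) - compDiff m ℓ θ' i (x i))) ^ 2 := by
        rw [exponentDiff, exponentDiff, Finset.sum_sub_distrib]
    _ ≤ (Finset.univ : Finset (Fin d)).card *
        ∑ i, (compDiff m ℓ θ i (x i) - compDiff m ℓ θ' i (x i)) ^ 2 := sq_sum_le_card_mul_sum_sq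
    _ ≤ d * ∑ i, nikolskiiConst d * (∑ i, (m i : ℝ)) ^ (2 * d) *
        ∑ k : Fin (m i), (θ ⟨i, k⟩ - θ' ⟨i, k⟩) ^ 2 := by
        rw [Finset.card_univ, Fintype.card_fin]
        gcongr with i _
        refine (compDiff_sub_sq_le (hm i) θ θ' (hx.1 i)).trans ?_
        have hle : (m i : ℝ) ≤ ∑ i, (m i : ℝ) :=
          Finset.single_le_sum (f := fun i => (m i : ℝ)) (fun j _ => by positivity)
            (Finset.mem_univ i)
        gcongr
    _ = _ := by
        rw [← Finset.mul_sum, Fintype.sum_sigma]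
        ring

/-- Bound for the approximation error of the log densities of the class. -/
def exponentConst (d : ℕ) (r : Fin d → ℕ) (κ : ℝ) : ℝ :=
  ∑ i : Fin d, approxConst (d - 1 - (i : ℕ)) i (r i) (d ! * κ ^ 2)

lemma exponentConst_nonneg (d : ℕ) (r : Fin d → ℕ) (κ : ℝ) : 0 ≤ exponentConst d r κ :=
  Finset.sum_nonneg fun i _ => by unfold approxConst; positivity

/-- Constant for the divergence of the projection of a density of the class to the model. -/
def biasConst (d : ℕ) (r : Fin d → ℕ) (κ : ℝ) : ℝ :=
  Real.exp (exponentConst d r κ) * (densityUpper d κ * (d * (d ! * κ ^ 2 *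
    ∑ i, (r i : ℝ) ^ (2 * r i))))

namespace RegularComponents

lemma continuous_exponentDiff (h : RegularComponents r κ f ℓ) (θ : ParamIndex m → ℝ) :
    Continuous (exponentDiff m ℓ θ) :=
  continuous_finsetSum _ fun i _ =>
    (continuous_compDiff (h.continuous i) θ).comp (continuous_apply i)

lemma essBounded (h : RegularComponents r κ f ℓ) {g : (Fin d → ℝ) → ℝ} (hg : Continuous g) :
    EssBounded (densityMeasure f) g := essBounded_of_continuous h.absolutelyContinuous hg

lemma ae_mem_simplex (h : RegularComponents r κ f ℓ) : ∀ᵐ x ∂(densityMeasure f), x ∈ simplex d :=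
  h.absolutelyContinuous.ae_le (ae_restrict_mem (measurableSet_simplex d))

lemma tilted_exponentDiff (h : RegularComponents r κ f ℓ) (θ : ParamIndex m → ℝ) :
    (densityMeasure f).tilted (exponentDiff m ℓ θ) = densityMeasure (modelDensity m θ) := by
  have := h.isDensity.neZero
  rw [densityMeasure_modelDensity, h.densityMeasure_eq,
    tilted_tilted (integrable_exp_of_continuous_simplex h.continuous_sum)]
  congr 1
  ext x
  rw [← familyExponent_eq_exponentDiff]
  simp only [familyExponent, Pi.add_apply, Finset.sum_apply, Pi.smul_apply, smul_eq_mul]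
  ring

lemma abs_exponentDiff_projParam_le (h : RegularComponents r κ f ℓ) (hm : ∀ i, r i ≤ m i)
    {x : Fin d → ℝ} (hx : x ∈ simplex d) :
    |exponentDiff m ℓ (projParam m ℓ) x| ≤ exponentConst d r κ := by
  refine (Finset.abs_sum_le_sum_abs _ _).trans (Finset.sum_le_sum fun i _ => ?_)
  rw [compDiff_projParam (h.jacobiCoeff_zero i), abs_sub_comm]
  exact h.abs_sub_le i (m i) (hm i) _ (hx.1 i)

/-- The curvature bound. The divergence controls the exponent minus its log moment in L² of the
simplex; the constant cancels in increments, so each component is controlled separately. Summing the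
d components costs a factor d. -/
lemma le_klTilted_exponentDiff (h : RegularComponents r κ f ℓ) (hd : 0 < d)
    (θ : ParamIndex m → ℝ) {M : ℝ} (hM : ∀ x ∈ simplex d, |exponentDiff m ℓ θ x| ≤ M)
    (hM0 : 0 ≤ M) :
    densityLower d κ * additiveConst d / (4 * (1 + 2 * M) * d) *
      ∑ p, (θ p - projParam m ℓ p) ^ 2 ≤ klTilted (densityMeasure f) (exponentDiff m ℓ θ) := by
  have := h.isProbabilityMeasure
  have hcont := h.continuous_exponentDiff (m := m) θ
  refine le_trans ?_ (le_klTilted (h.essBounded hcont) (h.ae_mem_simplex.mono hM))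
  set c := logExpMoment (densityMeasure f) (exponentDiff m ℓ θ)
  have hlow : 0 < densityLower d κ :=
    div_pos (Real.exp_pos _) h.isDensity.measureReal_simplex_pos
  have hd' : (0 : ℝ) < d := by exact_mod_cast hd
  have h1 : ∀ i : Fin d, additiveConst d * ∑ k : Fin (m i),
      (θ ⟨i, k⟩ - projParam m ℓ ⟨i, k⟩) ^ 2 ≤
      ∫ x in simplex d, (exponentDiff m ℓ θ x - c) ^ 2 := fun i =>
    (mul_le_mul_of_nonneg_left (sum_sub_projParam_sq_le (h.continuous i) (h.jacobiCoeff_zero i) θ)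
      (additiveConst_pos d).le).trans
      (integral_weightMeasure_sq_le i (continuous_compDiff (h.continuous i) θ)
        (integral_compDiff (h.continuous i) (h.centered i) θ) (hcont.sub continuous_const)
        fun x t => by
          rw [sub_sub_sub_cancel_right]
          exact exponentDiff_update_sub θ i x t)
  have h2 : additiveConst d * ∑ p, (θ p - projParam m ℓ p) ^ 2 ≤
      d * ∫ x in simplex d, (exponentDiff m ℓ θ x - c) ^ 2 := by
    rw [Fintype.sum_sigma, Finset.mul_sum]
    refine (Finset.sum_le_sum fun i _ => h1 i).trans ?_
    simp
  have h3 : densityLower d κ * ∫ x in simplex d, (exponentDiff m ℓ θ x - c) ^ 2 ≤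
      ∫ x, (exponentDiff m ℓ θ x - c) ^ 2 ∂(densityMeasure f) :=
    h.le_integral_densityMeasure ((hcont.sub continuous_const).pow 2) fun x => sq_nonneg _
  rw [div_mul_eq_mul_div, div_le_div_iff₀ (by positivity) (by positivity)]
  have h4 := mul_le_mul_of_nonneg_left h2 hlow.le
  have h5 := mul_le_mul_of_nonneg_left h3 hd'.le
  have h6 : densityLower d κ * additiveConst d * ∑ p, (θ p - projParam m ℓ p) ^ 2 ≤
      d * ∫ x, (exponentDiff m ℓ θ x - c) ^ 2 ∂(densityMeasure f) := by
    refine le_trans ?_ h5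
    linarith
  have h7 := mul_le_mul_of_nonneg_right h6 (show 0 ≤ 4 * (1 + 2 * M) by positivity)
  linarith

/-- The bias: a bounded sup norm error keeps the exponential factor fixed, so the divergence is of
the order of the squared L² errors of the d projections. -/
lemma klTilted_projParam_le (h : RegularComponents r κ f ℓ) (hm : ∀ i, r i ≤ m i) :
    klTilted (densityMeasure f) (exponentDiff m ℓ (projParam m ℓ)) ≤
      biasConst d r κ * ∑ i, ((m i : ℝ) ^ (2 * r i))⁻¹ := by
  have := h.isProbabilityMeasure
  have hcont := h.continuous_exponentDiff (m := m) (projParam m ℓ)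
  have hup : 0 < densityUpper d κ :=
    div_pos (Real.exp_pos _) h.isDensity.measureReal_simplex_pos
  have hcomp := fun i => continuous_compDiff (m := m) (h.continuous i) (projParam m ℓ)
  refine (klTilted_le (h.essBounded hcont) (h.ae_mem_simplex.mono fun x hx =>
    h.abs_exponentDiff_projParam_le hm hx)).trans ?_
  rw [biasConst, mul_assoc, mul_assoc]
  refine mul_le_mul_of_nonneg_left ?_ (Real.exp_pos _).le
  refine (h.integral_densityMeasure_le (hcont.pow 2) fun x => sq_nonneg _).trans ?_
  refine mul_le_mul_of_nonneg_left ?_ hup.le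
  have hint : ∀ i, Integrable (fun x : Fin d → ℝ => compDiff m ℓ (projParam m ℓ) i (x i) ^ 2)
      (volume.restrict (simplex d)) := fun i =>
    integrable_of_continuous_simplex (((hcomp i).comp (continuous_apply i)).pow 2)
  have h1 : ∫ x in simplex d, exponentDiff m ℓ (projParam m ℓ) x ^ 2 ≤
      d * ∑ i, ∫ x in simplex d, compDiff m ℓ (projParam m ℓ) i (x i) ^ 2 := by
    rw [← integral_finsetSum _ fun i _ => hint i, ← integral_const_mul]
    refine integral_mono (integrable_of_continuous_simplex (hcont.pow 2))
      ((integrable_finsetSum _ fun i _ => hint i).const_mul _) fun x => ?_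
    have := sq_sum_le_card_mul_sum_sq (s := Finset.univ)
      (f := fun i : Fin d => compDiff m ℓ (projParam m ℓ) i (x i))
    simpa only [Finset.card_univ, Fintype.card_fin, exponentDiff] using this
  refine h1.trans ?_
  rw [mul_assoc]
  refine mul_le_mul_of_nonneg_left ?_ (Nat.cast_nonneg d)
  rw [Finset.mul_sum]
  refine Finset.sum_le_sum fun i _ => ?_
  refine (setIntegral_simplex_apply_le i (g := fun t => compDiff m ℓ (projParam m ℓ) i t ^ 2)
    ((hcomp i).pow 2) fun t => sq_nonneg _).trans ?_
  have h2 := h.integral_sq_le i (m i) (hm i)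
  have h3 : ∀ t, compDiff m ℓ (projParam m ℓ) i t ^ 2 =
      (ℓ i t - jacobiProj (d - 1 - (i : ℕ)) i (m i) (ℓ i) t) ^ 2 := fun t => by
    rw [compDiff_projParam (h.jacobiCoeff_zero i)]
    ring
  simp_rw [h3]
  refine h2.trans ?_
  have h4 : (r i : ℝ) ^ (2 * r i) ≤ ∑ i, (r i : ℝ) ^ (2 * r i) :=
    Finset.single_le_sum (f := fun i => (r i : ℝ) ^ (2 * r i)) (fun j _ => by positivity)
      (Finset.mem_univ i)
  rw [div_pow, div_eq_mul_inv, mul_right_comm, mul_comm ((r i : ℝ) ^ (2 * r i))]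
  gcongr

end RegularComponents

/-- For moments close to the true ones, the maximum likelihood estimator exists, and its divergence
is of the order of the sum of the bias and of the deviation of the moments. -/
theorem exists_klDiv_modelDensity_le (hd : 0 < d) (hV : 0 < volume.real (simplex d))
    (r : Fin d → ℕ) (κ : ℝ) :
    ∃ C : ℝ, 0 < C ∧ ∀ (f : (Fin d → ℝ) → ℝ) (ℓ : Fin d → ℝ → ℝ) (_ : RegularComponents r κ f ℓ)
      (m : Fin d → ℕ) (_ : ∀ i, r i ≤ m i) (_ : ∀ i, 1 ≤ m i) (μ : ParamIndex m → ℝ) (δ : ℝ),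
      0 < δ → ∑ p, (μ p - ∫ x, phiVec m x p ∂(densityMeasure f)) ^ 2 ≤ δ →
      C * ((∑ i, (m i : ℝ)) ^ (2 * d) * (∑ i, ((m i : ℝ) ^ (2 * r i))⁻¹ + δ)) ≤ 1 →
      μ ∈ Set.range (meanMap m) ∧ ∀ θ, meanMap m θ = μ →
        InformationTheory.klDiv (densityMeasure f) (densityMeasure (modelDensity m θ)) ≤
          ENNReal.ofReal (C * (∑ i, ((m i : ℝ) ^ (2 * r i))⁻¹ + δ)) := by
  classical
  set A := exponentConst d r κ
  have hA : 0 ≤ A := exponentConst_nonneg d r κ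
  have hd' : (0 : ℝ) < d := by exact_mod_cast hd
  set N := nikolskiiConst d
  have hN : 0 ≤ N := by simp only [N, nikolskiiConst]; positivity
  -- The curvature for exponents bounded by A + 1: A at the projection, plus 1 for the variation
  -- over the ball.
  set c := densityLower d κ * additiveConst d / (4 * (1 + 2 * (A + 1)) * d)
  have hc : 0 < c := by
    have h1 : 0 < densityLower d κ := div_pos (Real.exp_pos _) hV
    have h2 := additiveConst_pos d
    positivity
  set C₂ := biasConst d r κ
  have hC₂ : 0 ≤ C₂ := by
    have : 0 < densityUpper d κ := div_pos (Real.exp_pos _) hV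
    simp only [C₂, biasConst]
    positivity
  -- Chosen so that R = C₃(B + δ) satisfies cR/2 = (C₂ + 1/(2c) + 1)(B + δ); the extra 1 makes the
  -- required inequality strict.
  set C₃ := 2 / c * (C₂ + 1 / (2 * c) + 1)
  have hC₃ : 0 < C₃ := by positivity
  refine ⟨d * N * C₃ + C₂ + C₃ + 1, by positivity, fun f ℓ h m hr hm μ δ hδ hμ hC => ?_⟩
  have := h.isProbabilityMeasure
  have := h.isDensity.neZero
  set B := ∑ i, ((m i : ℝ) ^ (2 * r i))⁻¹
  have hB : 0 ≤ B := Finset.sum_nonneg fun i _ => by positivity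
  set W := (∑ i, (m i : ℝ)) ^ (2 * d)
  have hW : 0 ≤ W := by positivity
  have hT : ∀ p : ParamIndex m, EssBounded (densityMeasure f) fun x => phiVec m x p := fun p =>
    h.essBounded (continuous_phiVec m p)
  have hw : EssBounded (densityMeasure f) fun x => -∑ i, ℓ i (x i) :=
    h.essBounded h.continuous_sum.neg
  have hmean : ∀ θ, (∀ p, ∫ x, phiVec m x p ∂((densityMeasure f).tilted
      (familyExponent (fun p x => phiVec m x p) (fun x => -∑ i, ℓ i (x i)) θ)) = μ p) ↔
      meanMap m θ = μ := fun θ => by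
    rw [familyExponent_eq_exponentDiff, h.tilted_exponentDiff, densityMeasure_modelDensity,
      funext_iff]
    simp_rw [meanMap_eq]
  -- The Nikolskii bound on the sphere: exponents there differ from that of the projection by at
  -- most 1.
  have hRW : d * N * W * (C₃ * (B + δ)) ≤ 1 := by
    refine le_trans ?_ hC
    have : 0 ≤ (C₂ + C₃ + 1) * (W * (B + δ)) := by positivity
    linarith
  obtain ⟨h1, h2⟩ := exists_solution_of_klTilted (μ := μ) (θ₀ := projParam m ℓ)
    (R := C₃ * (B + δ)) (b := C₂ * B) (δ := δ) (c := c) hT hw (by positivity) hc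
    (by rw [familyExponent_eq_exponentDiff]; exact h.klTilted_projParam_le hr)
    (fun θ hθ => by
      rw [familyExponent_eq_exponentDiff, ← hθ]
      refine h.le_klTilted_exponentDiff hd θ (fun x hx => ?_) (by positivity)
      have h3 := h.abs_exponentDiff_projParam_le hr hx
      have h4 := (exponentDiff_sub_sq_le (ℓ := ℓ) hm θ (projParam m ℓ) hx)
      rw [hθ] at h4
      have h5 := (sq_le_one_iff_abs_le_one _).1 (h4.trans hRW)
      calc |exponentDiff m ℓ θ x| = |exponentDiff m ℓ (projParam m ℓ) x +
            (exponentDiff m ℓ θ x - exponentDiff m ℓ (projParam m ℓ) x)| := by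
            rw [add_sub_cancel]
        _ ≤ _ := (abs_add_le _ _).trans (add_le_add h3 h5)) hμ
    (by
      have h3 : c / 2 * (C₃ * (B + δ)) = (C₂ + 1 / (2 * c) + 1) * (B + δ) := by
        simp only [C₃]
        field_simp
      rw [h3]
      have h4 : 0 ≤ C₂ * δ + 1 / (2 * c) * B + B := by positivity
      linarith)
  refine ⟨?_, fun θ hθ => ?_⟩
  · obtain ⟨θ, hθ⟩ := h1
    exact ⟨θ, (hmean θ).1 hθ⟩
  · have h3 := h2 θ ((hmean θ).2 hθ)
    rw [familyExponent_eq_exponentDiff] at h3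
    rw [← h.tilted_exponentDiff, klDiv_tilted (h.essBounded (h.continuous_exponentDiff θ))]
    refine ENNReal.ofReal_le_ofReal (h3.trans ?_)
    have h4 : 0 ≤ d * N * C₃ * (B + δ) + C₂ * δ + C₃ * (B + δ) / 2 + B + δ / 2 := by positivity
    linarith

end Model

/-! ### Fluctuations of the empirical moments -/

section Empirical

variable {d : ℕ} {r : Fin d → ℕ} {κ : ℝ} {f : (Fin d → ℝ) → ℝ} {ℓ : Fin d → ℝ → ℝ}
  {m : Fin d → ℕ} {Ω : Type*} [MeasurableSpace Ω] {P : Measure Ω} {X : ℕ → Ω → Fin d → ℝ}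

lemma IsIIDSample.isProbabilityMeasure [IsProbabilityMeasure (densityMeasure f)]
    (hX : IsIIDSample P X f) : IsProbabilityMeasure P := by
  have h : IsProbabilityMeasure (P.map (X 0)) := by rw [hX.law 0]; infer_instance
  exact Measure.isProbabilityMeasure_of_map (X 0)

namespace RegularComponents

lemma integral_phiVec_sq_le (h : RegularComponents r κ f ℓ) (p : ParamIndex m) :
    ∫ x, phiVec m x p ^ 2 ∂(densityMeasure f) ≤ densityUpper d κ * d ! := by
  have hup : 0 < densityUpper d κ :=
    div_pos (Real.exp_pos _) h.isDensity.measureReal_simplex_pos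
  refine (h.integral_densityMeasure_le ((continuous_phiVec m p).pow 2) fun x => sq_nonneg _).trans
    (mul_le_mul_of_nonneg_left ?_ hup.le)
  refine (setIntegral_simplex_apply_le p.1 (g := fun t => phi d p.1 ((p.2 : ℕ) + 1) t ^ 2)
    ((continuous_phi _ _).pow 2) fun t => sq_nonneg _).trans ?_
  rw [integral_phi_sq]
  exact marginalConst_le d p.1

lemma memLp_phiVec (h : RegularComponents r κ f ℓ) (p : ParamIndex m) :
    MemLp (fun x => phiVec m x p) 2 (densityMeasure f) := by
  have := h.isProbabilityMeasure
  have hb := h.essBounded (continuous_phiVec m p)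
  exact (memLp_two_iff_integrable_sq hb.1.aestronglyMeasurable).2 hb.integrable_sq

lemma memLp_phiVec_sample (h : RegularComponents r κ f ℓ) (hX : IsIIDSample P X f)
    (p : ParamIndex m) (j : ℕ) : MemLp (fun ω => phiVec m (X j ω) p) 2 P := by
  have h1 := h.memLp_phiVec (m := m) p
  rw [← hX.law j] at h1
  exact (memLp_map_measure_iff (continuous_phiVec m p).aestronglyMeasurable
    (hX.measurable j).aemeasurable).1 h1

lemma integral_phiVec_sample (hX : IsIIDSample P X f) {g : (Fin d → ℝ) → ℝ} (hg : Continuous g)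
    (j : ℕ) : ∫ ω, g (X j ω) ∂P = ∫ x, g x ∂(densityMeasure f) := by
  rw [← hX.law j]
  exact (integral_map (hX.measurable j).aemeasurable hg.aestronglyMeasurable).symm

lemma memLp_empiricalMean (h : RegularComponents r κ f ℓ) (hX : IsIIDSample P X f) (n : ℕ)
    (p : ParamIndex m) : MemLp (fun ω => empiricalMean m (fun j : Fin n => X j ω) p) 2 P :=
  (memLp_finsetSum Finset.univ fun (j : Fin n) _ =>
    h.memLp_phiVec_sample hX p (j : ℕ)).const_mul (n : ℝ)⁻¹

/-- The variance of an average of independent terms, whose second moments are bounded independently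
of the degree because the basis is normalised and the density bounded. -/
lemma integral_empiricalMean_sub_sq_le (h : RegularComponents r κ f ℓ) (hX : IsIIDSample P X f)
    {n : ℕ} (hn : 1 ≤ n) (p : ParamIndex m) :
    ∫ ω, (empiricalMean m (fun j : Fin n => X j ω) p -
      ∫ x, phiVec m x p ∂(densityMeasure f)) ^ 2 ∂P ≤ densityUpper d κ * d ! / n := by
  have := h.isProbabilityMeasure
  have hP := hX.isProbabilityMeasure
  have hn' : (0 : ℝ) < n := by exact_mod_cast hn
  set Y : Fin n → Ω → ℝ := fun j ω => phiVec m (X j ω) p with hY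
  have hmem : ∀ j, MemLp (Y j) 2 P := fun j => h.memLp_phiVec_sample hX p j
  have hindep : Set.Pairwise (↑(Finset.univ : Finset (Fin n))) fun i j => IndepFun (Y i) (Y j) P :=
    fun i _ j _ hij => (hX.indep.indepFun (fun hh => hij (Fin.ext hh))).comp
      (continuous_phiVec m p).measurable (continuous_phiVec m p).measurable
  have hmean : ∫ ω, empiricalMean m (fun j : Fin n => X j ω) p ∂P =
      ∫ x, phiVec m x p ∂(densityMeasure f) := by
    simp only [empiricalMean]
    rw [integral_const_mul, integral_finsetSum _ fun j _ => (hmem j).integrable one_le_two]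
    have hj : ∀ j : Fin n, ∫ ω, Y j ω ∂P = ∫ x, phiVec m x p ∂(densityMeasure f) :=
      fun j => integral_phiVec_sample hX (continuous_phiVec m p) j
    simp only [hj, Finset.sum_const, Finset.card_univ, Fintype.card_fin, nsmul_eq_mul]
    field_simp
  rw [← hmean, ← variance_eq_integral (h.memLp_empiricalMean hX n p).1.aemeasurable]
  have h1 : (fun ω => empiricalMean m (fun j : Fin n => X j ω) p) =
      fun ω => (n : ℝ)⁻¹ * (∑ j, Y j) ω := by
    ext ω
    simp only [empiricalMean, Finset.sum_apply, hY]
  rw [h1, variance_const_mul, IndepFun.variance_sum (fun j _ => hmem j) hindep]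
  have h2 : ∀ j, variance (Y j) P ≤ densityUpper d κ * d ! := fun j => by
    refine (variance_le_expectation_sq (hmem j).1).trans ?_
    refine le_trans (le_of_eq ?_) (h.integral_phiVec_sq_le p)
    exact integral_phiVec_sample hX (g := fun x => phiVec m x p ^ 2)
      ((continuous_phiVec m p).pow 2) j
  calc (n : ℝ)⁻¹ ^ 2 * ∑ j, variance (Y j) P
      ≤ (n : ℝ)⁻¹ ^ 2 * ∑ _j : Fin n, densityUpper d κ * d ! := by gcongr with j; exact h2 j
    _ = densityUpper d κ * d ! / n := by
      simp only [Finset.sum_const, Finset.card_univ, Fintype.card_fin, nsmul_eq_mul]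
      field_simp

/-- Chebyshev's inequality for the vector of empirical moments. -/
theorem measure_le_sum_empiricalMean_sub_sq_le (h : RegularComponents r κ f ℓ)
    (hX : IsIIDSample P X f) {n : ℕ} (hn : 1 ≤ n) {δ : ℝ} (hδ : 0 < δ) :
    P {ω | δ ≤ ∑ p, (empiricalMean m (fun j : Fin n => X j ω) p -
      ∫ x, phiVec m x p ∂(densityMeasure f)) ^ 2} ≤
      ENNReal.ofReal (densityUpper d κ * d ! * ((∑ i, (m i : ℝ)) / n) / δ) := by
  have := h.isProbabilityMeasure
  have hP := hX.isProbabilityMeasure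
  have hint : ∀ p : ParamIndex m, Integrable (fun ω => (empiricalMean m (fun j : Fin n => X j ω) p -
      ∫ x, phiVec m x p ∂(densityMeasure f)) ^ 2) P := fun p =>
    ((h.memLp_empiricalMean hX n p).sub (memLp_const _)).integrable_sq
  have h1 := mul_meas_ge_le_integral_of_nonneg (ae_of_all P fun ω =>
    Finset.sum_nonneg (s := Finset.univ) fun (p : ParamIndex m) _ => sq_nonneg (empiricalMean m (fun j : Fin n => X j ω) p -
      ∫ x, phiVec m x p ∂(densityMeasure f))) (integrable_finsetSum _ fun p _ => hint p) δ
  rw [integral_finsetSum _ fun p _ => hint p] at h1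
  have h2 : δ * P.real {ω | δ ≤ ∑ p, (empiricalMean m (fun j : Fin n => X j ω) p -
      ∫ x, phiVec m x p ∂(densityMeasure f)) ^ 2} ≤
      densityUpper d κ * d ! * ((∑ i, (m i : ℝ)) / n) := by
    refine (h1.trans (Finset.sum_le_sum fun p _ =>
      h.integral_empiricalMean_sub_sq_le hX hn p)).trans (le_of_eq ?_)
    simp only [Finset.sum_const, Finset.card_univ, Fintype.card_sigma, Fintype.card_fin,
      nsmul_eq_mul, Nat.cast_sum]
    ring
  rw [← ofReal_measureReal]
  refine ENNReal.ofReal_le_ofReal ?_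
  rw [le_div_iff₀ hδ, mul_comm]
  exact h2

end RegularComponents

end Empirical

/-! ### Tail of the loss of the maximum likelihood estimator -/

section Loss

variable {d : ℕ} {r : Fin d → ℕ} {κ : ℝ}

lemma mleLoss_eq {f : (Fin d → ℝ) → ℝ} {m : Fin d → ℕ} {n : ℕ} {s : Fin n → Fin d → ℝ}
    (h : empiricalMean m s ∈ Set.range (meanMap m)) :
    mleLoss f m s = InformationTheory.klDiv (densityMeasure f)
      (densityMeasure (modelDensity m (mleParam m s))) := if_pos h

lemma meanMap_mleParam {m : Fin d → ℕ} {n : ℕ} {s : Fin n → Fin d → ℝ}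
    (h : empiricalMean m s ∈ Set.range (meanMap m)) :
    meanMap m (mleParam m s) = empiricalMean m s := Function.invFun_eq h

/-- Nonasymptotic bound for the tail of the loss, uniform over the class. -/
theorem exists_measure_mleLoss_le (hd : 0 < d) (hr : ∀ i, d < r i) (hκ : 0 ≤ κ) :
    ∃ C : ℝ, 0 < C ∧ ∀ (f : (Fin d → ℝ) → ℝ) (_ : f ∈ productClass r κ) {Ω : Type*}
      [MeasurableSpace Ω] (P : Measure Ω) (X : ℕ → Ω → Fin d → ℝ) (_ : IsIIDSample P X f)
      (m : Fin d → ℕ) (_ : ∀ i, r i ≤ m i) (n : ℕ) (_ : 1 ≤ n) (K : ℝ) (_ : C ≤ K),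
      C * ((∑ i, (m i : ℝ)) ^ (2 * d) * (∑ i, ((m i : ℝ) ^ (2 * r i))⁻¹ +
        K / (2 * C) * ((∑ i, (m i : ℝ)) / n))) ≤ 1 →
      P {ω | ENNReal.ofReal
          ((∑ i, ((m i : ℝ) ^ (2 * r i))⁻¹ + (∑ i, (m i : ℝ)) / (n : ℝ)) * K) ≤
        mleLoss f m (fun j : Fin n => X j ω)} ≤ ENNReal.ofReal (C ^ 2 / K) := by
  -- If the simplex were null the class would be empty; otherwise the density constants are
  -- positive.
  by_cases hV : 0 < volume.real (simplex d)
  swap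
  · refine ⟨1, one_pos, fun f hf => ?_⟩
    obtain ⟨ℓ, h⟩ := exists_regularComponents hr hκ hf
    exact absurd h.isDensity.measureReal_simplex_pos hV
  obtain ⟨C₁, hC₁, hmle⟩ := exists_klDiv_modelDensity_le hd hV r κ
  have hup : 0 < densityUpper d κ := div_pos (Real.exp_pos _) hV
  set C := C₁ + 2 * (densityUpper d κ * d !) with hC
  have hfac : (0 : ℝ) < d ! := by exact_mod_cast Nat.factorial_pos d
  have hCpos : 0 < C := by positivity
  have hCC : C₁ ≤ C := by rw [hC]; linarith [mul_pos hup hfac]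
  refine ⟨C, hCpos, fun f hf {Ω} _ P X hX m hrm n hn K hK hsmall => ?_⟩
  obtain ⟨ℓ, h⟩ := exists_regularComponents hr hκ hf
  have hm : ∀ i, 1 ≤ m i := fun i => (Nat.one_le_of_lt (hr i)).trans (hrm i)
  have hn' : (0 : ℝ) < n := by exact_mod_cast hn
  have hK0 : 0 < K := hCpos.trans_le hK
  set B := ∑ i, ((m i : ℝ) ^ (2 * r i))⁻¹
  have hB : 0 ≤ B := Finset.sum_nonneg fun i _ => by positivity
  set S := ∑ i, (m i : ℝ)
  have hS : 0 < S := by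
    have := Fin.pos_iff_nonempty.1 hd
    exact Finset.sum_pos (fun i _ => by exact_mod_cast hm i) Finset.univ_nonempty
  -- Half of K·S/n is left for the deviation, Cδ = (K/2)(S/n), so for K ≥ C the divergence bound C(B
  -- + δ) stays strictly below K(B + S/n).
  set δ := K / (2 * C) * (S / n) with hδ
  have hδ0 : 0 < δ := by positivity
  refine (measure_mono (t := {ω | δ ≤ ∑ p, (empiricalMean m (fun j : Fin n => X j ω) p -
      ∫ x, phiVec m x p ∂(densityMeasure f)) ^ 2}) fun ω hω => ?_).trans
    ((h.measure_le_sum_empiricalMean_sub_sq_le hX hn hδ0).trans (ENNReal.ofReal_le_ofReal ?_))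
  · by_contra hlt
    simp only [Set.mem_ofPred_eq, not_le] at hω hlt
    obtain ⟨h1, h2⟩ := hmle f ℓ h m hrm hm _ δ hδ0 hlt.le (le_trans
      (mul_le_mul_of_nonneg_right hCC (by positivity)) hsmall)
    rw [mleLoss_eq h1] at hω
    have h3 := hω.trans (h2 _ (meanMap_mleParam h1))
    have h4 := (ENNReal.ofReal_le_ofReal_iff (by positivity)).1 h3
    have h5 : C * δ = K / 2 * (S / n) := by
      rw [hδ]
      field_simp
    have h6 : 0 < K / 2 * (S / n) := by positivity
    have h7 : C₁ * (B + δ) ≤ C * (B + δ) := mul_le_mul_of_nonneg_right hCC (by positivity)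
    have h8 : C * B ≤ K * B := mul_le_mul_of_nonneg_right hK hB
    linarith
  · have h1 : densityUpper d κ * d ! * (S / n) / δ = 2 * (densityUpper d κ * d !) * C / K := by
      rw [hδ]
      field_simp
    rw [h1, sq]
    gcongr
    rw [hC]
    linarith

end Loss

end

end SimplexSeries

/-! ### Passage to the limit, uniformly over the class. -/

open SimplexSeries
theorem mainTheorem2 {d : ℕ} (hd : 2 ≤ d) (r : Fin d → ℕ) (hr : ∀ i, d < r i)
    (κ : ℝ) (hκ : 0 < κ)
    (m : ℕ → Fin d → ℕ) (hm_pos : ∀ n, 1 ≤ n → ∀ i, 1 ≤ m n i)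
    (hm_top : ∀ i, Tendsto (fun n => m n i) atTop atTop)
    (hm_bias : Tendsto
      (fun n => (∑ i, (m n i : ℝ)) ^ (2 * d) * ∑ i, ((m n i : ℝ) ^ (2 * r i))⁻¹) atTop (𝓝 0))
    (hm_var : Tendsto (fun n : ℕ => (∑ i, (m n i : ℝ)) ^ (2 * d + 1) / (n : ℝ)) atTop (𝓝 0))
    -- for every density `f` in the class, an i.i.d. sequence with density `f`
    {Ω : ((Fin d → ℝ) → ℝ) → Type*} [∀ f, MeasurableSpace (Ω f)]
    (P : ∀ f, Measure (Ω f)) (X : ∀ f, ℕ → Ω f → Fin d → ℝ)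
    (hX : ∀ f ∈ productClass r κ, IsIIDSample (P f) (X f) f) :
    Tendsto
      (fun K : ℝ => limsup
        (fun n : ℕ => ⨆ f ∈ productClass r κ,
          P f {ω | ENNReal.ofReal
              ((∑ i, ((m n i : ℝ) ^ (2 * r i))⁻¹ + (∑ i, (m n i : ℝ)) / (n : ℝ)) * K) ≤
            mleLoss f (m n) (fun j : Fin n => X f j ω)})
        atTop)
      atTop (𝓝 0) := by
  obtain ⟨C, hC, hbound⟩ := exists_measure_mleLoss_le (d := d) (by omega) hr hκ.le
  have hlim : Tendsto (fun K : ℝ => ENNReal.ofReal (C ^ 2 / K)) atTop (𝓝 0) := by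
    rw [← ENNReal.ofReal_zero]
    exact ENNReal.tendsto_ofReal (tendsto_const_nhds.div_atTop tendsto_id)
  refine tendsto_of_tendsto_of_tendsto_of_le_of_le' tendsto_const_nhds hlim
    (Eventually.of_forall fun _ => zero_le) ?_
  filter_upwards [eventually_ge_atTop C] with K hK
  -- For fixed K the two growth conditions make the smallness requirement hold for large n; the
  -- second one carries the extra power 2d + 1 from |m|^(2d) · |m|/n.
  have hsmall : Tendsto (fun n : ℕ => C * ((∑ i, (m n i : ℝ)) ^ (2 * d) *
      (∑ i, ((m n i : ℝ) ^ (2 * r i))⁻¹ + K / (2 * C) * ((∑ i, (m n i : ℝ)) / n))))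
      atTop (𝓝 0) := by
    have h := (hm_bias.add (hm_var.const_mul (K / (2 * C)))).const_mul C
    simp only [mul_zero, add_zero] at h
    refine h.congr fun n => ?_
    rw [pow_succ]
    ring
  refine limsup_le_of_le (h := ?_)
  filter_upwards [hsmall.eventually (eventually_le_nhds one_pos), eventually_ge_atTop 1,
    eventually_all.2 fun i => (hm_top i).eventually (eventually_ge_atTop (r i))] with n h1 hn hrm
  exact iSup₂_le fun f hf => hbound f hf (P f) (X f) (hX f hf) (m n) hrm n hn K hK h1
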